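/- **Ribbon graphs.** A ribbon graph $\Gamma$ is a finite set of half-edges with a permutation $\sigma$, whose cycles are the vertices with the cyclic ordering of their half-edges, and an involution $\alpha$, whose 2-cycles are the internal edges and whose fixed points are the external edges. Its faces are the cycles of $\sigma\alpha$; a face is broken if it contains an external edge. If $\Gamma$ is connected with $V$ vertices, $I$ internal edges and $F$ faces, its genus $g$ is given by $2-2g=V-I+F$; it is planar if $g=0$, and a planar graph is regular if it has exactly one broken face. Two connected ribbon graphs are isomorphic if there is a bijection of the half-edges that commutes with the involutions and carries $\sigma$ either to $\sigma'$ or to $\sigma'^{-1}$ (a homeomorphism of ribbon surfaces, which may reverse the orientation). A 1PI ribbon Feynman graph (of the Grosse–Wulkenhaar $\Phi^4$ model) is a connected ribbon graph with all vertices of valence $4$ and at least one internal edge, which stays connected when any one internal edge is cut into two external edges. **Subgraphs and shrinking.** A subgraph $\gamma\subset\Gamma$ is a set of internal edges of $\Gamma$ together with the vertices hooked to them; the other half-edges at these vertices are its external edges. Let $\underline\Gamma$ be the set of subgraphs $\gamma$ of $\Gamma$, with edge set neither empty nor full, all of whose connected components are 1PI, planar regular, and have $2$ or $4$ external edges. The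 cograph $\Gamma/\gamma$ is obtained by replacing each component of $\gamma$ with $4$ external edges by a vertex, whose half-edges are these external edges in the cyclic order in which they occur along the broken face of the component, and each component with $2$ external edges by an edge (merging with the adjacent edges into a single edge). If $\Gamma$ has no external edges, those $\gamma$ for which this would leave a closed line without vertices are not included in $\underline\Gamma$. **Theorem.** Let $K$ be a field and let $\mathcal H^\star$ be the free commutative unital $K$-algebra on the isomorphism classes of 1PI ribbon Feynman graphs, where a disjoint union of such graphs is identified with the product of its components and the empty graph with $1$. For every 1PI ribbon Feynman graph $\Gamma$ and $\gamma\in\underline\Gamma$, the components of $\gamma$ and the cograph $\Gamma/\gamma$ are 1PI ribbon Feynman graphs. There are well-defined algebra homomorphisms $\Delta:\mathcal H^\star\to\mathcal H^\star\otimes\mathcal H^\star$, $\varepsilon:\mathcal H^\star\to K$ and $S:\mathcal H^\star\to\mathcal H^\star$ given on each 1PI ribbon Feynman graph $\Gamma$ by $$\Delta\Gamma=\Gamma\otimes1+1\otimes\Gamma+\sum_{\gamma\in\underline\Gamma}\gamma\otimes\Gamma/\gamma,\qquad \varepsilon(\Gamma)=0,\qquad S(\Gamma)=-\Gamma-\sum_{\gamma\in\underline\Gamma}S(\gamma)\,\Gamma/\gamma,$$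 the last one recursively in the number of internal edges. The quadruple $(\mathcal H^\star,\Delta,\varepsilon,S)$ is a Hopf algebra: $\Delta$ is coassociative, $\varepsilon$ is a counit for $\Delta$, $\Delta$ and $\varepsilon$ are unital algebra homomorphisms, and $m(S\otimes\mathrm{id})\Delta=u\varepsilon=m(\mathrm{id}\otimes S)\Delta$. -/

import Mathlib

open scoped TensorProduct

noncomputable section

/-! ### First-return permutations -/

namespace FirstReturn

variable {X : Type}

/-- The least `n ≥ 1` with `pⁿ x ∈ s`. -/
def time (p : Equiv.Perm X) (s : Set X) (x : X) : ℕ :=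
  sInf {n | 0 < n ∧ (p ^ n) x ∈ s}

theorem time_spec [Finite X] (p : Equiv.Perm X) (s : Set X) {x : X} (hx : x ∈ s) :
    0 < time p s x ∧ (p ^ time p s x) x ∈ s := by
  have hne : {n | 0 < n ∧ (p ^ n) x ∈ s}.Nonempty :=
    ⟨orderOf p, orderOf_pos p, by simpa [pow_orderOf_eq_one] using hx⟩
  exact Nat.sInf_mem hne

theorem time_le (p : Equiv.Perm X) (s : Set X) {x : X} {n : ℕ} (h0 : 0 < n)
    (hn : (p ^ n) x ∈ s) : time p s x ≤ n :=
  Nat.sInf_le ⟨h0, hn⟩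

/-- The first-return map of the permutation `p` to the set `s`, as a map `s → s`. -/
def map [Finite X] (p : Equiv.Perm X) (s : Set X) (x : s) : s :=
  ⟨(p ^ time p s x) x, (time_spec p s x.2).2⟩

theorem map_inv_map [Finite X] (p : Equiv.Perm X) (s : Set X) (x : s) :
    map p⁻¹ s (map p s x) = x := by
  obtain ⟨x, hx⟩ := x
  obtain ⟨h0, hm⟩ := time_spec p s hx
  set m := time p s x with hmdef
  have hback : ∀ k, k ≤ m → (p⁻¹ ^ k) ((p ^ m) x) = (p ^ (m - k)) x := by
    intro k hk
    obtain ⟨j, hj⟩ := Nat.exists_eq_add_of_le hk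
    rw [hj, pow_add, Equiv.Perm.mul_apply, ← Equiv.Perm.mul_apply, inv_pow, inv_mul_cancel]
    simp
  have hle : time p⁻¹ s ((p ^ m) x) ≤ m :=
    time_le _ _ h0 (by rw [hback m le_rfl]; simpa using hx)
  have heq : time p⁻¹ s ((p ^ m) x) = m := by
    obtain ⟨k0, hk⟩ := time_spec p⁻¹ s hm
    rw [hback _ hle] at hk
    by_contra hlt
    have := time_le p s (by omega : 0 < m - time p⁻¹ s ((p ^ m) x)) hk
    omega
  apply Subtype.ext
  change (p⁻¹ ^ time p⁻¹ s ((p ^ m) x)) ((p ^ m) x) = x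
  rw [heq, hback m le_rfl]
  simp

/-- The first-return map is a permutation of `s`; its inverse is the first-return map of `p⁻¹`. -/
def perm [Finite X] (p : Equiv.Perm X) (s : Set X) : Equiv.Perm s where
  toFun := map p s
  invFun := map p⁻¹ s
  left_inv := map_inv_map p s
  right_inv x := by simpa using map_inv_map p⁻¹ s x

/-- If `a` and `t` are involutions and `t` fixes `s` pointwise, then the first-return map of
`a * t` to `s` is an involution. -/
theorem perm_perm_of_involutive [Finite X] (a t : Equiv.Perm X) (s : Set X) (ha : ∀ x, a (a x) = x)
    (ht : ∀ x, t (t x) = x) (hts : ∀ x ∈ s, t x = x) (x : s) :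
    perm (a * t) s (perm (a * t) s x) = x := by
  have haa : a⁻¹ = a := by
    ext y; rw [Equiv.Perm.inv_eq_iff_eq, ha]
  have htt : t⁻¹ = t := by
    ext y; rw [Equiv.Perm.inv_eq_iff_eq, ht]
  have hinv : (a * t)⁻¹ = t * (a * t) * t⁻¹ := by
    rw [mul_inv_rev, haa, htt, mul_assoc, mul_assoc]
    have : t * t = 1 := by ext y; simp [ht]
    rw [this, mul_one]
  have hpow : ∀ (n : ℕ) (y : X), y ∈ s → ((a * t)⁻¹ ^ n) y = t (((a * t) ^ n) y) := by
    intro n y hy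
    rw [hinv, conj_pow, Equiv.Perm.mul_apply, Equiv.Perm.mul_apply, htt, hts y hy]
  have hmem : ∀ y : X, t y ∈ s ↔ y ∈ s := by
    intro y
    constructor
    · intro h
      have h' := hts _ h
      rw [ht] at h'
      rwa [← h'] at h
    · intro h
      rwa [hts y h]
  have hmap : ∀ y : s, map (a * t)⁻¹ s y = map (a * t) s y := by
    rintro ⟨y, hy⟩
    have htime : time (a * t)⁻¹ s y = time (a * t) s y := by
      unfold time
      congr 1
      ext n
      simp only [Set.mem_ofPred_eq, hpow n y hy, hmem]
    apply Subtype.ext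
    change ((a * t)⁻¹ ^ time (a * t)⁻¹ s y) y = ((a * t) ^ time (a * t) s y) y
    rw [htime, hpow _ y hy, hts _ (time_spec (a * t) s hy).2]
  change map (a * t) s (map (a * t) s x) = x
  rw [← hmap (map (a * t) s x), map_inv_map]

end FirstReturn

/-! ### Ribbon graphs -/

/-- A ribbon graph with internal and external edges: a finite set of half-edges, a permutation
`rot` whose cycles are the vertices with the cyclic ordering of the half-edges incident to them,
and an involution `flip` whose 2-cycles are the internal edges and whose fixed points are the
external edges. -/
structure RibbonGraph where
  HalfEdge : Type
  finite : Finite HalfEdge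
  rot : Equiv.Perm HalfEdge
  flip : Equiv.Perm HalfEdge
  flip_flip : ∀ h, flip (flip h) = h

namespace RibbonGraph

instance (G : RibbonGraph) : Finite G.HalfEdge := G.finite

/-- Vertices are the cycles of `rot`. -/
abbrev Vertex (G : RibbonGraph) : Type := Quotient (Equiv.Perm.SameCycle.setoid G.rot)

/-- Faces, that is boundary components of the surface, are the cycles of `rot * flip`: walk along
one side of an edge (of a dangling ribbon, for an external edge), then go to the next half-edge at
the vertex reached. -/
abbrev Face (G : RibbonGraph) : Type := Quotient (Equiv.Perm.SameCycle.setoid (G.rot * G.flip))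

def numVertices (G : RibbonGraph) : ℕ := Nat.card G.Vertex

def numFaces (G : RibbonGraph) : ℕ := Nat.card G.Face

/-- Number of half-edges that belong to internal edges. -/
def numInternalHalfEdges (G : RibbonGraph) : ℕ := Nat.card {h : G.HalfEdge // G.flip h ≠ h}

def numExternalEdges (G : RibbonGraph) : ℕ := Nat.card {h : G.HalfEdge // G.flip h = h}

/-- Number of faces broken by at least one external edge. -/
def numBrokenFaces (G : RibbonGraph) : ℕ :=
  Nat.card {f : G.Face // ∃ h : G.HalfEdge, G.flip h = h ∧ Quotient.mk _ h = f}

/-- The genus `g` of a connected ribbon graph, given by `2 - 2 g = V - I + F`. -/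
def genus (G : RibbonGraph) : ℚ :=
  (2 - ((G.numVertices : ℚ) - (G.numInternalHalfEdges : ℚ) / 2 + (G.numFaces : ℚ))) / 2

/-- The equivalence relation whose classes are the connected components. -/
def connSetoid (G : RibbonGraph) : Setoid G.HalfEdge :=
  Relation.EqvGen.setoid fun a b => b = G.rot a ∨ b = G.flip a

def IsConnected (G : RibbonGraph) : Prop :=
  Nonempty G.HalfEdge ∧ ∀ a b : G.HalfEdge, G.connSetoid a b

/-- Every vertex has valence four. -/
def IsQuartic (G : RibbonGraph) : Prop :=
  ∀ h : G.HalfEdge, Function.minimalPeriod G.rot h = 4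

/-- A set of internal edges of `G`, given by the set of its half-edges. -/
abbrev EdgeSet (G : RibbonGraph) : Type :=
  {D : Set G.HalfEdge // ∀ h ∈ D, G.flip h ∈ D ∧ G.flip h ≠ h}

theorem flip_mem_iff (G : RibbonGraph) (D : G.EdgeSet) (h : G.HalfEdge) :
    G.flip h ∈ D.1 ↔ h ∈ D.1 := by
  constructor
  · intro hh
    have := (D.2 _ hh).1
    rwa [G.flip_flip] at this
  · intro hh
    exact (D.2 _ hh).1

open Classical in
/-- `flip` on the edges of `D`, the identity on all the other half-edges. -/
def flipOn (G : RibbonGraph) (D : G.EdgeSet) : Equiv.Perm G.HalfEdge :=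
  Function.Involutive.toPerm (fun h => if h ∈ D.1 then G.flip h else h) (by
    intro h
    by_cases hh : h ∈ D.1
    · simp [hh, G.flip_mem_iff D h, G.flip_flip]
    · simp [hh])

/-- The graph with the same vertices as `G` in which the internal edges outside `D` are cut, each
of them into two external edges. -/
def cutOutside (G : RibbonGraph) (D : G.EdgeSet) : RibbonGraph where
  HalfEdge := G.HalfEdge
  finite := G.finite
  rot := G.rot
  flip := G.flipOn D
  flip_flip := by
    intro h
    exact (G.flipOn D).left_inv h

/-- All the internal edges other than the one containing `h`. -/
def edgesExcept (G : RibbonGraph) (h : G.HalfEdge) : G.EdgeSet :=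
  ⟨{x | G.flip x ≠ x ∧ x ≠ h ∧ x ≠ G.flip h}, by
    rintro x ⟨h1, h2, h3⟩
    refine ⟨⟨?_, ?_, ?_⟩, h1⟩
    · rw [G.flip_flip]; exact h1.symm
    · rintro rfl; exact h3 (G.flip_flip x).symm
    · exact fun hx => h2 (G.flip.injective hx)⟩

/-- One-particle irreducible: connected, with at least one internal edge, and still connected
after cutting any one internal edge. -/
def Is1PI (G : RibbonGraph) : Prop :=
  G.IsConnected ∧ (∃ h, G.flip h ≠ h) ∧
    ∀ h, G.flip h ≠ h → (G.cutOutside (G.edgesExcept h)).IsConnected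

/-- A 1PI ribbon Feynman graph of the quartic model. -/
def IsFeynman1PI (G : RibbonGraph) : Prop := G.IsQuartic ∧ G.Is1PI

/-- Planar regular (genus zero and exactly one broken face), with two or four external edges. -/
def IsPrimitivelyDivergent (G : RibbonGraph) : Prop :=
  G.genus = 0 ∧ G.numBrokenFaces = 1 ∧ (G.numExternalEdges = 2 ∨ G.numExternalEdges = 4)

/-! ### Subgraphs and their components -/

theorem connSetoid_rot (G : RibbonGraph) (h : G.HalfEdge) : G.connSetoid h (G.rot h) :=
  Relation.EqvGen.rel _ _ (Or.inl rfl)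

theorem connSetoid_flip (G : RibbonGraph) (h : G.HalfEdge) : G.connSetoid h (G.flip h) :=
  Relation.EqvGen.rel _ _ (Or.inr rfl)

/-- A connected component of `G` as a ribbon graph of its own. -/
def component (G : RibbonGraph) (c : Quotient G.connSetoid) : RibbonGraph where
  HalfEdge := {h : G.HalfEdge // Quotient.mk G.connSetoid h = c}
  finite := inferInstance
  rot := G.rot.subtypePerm fun h => by
    rw [Quotient.sound (s := G.connSetoid) (G.connSetoid_rot h)]
  flip := G.flip.subtypePerm fun h => by
    rw [Quotient.sound (s := G.connSetoid) (G.connSetoid_flip h)]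
  flip_flip := by
    rintro ⟨h, hh⟩
    exact Subtype.ext (G.flip_flip h)

/-- The connected components of the subgraph with edge set `D`. The subgraph has only the vertices
hooked to the edges of `D`, so these are the components of `G.cutOutside D` that meet `D`. -/
abbrev SubComponent (G : RibbonGraph) (D : G.EdgeSet) : Type :=
  {c : Quotient (G.cutOutside D).connSetoid //
    ∃ h : G.HalfEdge, h ∈ D.1 ∧ Quotient.mk (G.cutOutside D).connSetoid h = c}

instance (G : RibbonGraph) (D : G.EdgeSet) : Finite (G.SubComponent D) :=
  inferInstanceAs (Finite {c : Quotient (G.cutOutside D).connSetoid //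
    ∃ h : G.HalfEdge, h ∈ D.1 ∧ Quotient.mk (G.cutOutside D).connSetoid h = c})

instance (G : RibbonGraph) (D : G.EdgeSet) : Fintype (G.SubComponent D) := Fintype.ofFinite _

def subComponent (G : RibbonGraph) (D : G.EdgeSet) (c : G.SubComponent D) : RibbonGraph :=
  (G.cutOutside D).component c.1

/-! ### Shrinking -/

/-- Shrink each component of the subgraph with edge set `D` to a vertex. The half-edges at the new
vertices are the external edges of the components, in the cyclic order in which they are met along
the broken face of the component; the other vertices are unchanged. -/
def contract (G : RibbonGraph) (D : G.EdgeSet) : RibbonGraph where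
  HalfEdge := {h : G.HalfEdge // h ∈ (D.1)ᶜ}
  finite := inferInstance
  rot := FirstReturn.perm (G.rot * G.flipOn D) (D.1)ᶜ
  flip := G.flip.subtypePerm fun h => not_congr (G.flip_mem_iff D h)
  flip_flip := by
    rintro ⟨h, hh⟩
    exact Subtype.ext (G.flip_flip h)

/-- The half-edges at vertices of valence two. -/
def bivalent (G : RibbonGraph) : Set G.HalfEdge := {h | G.rot h ≠ h ∧ G.rot (G.rot h) = h}

theorem rot_mem_bivalent (G : RibbonGraph) (h : G.HalfEdge) :
    G.rot h ∈ G.bivalent ↔ h ∈ G.bivalent := by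
  simp only [bivalent, Set.mem_ofPred_eq, ne_eq, EmbeddingLike.apply_eq_iff_eq]

open Classical in
/-- `rot` at the vertices of valence two, the identity on all the other half-edges. -/
def crossBivalent (G : RibbonGraph) : Equiv.Perm G.HalfEdge :=
  Function.Involutive.toPerm (fun h => if h ∈ G.bivalent then G.rot h else h) (by
    intro h
    by_cases hh : h ∈ G.bivalent
    · simp only [hh, if_true, G.rot_mem_bivalent h]
      exact hh.2
    · simp [hh])

/-- Erase the vertices of valence two: each maximal chain of edges that passes through such
vertices becomes a single edge. -/
def eraseBivalent (G : RibbonGraph) : RibbonGraph where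
  HalfEdge := {h : G.HalfEdge // h ∈ (G.bivalent)ᶜ}
  finite := inferInstance
  rot := G.rot.subtypePerm fun h => not_congr (G.rot_mem_bivalent h)
  flip := FirstReturn.perm (G.flip * G.crossBivalent) (G.bivalent)ᶜ
  flip_flip := FirstReturn.perm_perm_of_involutive _ _ _ G.flip_flip
    (fun x => G.crossBivalent.left_inv x) (by
      intro x hx
      have hx' : x ∉ G.bivalent := hx
      exact if_neg hx')

/-- The cograph: components with four external edges are replaced by a vertex, those with two
external edges by an edge. -/
def shrink (G : RibbonGraph) (D : G.EdgeSet) : RibbonGraph := (G.contract D).eraseBivalent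

/-- The edge sets of the primitively divergent subgraphs which the coproduct of `G` sums over:
neither empty nor full, with all components 1PI and primitively divergent. The last condition only
matters if `G` has no external edges; it says that the subgraph is not a closed chain of components
with two external edges, shrinking which would leave a closed line without vertices. -/
def divergentSubgraphs (G : RibbonGraph) : Finset G.EdgeSet :=
  Set.Finite.toFinset (s := {D : G.EdgeSet |
    D.1.Nonempty ∧ D.1 ≠ {h | G.flip h ≠ h} ∧
    (∀ c, (G.subComponent D c).Is1PI ∧ (G.subComponent D c).IsPrimitivelyDivergent) ∧
    Nonempty (G.shrink D).HalfEdge}) (Set.toFinite _)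

/-! ### Isomorphism -/

/-- A homeomorphism mapping vertices to vertices and edges to edges: it preserves incidence and
either preserves or reverses all the cyclic orderings (the graphs compared below are connected, and
their surfaces are orientable but carry no preferred orientation). -/
def Isomorphic (G G' : RibbonGraph) : Prop :=
  ∃ e : G.HalfEdge ≃ G'.HalfEdge, (∀ h, e (G.flip h) = G'.flip (e h)) ∧
    ((∀ h, e (G.rot h) = G'.rot (e h)) ∨ (∀ h, e (G.rot h) = G'.rot.symm (e h)))

theorem Isomorphic.refl (G : RibbonGraph) : Isomorphic G G :=
  ⟨Equiv.refl _, fun _ => rfl, Or.inl fun _ => rfl⟩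

theorem Isomorphic.symm {G G' : RibbonGraph} (h : Isomorphic G G') : Isomorphic G' G := by
  obtain ⟨e, hf, hr⟩ := h
  refine ⟨e.symm, fun x => ?_, ?_⟩
  · rw [Equiv.symm_apply_eq, hf, Equiv.apply_symm_apply]
  · refine hr.imp (fun hr x => ?_) (fun hr x => ?_)
    · rw [Equiv.symm_apply_eq, hr, Equiv.apply_symm_apply]
    · have := hr (G.rot.symm (e.symm x))
      rw [Equiv.apply_symm_apply, Equiv.apply_symm_apply, Equiv.eq_symm_apply] at this
      rw [Equiv.symm_apply_eq, this]

theorem Isomorphic.trans {G G' G'' : RibbonGraph} (h : Isomorphic G G') (h' : Isomorphic G' G'') :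
    Isomorphic G G'' := by
  obtain ⟨e, hf, hr⟩ := h
  obtain ⟨e', hf', hr'⟩ := h'
  have hs : ∀ {A B : RibbonGraph} (i : A.HalfEdge ≃ B.HalfEdge),
      (∀ x, i (A.rot x) = B.rot (i x)) → ∀ x, i (A.rot.symm x) = B.rot.symm (i x) := by
    intro A B i hi x
    rw [Equiv.eq_symm_apply, ← hi, Equiv.apply_symm_apply]
  have hs' : ∀ {A B : RibbonGraph} (i : A.HalfEdge ≃ B.HalfEdge),
      (∀ x, i (A.rot x) = B.rot.symm (i x)) → ∀ x, i (A.rot.symm x) = B.rot (i x) := by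
    intro A B i hi x
    rw [← Equiv.symm_apply_eq, ← hi, Equiv.apply_symm_apply]
  refine ⟨e.trans e', fun x => ?_, ?_⟩
  · simp [hf, hf']
  · rcases hr with hr | hr <;> rcases hr' with hr' | hr'
    · exact Or.inl fun x => by simp [hr, hr']
    · exact Or.inr fun x => by simp [hr, hr']
    · exact Or.inr fun x => by simp [hr, hs e' hr']
    · exact Or.inl fun x => by simp [hr, hs' e' hr']

theorem Isomorphic.numInternalHalfEdges_eq {G G' : RibbonGraph} (h : Isomorphic G G') :
    G.numInternalHalfEdges = G'.numInternalHalfEdges := by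
  obtain ⟨e, hf, -⟩ := h
  refine Nat.card_congr (e.subtypeEquiv fun x => ?_)
  rw [← hf]
  simp

/-- The components of a proper subgraph have fewer internal edges than the graph. -/
theorem numInternalHalfEdges_subComponent_lt (G : RibbonGraph) (D : G.EdgeSet)
    (hD : D ∈ G.divergentSubgraphs) (c : G.SubComponent D) :
    (G.subComponent D c).numInternalHalfEdges < G.numInternalHalfEdges := by
  have hD' : D.1 ≠ {h | G.flip h ≠ h} := by
    have := (Set.Finite.mem_toFinset _).1 hD
    exact this.2.1
  have hss : D.1 ⊂ {h | G.flip h ≠ h} :=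
    (Set.ssubset_iff_subset_ne).2 ⟨fun h hh => (D.2 h hh).2, hD'⟩
  have hlt : D.1.ncard < {h | G.flip h ≠ h}.ncard := Set.ncard_lt_ncard hss (Set.toFinite _)
  refine lt_of_le_of_lt ?_ hlt
  let f : {h : (G.subComponent D c).HalfEdge // (G.subComponent D c).flip h ≠ h} → D.1 :=
    fun h => ⟨h.1.1, by
      by_contra hn
      exact h.2 (Subtype.ext (by
        change G.flipOn D h.1.1 = h.1.1
        exact if_neg hn))⟩
  have hf : Function.Injective f := fun a b hab => by
    have : a.1.1 = b.1.1 := congrArg (fun x : D.1 => x.1) hab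
    exact Subtype.ext (Subtype.ext this)
  exact Nat.card_le_card_of_injective f hf

end RibbonGraph

/-! ### The algebra -/

instance feynmanSetoid : Setoid {G : RibbonGraph // G.IsFeynman1PI} where
  r G G' := RibbonGraph.Isomorphic G.1 G'.1
  iseqv := ⟨fun G => .refl G.1, .symm, .trans⟩

/-- Isomorphism classes of 1PI ribbon Feynman graphs. -/
abbrev FeynmanClass : Type 1 := Quotient feynmanSetoid

/-- The free commutative algebra on the 1PI ribbon Feynman graphs; monomials are disjoint unions of
graphs and `1` is the empty graph. -/
abbrev HStar (K : Type*) [Field K] := MvPolynomial FeynmanClass K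

namespace HStar

variable (K : Type*) [Field K]

open Classical in
/-- A 1PI ribbon Feynman graph as a generator of the algebra (and `0` for other ribbon graphs). -/
def ofGraph (G : RibbonGraph) : HStar K :=
  if h : G.IsFeynman1PI then MvPolynomial.X (Quotient.mk feynmanSetoid ⟨G, h⟩) else 0

/-- A subgraph as an element of the algebra: the product of its connected components. -/
def ofSubgraph (G : RibbonGraph) (D : G.EdgeSet) : HStar K :=
  ∏ c, ofGraph K (G.subComponent D c)

/-- The reduced coproduct of a graph: the sum of `γ ⊗ Γ/γ` over the primitively divergent
subgraphs `γ` of `Γ`. -/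
def reducedCoproduct (G : RibbonGraph) : HStar K ⊗[K] HStar K :=
  ∑ D ∈ G.divergentSubgraphs, ofSubgraph K G D ⊗ₜ[K] ofGraph K (G.shrink D)

/-- The coproduct: the algebra homomorphism with `Γ ↦ Γ ⊗ 1 + 1 ⊗ Γ + Δ' Γ` on generators. -/
def coproduct : HStar K →ₐ[K] HStar K ⊗[K] HStar K :=
  MvPolynomial.aeval fun g =>
    MvPolynomial.X g ⊗ₜ[K] 1 + 1 ⊗ₜ[K] MvPolynomial.X g + reducedCoproduct K g.out.1

/-- The counit: the algebra homomorphism that vanishes on all generators. -/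
def counit : HStar K →ₐ[K] K := MvPolynomial.aeval fun _ => 0

open Classical in
/-- The antipode on generators, by recursion on the number of internal edges:
`S Γ = - Γ - ∑ S(γ) Γ/γ`, where `S(γ)` is the product of `S` over the components of `γ`. -/
def antipodeGen (g : FeynmanClass) : HStar K :=
  - MvPolynomial.X g - ∑ D ∈ g.out.1.divergentSubgraphs.attach,
    (∏ c, if h : (g.out.1.subComponent D.1 c).IsFeynman1PI then
        antipodeGen (Quotient.mk feynmanSetoid ⟨g.out.1.subComponent D.1 c, h⟩) else 0) *
      ofGraph K (g.out.1.shrink D.1)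
termination_by g.out.1.numInternalHalfEdges
decreasing_by
  have hiso : RibbonGraph.Isomorphic
      (Quotient.mk feynmanSetoid ⟨g.out.1.subComponent D.1 c, h⟩).out.1
      (g.out.1.subComponent D.1 c) :=
    Quotient.mk_out (s := feynmanSetoid) ⟨g.out.1.subComponent D.1 c, h⟩
  rw [hiso.numInternalHalfEdges_eq]
  exact RibbonGraph.numInternalHalfEdges_subComponent_lt _ _ D.2 c

/-- The antipode, extended multiplicatively from the generators. -/
def antipode : HStar K →ₐ[K] HStar K := MvPolynomial.aeval (antipodeGen K)

end HStar

/-! ### Hopf algebras -/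

/-- The linear maps `Δ`, `ε`, `S` make the `R`-algebra `A` a Hopf algebra. -/
structure IsHopfAlgebra (R A : Type*) [CommSemiring R] [Semiring A] [Algebra R A]
    (Δ : A →ₗ[R] A ⊗[R] A) (ε : A →ₗ[R] R) (S : A →ₗ[R] A) : Prop where
  coassoc : TensorProduct.assoc R A A A ∘ₗ Δ.rTensor A ∘ₗ Δ = Δ.lTensor A ∘ₗ Δ
  counit_left : ε.rTensor A ∘ₗ Δ = TensorProduct.mk R R A 1
  counit_right : ε.lTensor A ∘ₗ Δ = (TensorProduct.mk R A R).flip 1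
  comul_one : Δ 1 = 1
  comul_mul : ∀ a b, Δ (a * b) = Δ a * Δ b
  counit_one : ε 1 = 1
  counit_mul : ∀ a b, ε (a * b) = ε a * ε b
  antipode_left : LinearMap.mul' R A ∘ₗ S.rTensor A ∘ₗ Δ = Algebra.linearMap R A ∘ₗ ε
  antipode_right : LinearMap.mul' R A ∘ₗ S.lTensor A ∘ₗ Δ = Algebra.linearMap R A ∘ₗ ε

/-- `IsHopfAlgebra` is Mathlib's notion, with the structure maps given explicitly. -/
@[reducible]
def IsHopfAlgebra.toHopfAlgebra {R A : Type*} [CommSemiring R] [Semiring A] [Algebra R A]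
    {Δ : A →ₗ[R] A ⊗[R] A} {ε : A →ₗ[R] R} {S : A →ₗ[R] A} (h : IsHopfAlgebra R A Δ ε S) :
    HopfAlgebra R A :=
  letI : Coalgebra R A :=
    { comul := Δ
      counit := ε
      coassoc := h.coassoc
      rTensor_counit_comp_comul := h.counit_left
      lTensor_counit_comp_comul := h.counit_right }
  { Bialgebra.mk' R A h.counit_one (fun {a b} => h.counit_mul a b) h.comul_one
      (fun {a b} => h.comul_mul a b) with
    antipode := S
    mul_antipode_rTensor_comul := h.antipode_left
    mul_antipode_lTensor_comul := h.antipode_right }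

end

noncomputable section

/-! ### First returns -/

namespace FirstReturn

variable {X : Type}

/-! All data of a ribbon graph are cycles of permutations, and both operations behind `shrink` are
first-return maps. Contracting `D` takes the first return of `rot * flipOn D` to the complement of
`D`; erasing bivalent vertices takes the first return of the walk along a chain of edges. In both
cases the face permutation `rot * flip` of the new graph is the first return of the old one
(`coe_contract_face`, `coe_erase_face`), so faces can be compared cycle by cycle. As the external
edges of a divergent component lie on a single face, contraction turns the component into exactly
one vertex. Hence connectedness, absence of bridges, Euler characteristic and external edges agree
before and after shrinking (`conn_shrink_iff`, `bridgeless_contract_iff`, `euler_contract`,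
`euler_erase`).

The combinatorial core is that, for a divergent `D`, the map `shrinkEdges D` is a bijection from the
divergent subgraphs strictly containing `D` to those of the cograph (`shrinkEdges_mem`,
`shrinkEdges_injective`, `exists_shrinkEdges_eq`), and that shrinking in two steps agrees with
shrinking at once (`isomorphic_shrink_shrink`). This is where bridges matter: a bridgeless edge set
cannot use just one of the two external edges of a component, so it consists of whole chains.

For the algebra, a disjoint union `A` of divergent graphs has as coproduct the sum of `γ ⊗ A/γ` over
all divergent `γ`, the empty and the full one included; this form is multiplicative over components
(`coproduct_ofComponents`). Both sides of coassociativity then become sums over nested pairs of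
subgraphs (`sum_nested`). The recursion for `S` says that `S` is a left convolution inverse of the
identity. For the other side, `e = id * S` satisfies `e * id = id`, and induction on the number of
internal edges forces `e` to be the convolution unit. -/

/-- The first return of `x` to `s` under `p`, as a total function. -/
def ret (p : Equiv.Perm X) (s : Set X) (x : X) : X := (p ^ time p s x) x

/-- The orbit of `x` under `p` meets `s` at a positive time. -/
def Hits (p : Equiv.Perm X) (s : Set X) (x : X) : Prop := ∃ n, 0 < n ∧ (p ^ n) x ∈ s

theorem coe_perm [Finite X] (p : Equiv.Perm X) (s : Set X) (x : s) :
    (perm p s x : X) = ret p s x := rfl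

theorem Hits.of_mem [Finite X] {p : Equiv.Perm X} {s : Set X} {x : X} (hx : x ∈ s) :
    Hits p s x :=
  ⟨time p s x, time_spec p s hx⟩

theorem Hits.time_spec {p : Equiv.Perm X} {s : Set X} {x : X} (h : Hits p s x) :
    0 < time p s x ∧ (p ^ time p s x) x ∈ s :=
  Nat.sInf_mem h

theorem Hits.of_apply_mem {p : Equiv.Perm X} {s : Set X} {x : X} (h : p x ∈ s) : Hits p s x :=
  ⟨1, one_pos, by simpa using h⟩

theorem Hits.of_apply {p : Equiv.Perm X} {s : Set X} {x : X} (h : Hits p s (p x)) :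
    Hits p s x := by
  obtain ⟨n, -, hn⟩ := h
  exact ⟨n + 1, Nat.succ_pos n, by rwa [pow_succ, Equiv.Perm.mul_apply]⟩

theorem time_eq {p : Equiv.Perm X} {s : Set X} {x : X} {n : ℕ} (h0 : 0 < n)
    (hn : (p ^ n) x ∈ s) (hlt : ∀ k, 0 < k → k < n → (p ^ k) x ∉ s) : time p s x = n := by
  refine le_antisymm (time_le p s h0 hn) ?_
  by_contra hcon
  have hh : Hits p s x := ⟨n, h0, hn⟩
  exact hlt _ hh.time_spec.1 (not_le.1 hcon) hh.time_spec.2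

theorem time_of_apply_mem {p : Equiv.Perm X} {s : Set X} {x : X} (h : p x ∈ s) :
    time p s x = 1 :=
  time_eq one_pos (by simpa using h) (by omega)

theorem ret_of_apply_mem {p : Equiv.Perm X} {s : Set X} {x : X} (h : p x ∈ s) :
    ret p s x = p x := by
  simp [ret, time_of_apply_mem h]

theorem Hits.apply {p : Equiv.Perm X} {s : Set X} {x : X} (h : Hits p s x) (hx : p x ∉ s) :
    Hits p s (p x) ∧ time p s x = time p s (p x) + 1 := by
  obtain ⟨h0, hm⟩ := h.time_spec
  have hne : time p s x ≠ 1 := by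
    intro h1
    rw [h1] at hm
    exact hx (by simpa using hm)
  obtain ⟨n, hn⟩ : ∃ n, time p s x = n + 1 := ⟨time p s x - 1, by omega⟩
  have hn0 : 0 < n := by omega
  have hn' : (p ^ n) (p x) ∈ s := by
    rw [hn, pow_succ, Equiv.Perm.mul_apply] at hm
    exact hm
  refine ⟨⟨n, hn0, hn'⟩, ?_⟩
  rw [hn, time_eq hn0 hn']
  intro k hk hkn hks
  have := time_le p s (x := x) (Nat.succ_pos k)
    (by rwa [pow_succ, Equiv.Perm.mul_apply])
  omega

theorem Hits.ret_apply {p : Equiv.Perm X} {s : Set X} {x : X} (h : Hits p s x) (hx : p x ∉ s) :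
    ret p s x = ret p s (p x) := by
  rw [ret, (h.apply hx).2, pow_succ, Equiv.Perm.mul_apply]
  rfl

/-- Induction along an orbit up to the first return. -/
theorem Hits.induction {p : Equiv.Perm X} {s : Set X} {P : X → Prop}
    (h1 : ∀ x, p x ∈ s → P x) (h2 : ∀ x, p x ∉ s → Hits p s x → P (p x) → P x)
    {x : X} (h : Hits p s x) : P x := by
  induction hn : time p s x using Nat.strong_induction_on generalizing x with
  | _ n ih =>
    by_cases hx : p x ∈ s
    · exact h1 x hx
    · obtain ⟨h', ht⟩ := h.apply hx
      exact h2 x hx h (ih _ (by omega) h' rfl)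

theorem Hits.sameCycle_ret {p : Equiv.Perm X} {s : Set X} {x : X} :
    Equiv.Perm.SameCycle p x (ret p s x) :=
  ⟨time p s x, by simp [ret]⟩

/-- If `p x = q y` and `p` and `q` agree outside `s`, then the first returns of `x` and `y`
agree. -/
theorem ret_congr {p q : Equiv.Perm X} {s : Set X} (hpq : ∀ z, z ∉ s → p z = q z) {x y : X}
    (hxy : p x = q y) (h : Hits p s x) : Hits q s y ∧ ret p s x = ret q s y := by
  suffices H : ∀ y, p x = q y → Hits q s y ∧ ret p s x = ret q s y from H y hxy
  refine Hits.induction (P := fun x => ∀ y, p x = q y → Hits q s y ∧ ret p s x = ret q s y)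
    ?_ ?_ h
  · intro x hx y hxy
    have hy : q y ∈ s := hxy ▸ hx
    exact ⟨.of_apply_mem hy, by rw [ret_of_apply_mem hx, ret_of_apply_mem hy, hxy]⟩
  · intro x hx hh ih y hxy
    have hy : q y ∉ s := hxy ▸ hx
    obtain ⟨h1, h2⟩ := ih (q y) (by rw [hpq _ hx, hxy])
    have hy' := h1.of_apply
    exact ⟨hy', by rw [hh.ret_apply hx, h2, hy'.ret_apply hy]⟩

/-- A power of `p` that leads from `x` to a point of `s` is at least the return time, so one return
can be split off and induction applies. This is what lets vertices and faces be counted after a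
first-return construction. -/
theorem sameCycle_perm [Finite X] (p : Equiv.Perm X) (s : Set X) (x y : s) :
    Equiv.Perm.SameCycle (perm p s) x y ↔ Equiv.Perm.SameCycle p (x : X) y := by
  constructor
  · intro h
    obtain ⟨n, rfl⟩ := h.exists_nat_pow_eq
    clear h
    induction n with
    | zero => exact .refl _ _
    | succ n ih =>
      rw [pow_succ', Equiv.Perm.mul_apply, coe_perm]
      exact ih.trans Hits.sameCycle_ret
  · intro h
    obtain ⟨n, hn⟩ := h.exists_nat_pow_eq
    clear h
    induction n using Nat.strong_induction_on generalizing x with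
    | _ n ih =>
      rcases Nat.eq_zero_or_pos n with rfl | h0
      · have : x = y := Subtype.ext (by simpa using hn)
        rw [this]
      · have hle : time p s x ≤ n := time_le p s h0 (hn ▸ y.2)
        have hpos := (time_spec p s x.2).1
        refine Equiv.Perm.SameCycle.trans ⟨1, by simp⟩ (ih (n - time p s x) (by omega)
          (perm p s x) ?_)
        rw [coe_perm, ret, ← Equiv.Perm.mul_apply, ← pow_add, Nat.sub_add_cancel hle, hn]

/-- First returns are compatible with equivariant maps. -/
theorem map_ret {Y : Type} {p : Equiv.Perm X} {q : Equiv.Perm Y} (i : X → Y)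
    (hi : ∀ x, i (p x) = q (i x)) (s : Set Y) (x : X) :
    i (ret p (i ⁻¹' s) x) = ret q s (i x) := by
  have hpow : ∀ (n : ℕ) x, i ((p ^ n) x) = (q ^ n) (i x) := by
    intro n
    induction n with
    | zero => simp
    | succ n ih => intro x; rw [pow_succ, pow_succ, Equiv.Perm.mul_apply, Equiv.Perm.mul_apply,
        ih, hi]
  have ht : time p (i ⁻¹' s) x = time q s (i x) := by
    simp only [time, Set.mem_preimage, hpow]
  rw [ret, hpow, ht, ret]

theorem map_ret' {Y : Type} {p : Equiv.Perm X} {q : Equiv.Perm Y} (i : X → Y)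
    (hi : ∀ x, i (p x) = q (i x)) {t : Set X} {s : Set Y} (hts : ∀ x, x ∈ t ↔ i x ∈ s) (x : X) :
    i (ret p t x) = ret q s (i x) := by
  have : t = i ⁻¹' s := Set.ext hts
  rw [this, map_ret i hi]

/-- The first return to a subset `s` of the first-return map to `r` is the first return to `s`. -/
theorem map_ret_of_ret {Y : Type} {p : Equiv.Perm X} {q : Equiv.Perm Y} (i : X → Y)
    {r s : Set Y} (hi : ∀ x, i (p x) = ret q r (i x)) (hr : ∀ x, Hits q r (i x))
    (hsr : s ⊆ r) {t : Set X} (hts : ∀ x, x ∈ t ↔ i x ∈ s) {x : X} (hx : Hits p t x) :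
    Hits q s (i x) ∧ i (ret p t x) = ret q s (i x) := by
  -- One step of `p` is a walk of `q` up to `r`. It meets no point of `s` before its end, because `s
  -- ⊆ r`; the two cases say whether that end `z` is in `s`.
  have key : ∀ y, Hits q r y → ∀ z, ret q r y = z →
      (z ∈ s → Hits q s y ∧ ret q s y = z) ∧
      (z ∉ s → Hits q s z → Hits q s y ∧ ret q s y = ret q s z) := by
    intro y hy
    refine Hits.induction (P := fun y => ∀ z, ret q r y = z →
      (z ∈ s → Hits q s y ∧ ret q s y = z) ∧
      (z ∉ s → Hits q s z → Hits q s y ∧ ret q s y = ret q s z)) ?_ ?_ hy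
    · rintro y hy z rfl
      rw [ret_of_apply_mem hy]
      exact ⟨fun h => ⟨.of_apply_mem h, ret_of_apply_mem h⟩,
        fun h h' => ⟨h'.of_apply, h'.of_apply.ret_apply h⟩⟩
    · rintro y hy hh ih z rfl
      have hys : q y ∉ s := fun h => hy (hsr h)
      obtain ⟨h1, h2⟩ := ih _ rfl
      rw [hh.ret_apply hy]
      refine ⟨fun h => ?_, fun h h' => ?_⟩
      · obtain ⟨a, b⟩ := h1 h
        exact ⟨a.of_apply, by rw [a.of_apply.ret_apply hys, b]⟩
      · obtain ⟨a, b⟩ := h2 h h'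
        exact ⟨a.of_apply, by rw [a.of_apply.ret_apply hys, b]⟩
  refine Hits.induction (P := fun x => Hits q s (i x) ∧ i (ret p t x) = ret q s (i x)) ?_ ?_ hx
  · intro x hx
    obtain ⟨h1, h2⟩ := (key _ (hr x) _ (hi x).symm).1 ((hts _).1 hx)
    exact ⟨h1, by rw [ret_of_apply_mem hx, h2]⟩
  · rintro x hx hh ⟨ih1, ih2⟩
    obtain ⟨h1, h2⟩ := (key _ (hr x) _ (hi x).symm).2 (fun h => hx ((hts _).2 h)) ih1
    exact ⟨h1, by rw [hh.ret_apply hx, ih2, h2]⟩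

/-- If the involution `t` fixes `s` pointwise, then `t * p` and `p * t` have the same first returns
to `s`. -/
theorem ret_mul_comm {p t : Equiv.Perm X} {s : Set X} (ht : ∀ x, t (t x) = x)
    (hts : ∀ x ∈ s, t x = x) {x : X} (hx : x ∈ s) : ret (t * p) s x = ret (p * t) s x := by
  have hmem : ∀ y : X, t y ∈ s ↔ y ∈ s := fun y =>
    ⟨fun h => by have := hts _ h; rw [ht] at this; rwa [← this] at h, fun h => by rwa [hts y h]⟩
  have hpow : ∀ n : ℕ, ((t * p) ^ n) x = t (((p * t) ^ n) x) := by
    intro n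
    induction n with
    | zero => simp [hts x hx]
    | succ n ih =>
      rw [pow_succ', Equiv.Perm.mul_apply, ih, pow_succ', Equiv.Perm.mul_apply (p * t)]
      simp
  have htime : time (t * p) s x = time (p * t) s x := by
    simp only [time, hpow, hmem]
  by_cases hh : Hits (p * t) s x
  · rw [ret, htime, hpow, hts _ hh.time_spec.2, ret]
  -- Without a return the time is the infimum of the empty set, that is `0`, and both sides are `x`.
  · have h0 : time (p * t) s x = 0 := by
      have : {n | 0 < n ∧ ((p * t) ^ n) x ∈ s} = ∅ :=
        Set.eq_empty_iff_forall_notMem.2 fun n hn => hh ⟨n, hn⟩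
      rw [time, this, Nat.sInf_empty]
    rw [ret, ret, htime, h0, pow_zero, pow_zero]

end FirstReturn

/-! ### Orbits and involutions -/

/-- A set mapped into itself by a permutation of a finite type is invariant. -/
theorem Equiv.Perm.apply_mem_iff_of_forall {X : Type} [Finite X] (p : Equiv.Perm X) {A : Set X}
    (h : ∀ x ∈ A, p x ∈ A) (x : X) : p x ∈ A ↔ x ∈ A := by
  refine ⟨fun hx => ?_, h x⟩
  have hn : ∀ n : ℕ, ∀ y ∈ A, (p ^ n) y ∈ A := by
    intro n
    induction n with
    | zero => simp
    | succ n ih => intro y hy; rw [pow_succ', Equiv.Perm.mul_apply]; exact h _ (ih y hy)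
  have := hn (orderOf p - 1) _ hx
  rwa [← Equiv.Perm.mul_apply, ← pow_succ, Nat.sub_add_cancel (orderOf_pos p), pow_orderOf_eq_one,
    Equiv.Perm.one_apply] at this

theorem Equiv.Perm.SameCycle.mem_iff {X : Type} [Finite X] {p : Equiv.Perm X} {A : Set X}
    (h : ∀ x ∈ A, p x ∈ A) {x y : X} (hxy : p.SameCycle x y) : x ∈ A ↔ y ∈ A := by
  obtain ⟨n, rfl⟩ := hxy.exists_nat_pow_eq
  clear hxy
  induction n with
  | zero => simp
  | succ n ih => rw [pow_succ', Equiv.Perm.mul_apply, p.apply_mem_iff_of_forall h, ih]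

/-- The sum of `1` over `A` in `ZMod 2` cancels in pairs. The parity arguments about ends of chains
rest on this. -/
theorem Set.even_ncard_of_involution {X : Type} [Finite X] (A : Set X) (f : X → X)
    (hf : ∀ x ∈ A, f x ∈ A) (hff : ∀ x ∈ A, f (f x) = x) (hne : ∀ x ∈ A, f x ≠ x) :
    Even A.ncard := by
  classical
  have := Fintype.ofFinite X
  have hA : A.ncard = A.toFinset.card := Set.ncard_eq_toFinset_card' A
  have key : (∑ x ∈ A.toFinset, (1 : ZMod 2)) = 0 := by
    refine Finset.sum_involution (fun x _ => f x) ?_ ?_ ?_ ?_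
    · intro a _; decide
    · intro a ha _; exact hne a (by simpa using ha)
    · intro a ha; simpa using hf a (by simpa using ha)
    · intro a ha; exact hff a (by simpa using ha)
  rw [Finset.sum_const, nsmul_eq_mul, mul_one, ZMod.natCast_eq_zero_iff] at key
  rw [hA]
  exact even_iff_two_dvd.2 key

/-- Turns valences into cardinalities of cycles, which can be compared by bijections. -/
theorem minimalPeriod_eq_card_sameCycle {X : Type} [Finite X] (p : Equiv.Perm X) (x : X) :
    Function.minimalPeriod p x = Nat.card {y // p.SameCycle x y} := by
  classical
  have := Fintype.ofFinite X
  have h := MulAction.minimalPeriod_eq_card (a := p) (b := x)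
  rw [← Nat.card_eq_fintype_card] at h
  rw [show Function.minimalPeriod p x = Function.minimalPeriod (p • ·) x from rfl, h]
  refine Nat.card_congr (Equiv.subtypeEquivRight fun y => ?_)
  rw [MulAction.mem_orbit_iff]
  constructor
  · rintro ⟨⟨_, n, rfl⟩, hg⟩
    exact ⟨n, hg⟩
  · rintro ⟨n, hn⟩
    exact ⟨⟨p ^ n, n, rfl⟩, hn⟩

/-- The classes of a pulled back equivalence relation are the classes that meet the image. -/
def quotientEquivMeets {A X : Type} (r : Setoid A) (s : Setoid X) (i : A → X)
    (h : ∀ a b, r a b ↔ s (i a) (i b)) :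
    Quotient r ≃ {c : Quotient s // ∃ a, Quotient.mk s (i a) = c} :=
  Equiv.ofBijective
    (fun q => Quotient.liftOn q (fun a => ⟨Quotient.mk s (i a), a, rfl⟩)
      fun a b hab => Subtype.ext (Quotient.sound ((h a b).1 hab)))
    (by
      constructor
      · intro q q'
        induction q using Quotient.inductionOn
        induction q' using Quotient.inductionOn
        intro hq
        exact Quotient.sound ((h _ _).2 (Quotient.exact (congrArg Subtype.val hq)))
      · rintro ⟨_, a, rfl⟩
        exact ⟨Quotient.mk r a, rfl⟩)

namespace RibbonGraph

variable {G : RibbonGraph}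

/-! ### Connectedness -/

theorem eq_of_rot_eq_of_flip_eq {H : Type} {fin fin' : Finite H} {r r' f f' : Equiv.Perm H}
    {i i'} (hr : r = r') (hf : f = f') :
    (⟨H, fin, r, f, i⟩ : RibbonGraph) = ⟨H, fin', r', f', i'⟩ := by
  subst hr hf
  rfl

/-- Stated for relations on the common type `H`, so that no half-edge is transported along an
equality of graphs. -/
theorem connSetoid_eq_of_eq {H : Type} {fin fin' : Finite H} {r r' f f' : Equiv.Perm H}
    {i i'} (hr : r = r') (hf : f = f') :
    (⟨H, fin, r, f, i⟩ : RibbonGraph).connSetoid =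
      (⟨H, fin', r', f', i'⟩ : RibbonGraph).connSetoid := by
  subst hr hf
  rfl

theorem connSetoid_le (G : RibbonGraph) {r : Setoid G.HalfEdge}
    (hr : ∀ h, r h (G.rot h)) (hf : ∀ h, r h (G.flip h)) {x y : G.HalfEdge}
    (h : G.connSetoid x y) : r x y := by
  induction h with
  | rel a b h =>
    rcases h with rfl | rfl
    · exact hr a
    · exact hf a
  | refl a => exact r.refl a
  | symm a b _ ih => exact r.symm ih
  | trans a b c _ _ ih1 ih2 => exact r.trans ih1 ih2

/-- Closure in one direction suffices since there are finitely many half-edges. Most connectedness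
proofs below consist in the choice of `A`. -/
theorem conn_mem_iff {A : Set G.HalfEdge} (hr : ∀ h ∈ A, G.rot h ∈ A)
    (hf : ∀ h ∈ A, G.flip h ∈ A) {x y : G.HalfEdge} (h : G.connSetoid x y) : x ∈ A ↔ y ∈ A := by
  let r : Setoid G.HalfEdge := ⟨fun a b => a ∈ A ↔ b ∈ A,
    fun _ => Iff.rfl, fun h => h.symm, fun h h' => h.trans h'⟩
  exact G.connSetoid_le (r := r) (fun h => (G.rot.apply_mem_iff_of_forall hr h).symm)
    (fun h => (G.flip.apply_mem_iff_of_forall hf h).symm) h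

theorem conn_of_sameCycle_rot {x y : G.HalfEdge} (h : G.rot.SameCycle x y) :
    G.connSetoid x y :=
  (h.mem_iff (A := {z | G.connSetoid x z})
    fun z hz => G.connSetoid.trans hz (G.connSetoid_rot z)).1 (G.connSetoid.refl x)

theorem conn_of_sameCycle_face {x y : G.HalfEdge} (h : (G.rot * G.flip).SameCycle x y) :
    G.connSetoid x y :=
  (h.mem_iff (A := {z | G.connSetoid x z})
    fun z hz => G.connSetoid.trans hz
      (G.connSetoid.trans (G.connSetoid_flip z) (G.connSetoid_rot _))).1 (G.connSetoid.refl x)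

/-! ### Cutting edges -/

theorem flipOn_of_mem (D : G.EdgeSet) {h : G.HalfEdge} (hh : h ∈ D.1) :
    G.flipOn D h = G.flip h := if_pos hh

theorem flipOn_of_notMem (D : G.EdgeSet) {h : G.HalfEdge} (hh : h ∉ D.1) :
    G.flipOn D h = h := if_neg hh

theorem flipOn_flipOn (D : G.EdgeSet) (h : G.HalfEdge) : G.flipOn D (G.flipOn D h) = h :=
  (G.flipOn D).left_inv h

theorem flipOn_ne_iff (D : G.EdgeSet) (h : G.HalfEdge) : G.flipOn D h ≠ h ↔ h ∈ D.1 := by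
  by_cases hh : h ∈ D.1
  · simpa [flipOn_of_mem D hh, hh] using (D.2 h hh).2
  · simp [flipOn_of_notMem D hh, hh]

theorem flipOn_eq_iff (D : G.EdgeSet) (h : G.HalfEdge) : G.flipOn D h = h ↔ h ∉ D.1 := by
  rw [← flipOn_ne_iff, not_not]

theorem conn_cutOutside_mono {D D' : G.EdgeSet} (h : D.1 ⊆ D'.1) {x y : G.HalfEdge}
    (hxy : (G.cutOutside D).connSetoid x y) : (G.cutOutside D').connSetoid x y := by
  refine (G.cutOutside D).connSetoid_le (r := (G.cutOutside D').connSetoid)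
    (fun z => (G.cutOutside D').connSetoid_rot z) (fun z => ?_) hxy
  by_cases hz : z ∈ D.1
  · have := (G.cutOutside D').connSetoid_flip z
    rwa [show (G.cutOutside D').flip z = (G.cutOutside D).flip z from
      (flipOn_of_mem D' (h hz)).trans (flipOn_of_mem D hz).symm] at this
  · rw [show (G.cutOutside D).flip z = z from flipOn_of_notMem D hz]
    exact Setoid.refl' _ z

theorem conn_of_conn_cutOutside {D : G.EdgeSet} {x y : G.HalfEdge}
    (hxy : (G.cutOutside D).connSetoid x y) : G.connSetoid x y := by
  refine (G.cutOutside D).connSetoid_le (r := G.connSetoid)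
    (fun z => G.connSetoid_rot z) (fun z => ?_) hxy
  by_cases hz : z ∈ D.1
  · rw [show (G.cutOutside D).flip z = G.flip z from flipOn_of_mem D hz]
    exact G.connSetoid_flip z
  · rw [show (G.cutOutside D).flip z = z from flipOn_of_notMem D hz]
    exact Setoid.refl' _ z

/-- A smaller edge set, as an edge set of the graph cut outside a larger one. -/
def cutEdges (D D' : G.EdgeSet) (h : D.1 ⊆ D'.1) : (G.cutOutside D').EdgeSet :=
  ⟨D.1, fun x hx => by
    have hx' : (G.cutOutside D').flip x = G.flip x := flipOn_of_mem D' (h hx)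
    rw [hx']
    exact D.2 x hx⟩

theorem flipOn_cutEdges (D D' : G.EdgeSet) (h : D.1 ⊆ D'.1) :
    (G.cutOutside D').flipOn (cutEdges D D' h) = G.flipOn D := by
  refine Equiv.ext fun (x : G.HalfEdge) => ?_
  by_cases hx : x ∈ D.1
  · exact ((flipOn_of_mem (G := G.cutOutside D') (cutEdges D D' h) hx).trans
      (flipOn_of_mem D' (h hx))).trans (flipOn_of_mem D hx).symm
  · exact (flipOn_of_notMem (G := G.cutOutside D') (cutEdges D D' h) hx).trans
      (flipOn_of_notMem D hx).symm

theorem cutOutside_cutEdges (D E : G.EdgeSet) (h : D.1 ⊆ E.1) :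
    (G.cutOutside E).cutOutside (cutEdges D E h) = G.cutOutside D :=
  eq_of_rot_eq_of_flip_eq rfl (flipOn_cutEdges D E h)

/-- The set of all internal edges. -/
def allEdges (G : RibbonGraph) : G.EdgeSet :=
  ⟨{h | G.flip h ≠ h}, fun h hh => ⟨by
    simp only [Set.mem_ofPred_eq, ne_eq, EmbeddingLike.apply_eq_iff_eq]; exact hh, hh⟩⟩

theorem subset_allEdges (D : G.EdgeSet) : D.1 ⊆ G.allEdges.1 := fun h hh => (D.2 h hh).2

theorem flipOn_allEdges (G : RibbonGraph) : G.flipOn G.allEdges = G.flip := by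
  ext x
  by_cases hx : G.flip x = x
  · rw [hx]
    exact flipOn_of_notMem G.allEdges (fun h => h hx)
  · exact flipOn_of_mem G.allEdges hx

theorem cutOutside_allEdges (G : RibbonGraph) : G.cutOutside G.allEdges = G :=
  eq_of_rot_eq_of_flip_eq rfl G.flipOn_allEdges

theorem flipOn_edgesExcept {h x : G.HalfEdge} (h1 : x ≠ h) (h2 : x ≠ G.flip h) :
    G.flipOn (G.edgesExcept h) x = G.flip x := by
  by_cases hx : G.flip x = x
  · rw [flipOn_of_notMem (G.edgesExcept h) (fun hh => hh.1 hx), hx]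
  · exact flipOn_of_mem _ ⟨hx, h1, h2⟩

theorem edgesExcept_flip (h : G.HalfEdge) : G.edgesExcept (G.flip h) = G.edgesExcept h := by
  refine Subtype.ext (Set.ext fun x => ?_)
  change (_ ∧ _ ∧ _) ↔ (_ ∧ _ ∧ _)
  rw [G.flip_flip]
  tauto

/-- No internal edge is a bridge. -/
def Bridgeless (G : RibbonGraph) : Prop :=
  ∀ h, G.flip h ≠ h → (G.cutOutside (G.edgesExcept h)).connSetoid h (G.flip h)

/-- Only the ends of the cut edge matter: wherever a path uses that edge, the detour between its
ends replaces it. Unlike `Is1PI`, the condition `Bridgeless` makes sense for graphs with several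
components. -/
theorem is1PI_iff : G.Is1PI ↔ G.IsConnected ∧ (∃ h, G.flip h ≠ h) ∧ G.Bridgeless := by
  refine and_congr_right fun hc => and_congr_right fun _ => forall_congr' fun h =>
    forall_congr' fun hh => ⟨fun H => H.2 _ _, fun H => ⟨hc.1, ?_⟩⟩
  have key : ∀ x, (G.cutOutside (G.edgesExcept h)).connSetoid h x := by
    intro x
    let A : Set G.HalfEdge := {z | (G.cutOutside (G.edgesExcept h)).connSetoid h z}
    refine (conn_mem_iff (A := A) (fun z hz => ?_) (fun z hz => ?_) (hc.2 h x)).1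
      ((G.cutOutside (G.edgesExcept h)).connSetoid.refl h)
    · exact Setoid.trans' _ hz ((G.cutOutside (G.edgesExcept h)).connSetoid_rot z)
    · by_cases h1 : z = h
      · rw [h1]; exact H
      by_cases h2 : z = G.flip h
      · rw [h2, G.flip_flip]
        exact (G.cutOutside (G.edgesExcept h)).connSetoid.refl h
      have := (G.cutOutside (G.edgesExcept h)).connSetoid_flip z
      rw [show (G.cutOutside (G.edgesExcept h)).flip z = G.flip z from
        flipOn_edgesExcept h1 h2] at this
      exact Setoid.trans' _ hz this
  exact fun a b => Setoid.trans' _ (Setoid.symm' _ (key a)) (key b)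

/-- The edges of `D` other than the one containing `h`. -/
def removeEdge (D : G.EdgeSet) (h : G.HalfEdge) : G.EdgeSet :=
  ⟨{x | x ∈ D.1 ∧ x ≠ h ∧ x ≠ G.flip h}, by
    rintro x ⟨h1, h2, h3⟩
    refine ⟨⟨(D.2 x h1).1, ?_, ?_⟩, (D.2 x h1).2⟩
    · rintro rfl
      exact h3 (G.flip_flip x).symm
    · exact fun hx => h2 (G.flip.injective hx)⟩

theorem bridgeless_cutOutside_iff {D : G.EdgeSet} : (G.cutOutside D).Bridgeless ↔
    ∀ h ∈ D.1, (G.cutOutside (removeEdge D h)).connSetoid h (G.flip h) := by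
  refine forall_congr' fun (h : G.HalfEdge) => ?_
  have h1 : (G.cutOutside D).flip h ≠ h ↔ h ∈ D.1 := flipOn_ne_iff D h
  rw [h1]
  refine forall_congr' fun hh => ?_
  have hfl : (G.cutOutside D).flipOn ((G.cutOutside D).edgesExcept h) =
      G.flipOn (removeEdge D h) := by
    refine Equiv.ext fun (x : G.HalfEdge) => ?_
    have hfx : (G.cutOutside D).flip h = G.flip h := flipOn_of_mem D hh
    by_cases hx : x ∈ (removeEdge D h).1
    · have hx' : x ∈ ((G.cutOutside D).edgesExcept h).1 :=
        ⟨(flipOn_ne_iff D x).2 hx.1, hx.2.1, by rw [hfx]; exact hx.2.2⟩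
      exact (flipOn_of_mem (G := G.cutOutside D) _ hx').trans ((flipOn_of_mem D hx.1).trans
        (flipOn_of_mem (removeEdge D h) hx).symm)
    · have hx' : x ∉ ((G.cutOutside D).edgesExcept h).1 := by
        rintro ⟨h2, h3, h4⟩
        rw [hfx] at h4
        exact hx ⟨(flipOn_ne_iff D x).1 h2, h3, h4⟩
      exact (flipOn_of_notMem (G := G.cutOutside D) _ hx').trans
        (flipOn_of_notMem (removeEdge D h) hx).symm
  have hc : ((G.cutOutside D).cutOutside ((G.cutOutside D).edgesExcept h)).connSetoid =
      (G.cutOutside (removeEdge D h)).connSetoid := connSetoid_eq_of_eq rfl hfl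
  rw [hc, show (G.cutOutside D).flip h = G.flip h from flipOn_of_mem D hh]
  rfl

/-- Every component has external edges, and they all lie on one face. -/
def OneBrokenFace (G : RibbonGraph) : Prop :=
  (∀ x y, G.flip x = x → G.flip y = y → G.connSetoid x y → (G.rot * G.flip).SameCycle x y) ∧
    ∀ x, ∃ y, G.flip y = y ∧ G.connSetoid x y

/-! ### Contraction -/

open FirstReturn

theorem coe_contract_rot (D : G.EdgeSet) (x : (G.contract D).HalfEdge) :
    ((G.contract D).rot x).1 = ret (G.rot * G.flipOn D) (D.1)ᶜ x.1 := rfl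

theorem coe_contract_flip (D : G.EdgeSet) (x : (G.contract D).HalfEdge) :
    ((G.contract D).flip x).1 = G.flip x.1 := rfl

theorem contract_sameCycle_rot (D : G.EdgeSet) (x y : (G.contract D).HalfEdge) :
    (G.contract D).rot.SameCycle x y ↔ (G.rot * G.flipOn D).SameCycle x.1 y.1 :=
  sameCycle_perm _ _ x y

/-- The walk of `rot * flip` from `x` and that of `rot * flipOn D` from `flip x` coincide after one
step, because `flipOn D` fixes `flip x`; inside `D` the two permutations agree. -/
theorem coe_contract_face (D : G.EdgeSet) (x : (G.contract D).HalfEdge) :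
    ((G.contract D).rot ((G.contract D).flip x)).1 = ret (G.rot * G.flip) (D.1)ᶜ x.1 := by
  rw [coe_contract_rot, coe_contract_flip]
  refine ((ret_congr (p := G.rot * G.flip) (q := G.rot * G.flipOn D) (fun z hz => ?_) ?_
    (.of_mem x.2)).2).symm
  · rw [Set.mem_compl_iff, not_not] at hz
    rw [Equiv.Perm.mul_apply, Equiv.Perm.mul_apply, flipOn_of_mem D hz]
  · rw [Equiv.Perm.mul_apply, Equiv.Perm.mul_apply, flipOn_of_notMem]
    rw [G.flip_mem_iff]
    exact x.2

theorem contract_sameCycle_face (D : G.EdgeSet) (x y : (G.contract D).HalfEdge) :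
    ((G.contract D).rot * (G.contract D).flip).SameCycle x y ↔
      (G.rot * G.flip).SameCycle x.1 y.1 := by
  rw [← sameCycle_perm (G.rot * G.flip) (D.1)ᶜ x y]
  have : (G.contract D).rot * (G.contract D).flip = perm (G.rot * G.flip) (D.1)ᶜ := by
    exact Equiv.ext fun z => Subtype.ext (coe_contract_face D z)
  rw [this]
  rfl

theorem conn_of_conn_contract (D : G.EdgeSet) {x y : (G.contract D).HalfEdge}
    (h : (G.contract D).connSetoid x y) : G.connSetoid x.1 y.1 := by
  refine (G.contract D).connSetoid_le (r := G.connSetoid.comap Subtype.val) (fun z => ?_)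
    (fun z => G.connSetoid_flip z.1) h
  exact conn_of_conn_cutOutside (D := D) (conn_of_sameCycle_face (G := G.cutOutside D)
    ((contract_sameCycle_rot D z _).1 ⟨1, by simp⟩))

/-- The external half-edges of a component of the cut graph lie on one face, hence at one vertex of
the contraction. So being connected to `x` in the contraction is a property of components of the cut
graph, and it propagates along the edges of `G`. -/
theorem conn_contract_iff {D : G.EdgeSet} (hD : (G.cutOutside D).OneBrokenFace)
    (x y : (G.contract D).HalfEdge) :
    (G.contract D).connSetoid x y ↔ G.connSetoid x.1 y.1 := by
  refine ⟨conn_of_conn_contract D, fun h => ?_⟩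
  let A : Set G.HalfEdge := {h | ∃ z : (G.contract D).HalfEdge,
    (G.contract D).connSetoid x z ∧ (G.cutOutside D).connSetoid z.1 h}
  have hmem : ∀ z : (G.contract D).HalfEdge, z.1 ∈ A → (G.contract D).connSetoid x z := by
    rintro z ⟨w, hw, hwz⟩
    refine Setoid.trans' _ hw (conn_of_sameCycle_rot ?_)
    rw [contract_sameCycle_rot]
    exact hD.1 _ _ (flipOn_of_notMem D w.2) (flipOn_of_notMem D z.2) hwz
  refine hmem y ((conn_mem_iff (A := A) ?_ ?_ h).1 ⟨x, Setoid.refl' _ x, Setoid.refl' _ x.1⟩)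
  · rintro z ⟨w, hw, hwz⟩
    exact ⟨w, hw, Setoid.trans' _ hwz ((G.cutOutside D).connSetoid_rot z)⟩
  · intro z hz
    by_cases hzD : z ∈ D.1
    · obtain ⟨w, hw, hwz⟩ := hz
      refine ⟨w, hw, Setoid.trans' _ hwz ?_⟩
      have := (G.cutOutside D).connSetoid_flip z
      rwa [show (G.cutOutside D).flip z = G.flip z from flipOn_of_mem D hzD] at this
    · have := hmem ⟨z, hzD⟩ hz
      exact ⟨(G.contract D).flip ⟨z, hzD⟩, Setoid.trans' _ this ((G.contract D).connSetoid_flip _),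
        Setoid.refl' _ _⟩

/-- The edges of `D'` that survive the contraction of `D`. -/
def contractEdges (D D' : G.EdgeSet) : (G.contract D).EdgeSet :=
  ⟨{x | x.1 ∈ D'.1}, fun x hx =>
    ⟨(G.flip_mem_iff D' x.1).2 hx, fun h => (D'.2 _ hx).2 (congrArg Subtype.val h)⟩⟩

theorem contract_rot_cutOutside (D D' : G.EdgeSet) (h : D.1 ⊆ D'.1) :
    ((G.cutOutside D').contract (cutEdges D D' h)).rot = (G.contract D).rot :=
  congrArg (fun t : Equiv.Perm G.HalfEdge => perm (G.rot * t) (D.1)ᶜ) (flipOn_cutEdges D D' h)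

theorem contract_flip_cutOutside (D D' : G.EdgeSet) (h : D.1 ⊆ D'.1) :
    ((G.cutOutside D').contract (cutEdges D D' h)).flip =
      (G.contract D).flipOn (contractEdges D D') := by
  refine Equiv.ext fun (x : (G.contract D).HalfEdge) => Subtype.ext ?_
  by_cases hx : x.1 ∈ D'.1
  · exact (flipOn_of_mem D' hx).trans (congrArg Subtype.val
      (flipOn_of_mem (G := G.contract D) (contractEdges D D') hx)).symm
  · exact (flipOn_of_notMem D' hx).trans (congrArg Subtype.val
      (flipOn_of_notMem (G := G.contract D) (contractEdges D D') hx)).symm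

/-- Contraction commutes with cutting edges outside a larger set. -/
theorem contract_cutOutside (D D' : G.EdgeSet) (h : D.1 ⊆ D'.1) :
    (G.cutOutside D').contract (cutEdges D D' h) =
      (G.contract D).cutOutside (contractEdges D D') :=
  eq_of_rot_eq_of_flip_eq (contract_rot_cutOutside D D' h) (contract_flip_cutOutside D D' h)

/-- Since contraction commutes with cutting, this is `conn_contract_iff` for `G.cutOutside D'`;
cutting again outside `D` gives back `G.cutOutside D`. -/
theorem conn_contract_cutOutside_iff {D : G.EdgeSet} (hD : (G.cutOutside D).OneBrokenFace)
    {D' : G.EdgeSet} (h : D.1 ⊆ D'.1) (x y : (G.contract D).HalfEdge) :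
    ((G.contract D).cutOutside (contractEdges D D')).connSetoid x y ↔
      (G.cutOutside D').connSetoid x.1 y.1 := by
  have h2 : ((G.cutOutside D').contract (cutEdges D D' h)).connSetoid =
      ((G.contract D).cutOutside (contractEdges D D')).connSetoid :=
    connSetoid_eq_of_eq (contract_rot_cutOutside D D' h) (contract_flip_cutOutside D D' h)
  rw [← h2]
  exact conn_contract_iff (G := G.cutOutside D') (D := cutEdges D D' h)
    (by rwa [cutOutside_cutEdges]) x y

end RibbonGraph

namespace RibbonGraph

variable {G : RibbonGraph}

open FirstReturn

/-! ### Chains of bivalent vertices -/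

theorem crossBivalent_of_mem {h : G.HalfEdge} (hh : h ∈ G.bivalent) :
    G.crossBivalent h = G.rot h := if_pos hh

theorem crossBivalent_of_notMem {h : G.HalfEdge} (hh : h ∉ G.bivalent) :
    G.crossBivalent h = h := if_neg hh

theorem crossBivalent_crossBivalent (h : G.HalfEdge) :
    G.crossBivalent (G.crossBivalent h) = h := G.crossBivalent.left_inv h

theorem crossBivalent_mem_bivalent (h : G.HalfEdge) :
    G.crossBivalent h ∈ G.bivalent ↔ h ∈ G.bivalent := by
  by_cases hh : h ∈ G.bivalent
  · rw [crossBivalent_of_mem hh, G.rot_mem_bivalent]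
  · rw [crossBivalent_of_notMem hh]

/-- The graph whose components are the maximal chains of edges that pass through vertices of
valence two. -/
def chainGraph (G : RibbonGraph) : RibbonGraph where
  HalfEdge := G.HalfEdge
  finite := G.finite
  rot := G.crossBivalent
  flip := G.flip
  flip_flip := G.flip_flip

/-- Two half-edges belong to the same chain. -/
def chain (G : RibbonGraph) : Setoid G.HalfEdge := G.chainGraph.connSetoid

theorem chain_cross (h : G.HalfEdge) : G.chain h (G.crossBivalent h) :=
  G.chainGraph.connSetoid_rot h

theorem chain_flip (h : G.HalfEdge) : G.chain h (G.flip h) := G.chainGraph.connSetoid_flip h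

theorem chain_mem_iff {A : Set G.HalfEdge} (hr : ∀ h ∈ A, G.crossBivalent h ∈ A)
    (hf : ∀ h ∈ A, G.flip h ∈ A) {x y : G.HalfEdge} (h : G.chain x y) : x ∈ A ↔ y ∈ A :=
  conn_mem_iff (G := G.chainGraph) hr hf h

theorem conn_of_chain {x y : G.HalfEdge} (h : G.chain x y) : G.connSetoid x y := by
  refine G.chainGraph.connSetoid_le (r := G.connSetoid) (fun z => ?_)
    (fun z => G.connSetoid_flip z) h
  change G.connSetoid z (G.crossBivalent z)
  by_cases hz : z ∈ G.bivalent
  · rw [crossBivalent_of_mem hz]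
    exact G.connSetoid_rot z
  · rw [crossBivalent_of_notMem hz]
    exact Setoid.refl' _ z

theorem coe_erase_flip (x : G.eraseBivalent.HalfEdge) :
    (G.eraseBivalent.flip x).1 = ret (G.flip * G.crossBivalent) (G.bivalent)ᶜ x.1 := rfl

theorem erase_sameCycle_rot (x y : G.eraseBivalent.HalfEdge) :
    G.eraseBivalent.rot.SameCycle x y ↔ G.rot.SameCycle x.1 y.1 :=
  Equiv.Perm.sameCycle_subtypePerm (f := G.rot)
    (h := fun h => not_congr (G.rot_mem_bivalent h))

/-- The face walk and the chain walk run in parallel: through a bivalent vertex, `crossBivalent`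
conjugates a step of `flip * crossBivalent` to a step of `rot * flip`. At the last step `rot` moves
on to the next half-edge of the vertex reached. -/
theorem coe_erase_face (x : G.eraseBivalent.HalfEdge) :
    (G.eraseBivalent.rot (G.eraseBivalent.flip x)).1 =
      ret (G.rot * G.flip) (G.bivalent)ᶜ x.1 := by
  have key : ∀ z, Hits (G.flip * G.crossBivalent) (G.bivalent)ᶜ z →
      Hits (G.rot * G.flip) (G.bivalent)ᶜ (G.crossBivalent z) ∧
      G.rot (ret (G.flip * G.crossBivalent) (G.bivalent)ᶜ z) =
        ret (G.rot * G.flip) (G.bivalent)ᶜ (G.crossBivalent z) := by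
    intro z hz
    refine Hits.induction (P := fun z => Hits (G.rot * G.flip) (G.bivalent)ᶜ (G.crossBivalent z) ∧
      G.rot (ret (G.flip * G.crossBivalent) (G.bivalent)ᶜ z) =
        ret (G.rot * G.flip) (G.bivalent)ᶜ (G.crossBivalent z)) ?_ ?_ hz
    · intro z hz
      have hz' : (G.rot * G.flip) (G.crossBivalent z) ∈ (G.bivalent)ᶜ :=
        fun h => hz ((G.rot_mem_bivalent _).1 h)
      exact ⟨.of_apply_mem hz', by rw [ret_of_apply_mem hz, ret_of_apply_mem hz']; rfl⟩
    · rintro z hz hh ⟨ih1, ih2⟩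
      have hzb : (G.flip * G.crossBivalent) z ∈ G.bivalent := not_not.1 hz
      have heq : (G.rot * G.flip) (G.crossBivalent z) =
          G.crossBivalent ((G.flip * G.crossBivalent) z) :=
        (crossBivalent_of_mem hzb).symm
      have hz' : (G.rot * G.flip) (G.crossBivalent z) ∉ (G.bivalent)ᶜ := by
        rw [heq, Set.mem_compl_iff, not_not, crossBivalent_mem_bivalent]
        exact hzb
      rw [← heq] at ih1 ih2
      exact ⟨ih1.of_apply, by rw [hh.ret_apply hz, ih1.of_apply.ret_apply hz', ih2]⟩
  have := (key x.1 (.of_mem x.2)).2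
  rwa [crossBivalent_of_notMem x.2] at this

theorem erase_sameCycle_face (x y : G.eraseBivalent.HalfEdge) :
    (G.eraseBivalent.rot * G.eraseBivalent.flip).SameCycle x y ↔
      (G.rot * G.flip).SameCycle x.1 y.1 := by
  rw [← sameCycle_perm (G.rot * G.flip) (G.bivalent)ᶜ x y]
  have : G.eraseBivalent.rot * G.eraseBivalent.flip =
      perm (G.rot * G.flip) (G.bivalent)ᶜ :=
    Equiv.ext fun z => Subtype.ext (coe_erase_face z)
  rw [this]
  rfl

theorem chain_erase_flip (x : G.eraseBivalent.HalfEdge) :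
    G.chain x.1 (G.eraseBivalent.flip x).1 := by
  have h : (G.flip * G.crossBivalent).SameCycle x.1 (G.eraseBivalent.flip x).1 :=
    Hits.sameCycle_ret
  exact (h.mem_iff (A := {z | G.chain x.1 z}) fun z hz =>
    Setoid.trans' _ hz (Setoid.trans' _ (chain_cross z) (chain_flip _))).1 (G.chain.refl x.1)

/-- A chain has at most two ends. -/
theorem eq_or_eq_flip_of_chain {x y : G.eraseBivalent.HalfEdge} (h : G.chain x.1 y.1) :
    y = x ∨ y = G.eraseBivalent.flip x := by
  let t := G.flip * G.crossBivalent
  -- Two involutions generate a dihedral group, whose orbits consist of at most two orbits of the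
  -- rotation `t`, exchanged by `crossBivalent`.
  let A : Set G.HalfEdge := {h | t.SameCycle x.1 h ∨ t.SameCycle x.1 (G.crossBivalent h)}
  have hy : y.1 ∈ A := by
    refine (chain_mem_iff (A := A) (fun z hz => ?_) (fun z hz => ?_) h).1 (Or.inl (.refl _ _))
    · rcases hz with hz | hz
      · exact Or.inr (by rwa [crossBivalent_crossBivalent])
      · exact Or.inl hz
    · rcases hz with hz | hz
      · refine Or.inr (hz.trans (Equiv.Perm.SameCycle.symm ⟨1, ?_⟩))
        rw [zpow_one]
        change G.flip (G.crossBivalent (G.crossBivalent (G.flip z))) = z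
        rw [crossBivalent_crossBivalent, G.flip_flip]
      · refine Or.inl (hz.trans ⟨1, ?_⟩)
        rw [zpow_one]
        change G.flip (G.crossBivalent (G.crossBivalent z)) = G.flip z
        rw [crossBivalent_crossBivalent]
  have hc : t.SameCycle x.1 y.1 := by
    rcases hy with hy | hy
    · exact hy
    · rwa [crossBivalent_of_notMem y.2] at hy
  have hc' : G.eraseBivalent.flip.SameCycle x y := (sameCycle_perm t (G.bivalent)ᶜ x y).2 hc
  refine (hc'.mem_iff (A := {z | z = x ∨ z = G.eraseBivalent.flip x}) ?_).1 (Or.inl rfl)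
  rintro z (rfl | rfl)
  · exact Or.inr rfl
  · exact Or.inl (G.eraseBivalent.flip_flip x)

/-- The ends of a chain are exchanged by the new `flip`, so being connected to `x` in the erased
graph is a property of chains, and `rot` at the other vertices is unchanged. -/
theorem conn_erase_iff (x y : G.eraseBivalent.HalfEdge) :
    G.eraseBivalent.connSetoid x y ↔ G.connSetoid x.1 y.1 := by
  constructor
  · exact fun h => G.eraseBivalent.connSetoid_le (r := G.connSetoid.comap Subtype.val)
      (fun z => G.connSetoid_rot z.1) (fun z => conn_of_chain (chain_erase_flip z)) h
  · intro h
    let A : Set G.HalfEdge := {h | ∃ z : G.eraseBivalent.HalfEdge,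
      G.eraseBivalent.connSetoid x z ∧ G.chain z.1 h}
    have hmem : ∀ z : G.eraseBivalent.HalfEdge, z.1 ∈ A → G.eraseBivalent.connSetoid x z := by
      rintro z ⟨w, hw, hwz⟩
      rcases eq_or_eq_flip_of_chain hwz with rfl | rfl
      · exact hw
      · exact Setoid.trans' _ hw (G.eraseBivalent.connSetoid_flip w)
    refine hmem y ((conn_mem_iff (A := A) ?_ ?_ h).1 ⟨x, Setoid.refl' _ x, Setoid.refl' _ x.1⟩)
    · intro z hz
      by_cases hzb : z ∈ G.bivalent
      · obtain ⟨w, hw, hwz⟩ := hz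
        refine ⟨w, hw, Setoid.trans' _ hwz ?_⟩
        rw [← crossBivalent_of_mem hzb]
        exact chain_cross z
      · exact ⟨G.eraseBivalent.rot ⟨z, hzb⟩, Setoid.trans' _ (hmem ⟨z, hzb⟩ hz)
          (G.eraseBivalent.connSetoid_rot _), Setoid.refl' _ _⟩
    · rintro z ⟨w, hw, hwz⟩
      exact ⟨w, hw, Setoid.trans' _ hwz (chain_flip z)⟩

/-- A chain with one end only contains an external edge. -/
theorem exists_external_of_erase_flip_eq {x : G.eraseBivalent.HalfEdge}
    (hx : G.eraseBivalent.flip x = x) : ∃ z, G.chain x.1 z ∧ G.flip z = z := by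
  by_contra! hcon
  let C : Set G.HalfEdge := {z | G.chain x.1 z}
  have h1 : Even C.ncard := Set.even_ncard_of_involution C G.flip
    (fun z hz => Setoid.trans' _ hz (chain_flip z)) (fun z _ => G.flip_flip z) hcon
  have hb : ∀ z ∈ C \ {x.1}, z ∈ G.bivalent := by
    rintro z ⟨hz, hzx⟩
    by_contra hzb
    rcases eq_or_eq_flip_of_chain (y := ⟨z, hzb⟩) hz with h | h
    · exact hzx (congrArg Subtype.val h)
    · rw [hx] at h
      exact hzx (congrArg Subtype.val h)
  -- Without external edges `flip` pairs off the whole chain, while `crossBivalent` pairs off all of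
  -- it except the only end `x`: a contradiction of parity.
  have h2 : Even (C \ {x.1}).ncard := by
    refine Set.even_ncard_of_involution _ G.crossBivalent (fun z hz => ⟨?_, ?_⟩)
      (fun z _ => crossBivalent_crossBivalent z) (fun z hz => ?_)
    · exact Setoid.trans' _ hz.1 (chain_cross z)
    · intro hzx
      have := hb z hz
      rw [← crossBivalent_mem_bivalent, show G.crossBivalent z = x.1 from hzx] at this
      exact x.2 this
    · rw [crossBivalent_of_mem (hb z hz)]
      exact (hb z hz).1
  have hxC : x.1 ∈ C := G.chain.refl x.1
  have h3 := Set.ncard_sdiff_singleton_add_one hxC (Set.toFinite C)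
  rw [← h3] at h1
  exact (Nat.even_add_one.1 h1) h2

/-! ### Edge sets that are unions of chains -/

/-- A set of edges that contains both or none of the edges at a vertex of valence two. -/
def Saturated (E : G.EdgeSet) : Prop := ∀ b ∈ G.bivalent, b ∈ E.1 → G.rot b ∈ E.1

theorem Saturated.cross_mem {E : G.EdgeSet} (hE : Saturated E) {b : G.HalfEdge} (hb : b ∈ E.1) :
    G.crossBivalent b ∈ E.1 := by
  by_cases h : b ∈ G.bivalent
  · rw [crossBivalent_of_mem h]
    exact hE b h hb
  · rwa [crossBivalent_of_notMem h]

theorem Saturated.mem_iff_of_chain {E : G.EdgeSet} (hE : Saturated E) {x y : G.HalfEdge}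
    (h : G.chain x y) : x ∈ E.1 ↔ y ∈ E.1 :=
  chain_mem_iff (fun _ hz => hE.cross_mem hz) (fun z hz => (E.2 z hz).1) h

/-- The edges that a saturated edge set leaves after erasing the vertices of valence two. -/
def eraseEdges (E : G.EdgeSet) : G.eraseBivalent.EdgeSet :=
  ⟨{x | x.1 ∈ E.1 ∧ (G.eraseBivalent.flip x).1 ∈ E.1 ∧ G.eraseBivalent.flip x ≠ x}, by
    rintro x ⟨h1, h2, h3⟩
    refine ⟨⟨h2, ?_, ?_⟩, h3⟩
    · rwa [G.eraseBivalent.flip_flip]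
    · rw [G.eraseBivalent.flip_flip]
      exact h3.symm⟩

/-- The other two conditions in `eraseEdges`, needed to get an edge set from an arbitrary `E`, are
automatic here: `E` contains the whole chain, which therefore has no external edge and cannot have
just one end. -/
theorem Saturated.mem_eraseEdges {E : G.EdgeSet} (hE : Saturated E)
    (x : G.eraseBivalent.HalfEdge) : x ∈ (eraseEdges E).1 ↔ x.1 ∈ E.1 := by
  refine ⟨fun h => h.1, fun h => ⟨h, (hE.mem_iff_of_chain (chain_erase_flip x)).1 h, fun hx => ?_⟩⟩
  obtain ⟨z, hz, hzf⟩ := exists_external_of_erase_flip_eq hx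
  exact (E.2 z ((hE.mem_iff_of_chain hz).1 h)).2 hzf

/-- A chain that starts in `E` stays in `E`, where cutting changes nothing; one that starts outside
is cut at its first edge, and its end becomes external. -/
theorem erase_flip_cutOutside {E : G.EdgeSet} (hE : Saturated E) :
    (G.cutOutside E).eraseBivalent.flip = G.eraseBivalent.flipOn (eraseEdges E) := by
  refine Equiv.ext fun (x : G.eraseBivalent.HalfEdge) => Subtype.ext ?_
  refine Eq.trans (b := ret (G.flipOn E * G.crossBivalent) (G.bivalent)ᶜ x.1) rfl ?_
  by_cases hx : x ∈ (eraseEdges E).1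
  · refine Eq.trans ?_ (congrArg Subtype.val (flipOn_of_mem (eraseEdges E) hx)).symm
    have hh : Hits (G.flip * G.crossBivalent) (G.bivalent)ᶜ x.1 := .of_mem x.2
    have key := Hits.induction (P := fun z => z ∈ E.1 →
      Hits (G.flipOn E * G.crossBivalent) (G.bivalent)ᶜ z ∧
      ret (G.flipOn E * G.crossBivalent) (G.bivalent)ᶜ z =
        ret (G.flip * G.crossBivalent) (G.bivalent)ᶜ z) ?_ ?_ hh
    · exact (key hx.1).2
    · intro z hz hzE
      have heq : (G.flipOn E * G.crossBivalent) z = (G.flip * G.crossBivalent) z :=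
        flipOn_of_mem E (hE.cross_mem hzE)
      have hz' := hz
      rw [← heq] at hz'
      exact ⟨.of_apply_mem hz', by rw [ret_of_apply_mem hz, ret_of_apply_mem hz', heq]⟩
    · intro z hz hh ih hzE
      have heq : (G.flipOn E * G.crossBivalent) z = (G.flip * G.crossBivalent) z :=
        flipOn_of_mem E (hE.cross_mem hzE)
      obtain ⟨h1, h2⟩ := ih ((G.flip_mem_iff E _).2 (hE.cross_mem hzE))
      have hz' := hz
      rw [← heq] at hz' h1
      exact ⟨h1.of_apply, by rw [hh.ret_apply hz, h1.of_apply.ret_apply hz', heq, h2]⟩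
  · refine Eq.trans ?_ (congrArg Subtype.val (flipOn_of_notMem (eraseEdges E) hx)).symm
    have hxE : x.1 ∉ E.1 := fun h => hx ((hE.mem_eraseEdges x).2 h)
    have heq : (G.flipOn E * G.crossBivalent) x.1 = x.1 := by
      rw [Equiv.Perm.mul_apply, crossBivalent_of_notMem x.2, flipOn_of_notMem E hxE]
    have hm : (G.flipOn E * G.crossBivalent) x.1 ∈ (G.bivalent)ᶜ := by
      rw [heq]
      exact x.2
    rw [ret_of_apply_mem hm, heq]

/-- Erasing vertices of valence two commutes with cutting the edges outside a saturated set. -/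
theorem erase_cutOutside {E : G.EdgeSet} (hE : Saturated E) :
    (G.cutOutside E).eraseBivalent = G.eraseBivalent.cutOutside (eraseEdges E) :=
  eq_of_rot_eq_of_flip_eq rfl (erase_flip_cutOutside hE)

theorem conn_erase_cutOutside_iff {E : G.EdgeSet} (hE : Saturated E)
    (x y : G.eraseBivalent.HalfEdge) :
    (G.eraseBivalent.cutOutside (eraseEdges E)).connSetoid x y ↔
      (G.cutOutside E).connSetoid x.1 y.1 := by
  have h : (G.cutOutside E).eraseBivalent.connSetoid =
    (G.eraseBivalent.cutOutside (eraseEdges E)).connSetoid :=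
    connSetoid_eq_of_eq rfl (erase_flip_cutOutside hE)
  rw [← h]
  exact conn_erase_iff (G := G.cutOutside E) x y

/-! ### External edges and bivalent vertices -/

/-- No vertex of valence two joins an external and an internal edge. -/
def NoHalfExternal (G : RibbonGraph) : Prop :=
  ∀ b ∈ G.bivalent, G.flip b = b → G.flip (G.rot b) = G.rot b

/-- The chain is just `{b, rot b}`: both half-edges are external, so it has no end. -/
theorem NoHalfExternal.bivalent_of_chain (hG : G.NoHalfExternal) {b x : G.HalfEdge}
    (hb : b ∈ G.bivalent) (hf : G.flip b = b) (h : G.chain b x) : x ∈ G.bivalent := by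
  have hx : x = b ∨ x = G.rot b := by
    refine (chain_mem_iff (A := {z | z = b ∨ z = G.rot b}) ?_ ?_ h).1 (Or.inl rfl)
    · rintro z (rfl | rfl)
      · exact Or.inr (crossBivalent_of_mem hb)
      · left
        rw [crossBivalent_of_mem ((G.rot_mem_bivalent b).2 hb)]
        exact hb.2
    · rintro z (rfl | rfl)
      · exact Or.inl hf
      · exact Or.inr (hG b hb hf)
  rcases hx with rfl | rfl
  · exact hb
  · exact (G.rot_mem_bivalent b).2 hb

/-- An end fixed by the new `flip` has an external edge on its chain. That half-edge is not
bivalent, as its chain has an end, so it is the end itself. -/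
theorem NoHalfExternal.erase_flip_eq_iff (hG : G.NoHalfExternal) (x : G.eraseBivalent.HalfEdge) :
    G.eraseBivalent.flip x = x ↔ G.flip x.1 = x.1 := by
  constructor
  · intro hx
    obtain ⟨z, hz, hzf⟩ := exists_external_of_erase_flip_eq hx
    by_cases hzb : z ∈ G.bivalent
    · exact absurd (hG.bivalent_of_chain hzb hzf (Setoid.symm' _ hz)) x.2
    · rcases eq_or_eq_flip_of_chain (y := ⟨z, hzb⟩) hz with h | h
      · rw [← h]
        exact hzf
      · rw [hx] at h
        rw [← h]
        exact hzf
  · intro hx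
    refine Subtype.ext ?_
    have heq : (G.flip * G.crossBivalent) x.1 = x.1 := by
      rw [Equiv.Perm.mul_apply, crossBivalent_of_notMem x.2, hx]
    have hm : (G.flip * G.crossBivalent) x.1 ∈ (G.bivalent)ᶜ := by
      rw [heq]
      exact x.2
    rw [coe_erase_flip, ret_of_apply_mem hm, heq]

/-- The edges whose chain belongs to `E`. -/
def liftEdges (hG : G.NoHalfExternal) (E : G.eraseBivalent.EdgeSet) : G.EdgeSet :=
  ⟨{h | ∃ y ∈ E.1, G.chain y.1 h}, by
    rintro h ⟨y, hy, hyh⟩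
    refine ⟨⟨y, hy, Setoid.trans' _ hyh (chain_flip h)⟩, fun hf => ?_⟩
    by_cases hb : h ∈ G.bivalent
    · exact y.2 (hG.bivalent_of_chain hb hf (Setoid.symm' _ hyh))
    · have hE : (⟨h, hb⟩ : G.eraseBivalent.HalfEdge) ∈ E.1 := by
        rcases eq_or_eq_flip_of_chain (y := ⟨h, hb⟩) hyh with h' | h'
        · rwa [h']
        · rw [h']
          exact (E.2 y hy).1
      exact (E.2 _ hE).2 ((hG.erase_flip_eq_iff _).2 hf)⟩

theorem saturated_liftEdges (hG : G.NoHalfExternal) (E : G.eraseBivalent.EdgeSet) :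
    Saturated (liftEdges hG E) := by
  rintro b hb ⟨y, hy, hyb⟩
  refine ⟨y, hy, Setoid.trans' _ hyb ?_⟩
  rw [← crossBivalent_of_mem hb]
  exact chain_cross b

theorem coe_mem_liftEdges (hG : G.NoHalfExternal) (E : G.eraseBivalent.EdgeSet)
    (x : G.eraseBivalent.HalfEdge) : x.1 ∈ (liftEdges hG E).1 ↔ x ∈ E.1 := by
  refine ⟨?_, fun h => ⟨x, h, Setoid.refl' _ _⟩⟩
  rintro ⟨y, hy, hyx⟩
  rcases eq_or_eq_flip_of_chain hyx with rfl | rfl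
  · exact hy
  · exact (E.2 y hy).1

theorem eraseEdges_liftEdges (hG : G.NoHalfExternal) (E : G.eraseBivalent.EdgeSet) :
    eraseEdges (liftEdges hG E) = E :=
  Subtype.ext (Set.ext fun x => by
    rw [(saturated_liftEdges hG E).mem_eraseEdges, coe_mem_liftEdges])

theorem Saturated.noHalfExternal_cutOutside {E : G.EdgeSet} (hE : Saturated E) :
    (G.cutOutside E).NoHalfExternal := by
  intro b hb hf
  have hbE : b ∉ E.1 := (flipOn_eq_iff E b).1 hf
  refine (flipOn_eq_iff E (G.rot b)).2 fun h => hbE ?_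
  have := hE (G.rot b) ((G.rot_mem_bivalent b).2 hb) h
  rwa [show G.rot (G.rot b) = b from hb.2] at this

/-- In a connected graph, each chain has an end, unless all vertices have valence two. -/
theorem exists_chain_of_conn {h : G.HalfEdge} (y : G.eraseBivalent.HalfEdge)
    (hy : G.connSetoid h y.1) : ∃ x : G.eraseBivalent.HalfEdge, G.chain h x.1 := by
  by_contra! hcon
  have hb : ∀ z, G.chain h z → z ∈ G.bivalent := fun z hz => by
    by_contra hzb
    exact hcon ⟨z, hzb⟩ hz
  refine hcon y ((conn_mem_iff (A := {z | G.chain h z}) (fun z hz => ?_) (fun z hz => ?_) hy).1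
    (G.chain.refl h))
  · have := chain_cross z
    rw [crossBivalent_of_mem (hb z hz)] at this
    exact Setoid.trans' _ hz this
  · exact Setoid.trans' _ hz (chain_flip z)

/-! ### Bridges -/

/-- Cutting the edge of `x` in the erased graph amounts to cutting every edge of its chain in `G`.
If this separated the two ends, the first edge of the chain alone would be a bridge of `G`. -/
theorem NoHalfExternal.bridgeless_erase (hG : G.NoHalfExternal) (hb : G.Bridgeless) :
    G.eraseBivalent.Bridgeless := by
  intro x hx
  have hx' : G.flip x.1 ≠ x.1 := fun h => hx ((hG.erase_flip_eq_iff x).2 h)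
  let D : G.EdgeSet := ⟨{h | G.flip h ≠ h ∧ ¬ G.chain x.1 h}, by
    rintro h ⟨h1, h2⟩
    refine ⟨⟨?_, fun h' => h2 ?_⟩, h1⟩
    · rw [G.flip_flip]
      exact h1.symm
    · exact Setoid.trans' _ h' (Setoid.symm' _ (chain_flip h))⟩
  have hD : Saturated D := by
    rintro b hb ⟨h1, h2⟩
    refine ⟨fun h => h1 ?_, fun h => h2 ?_⟩
    · have := hG (G.rot b) ((G.rot_mem_bivalent b).2 hb) h
      rwa [show G.rot (G.rot b) = b from hb.2] at this
    · have h3 := chain_cross b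
      rw [crossBivalent_of_mem hb] at h3
      exact Setoid.trans' _ h (Setoid.symm' _ h3)
  have hDE : eraseEdges D = G.eraseBivalent.edgesExcept x := by
    refine Subtype.ext (Set.ext fun z => ?_)
    rw [hD.mem_eraseEdges]
    change (G.flip z.1 ≠ z.1 ∧ ¬ G.chain x.1 z.1) ↔ (_ ∧ _ ∧ _)
    rw [ne_eq, ← hG.erase_flip_eq_iff]
    refine and_congr_right fun _ => (not_congr ⟨eq_or_eq_flip_of_chain, ?_⟩).trans not_or
    rintro (rfl | rfl)
    · exact Setoid.refl' _ _
    · exact chain_erase_flip x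
  rw [← hDE, conn_erase_cutOutside_iff hD]
  by_contra hcon
  -- The component of `x` meets its chain only in `x`: the bivalent vertices of the chain are
  -- isolated after the cuts, and the other end is excluded by `hcon`.
  have hchain : ∀ z, (G.cutOutside D).connSetoid x.1 z → G.chain x.1 z → z = x.1 := by
    intro z hz hzc
    by_cases hzb : z ∈ G.bivalent
    · exfalso
      have hcl : x.1 = z ∨ x.1 = G.rot z := by
        refine (conn_mem_iff (G := G.cutOutside D) (A := {w | w = z ∨ w = G.rot z}) ?_ ?_
          (Setoid.symm' _ hz)).1 (Or.inl rfl)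
        · rintro w (rfl | rfl)
          · exact Or.inr rfl
          · exact Or.inl hzb.2
        · rintro w (rfl | rfl)
          · exact Or.inl (flipOn_of_notMem D fun h => h.2 hzc)
          · refine Or.inr (flipOn_of_notMem D fun h => h.2 ?_)
            rw [← crossBivalent_of_mem (G := G) hzb]
            exact Setoid.trans' _ hzc (chain_cross (G := G) z)
      rcases hcl with h | h
      · exact x.2 (h ▸ hzb)
      · exact x.2 (h ▸ (G.rot_mem_bivalent z).2 hzb)
    · rcases eq_or_eq_flip_of_chain (G := G) (x := x) (y := ⟨z, hzb⟩) hzc with h | h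
      · exact congrArg Subtype.val h
      · exfalso
        rw [← h] at hcon
        exact hcon hz
  -- So the only exit from this component is the edge of `x`. With that edge cut in `G` the
  -- component is still closed, and it contains `flip x` because the edge is no bridge.
  have hfx : (G.cutOutside D).connSetoid x.1 (G.flip x.1) := by
    refine (conn_mem_iff (G := G.cutOutside (G.edgesExcept x.1))
      (A := {z | (G.cutOutside D).connSetoid x.1 z}) (fun z hz => ?_) (fun z hz => ?_)
      (hb x.1 hx')).1 ((G.cutOutside D).connSetoid.refl x.1)
    · exact Setoid.trans' _ hz ((G.cutOutside D).connSetoid_rot z)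
    · change (G.cutOutside D).connSetoid x.1 (G.flipOn (G.edgesExcept x.1) z)
      by_cases hzE : z ∈ (G.edgesExcept x.1).1
      · rw [flipOn_of_mem _ hzE]
        have hzD : z ∈ D.1 := ⟨hzE.1, fun h => hzE.2.1 (hchain z hz h)⟩
        have h3 := (G.cutOutside D).connSetoid_flip z
        rw [show (G.cutOutside D).flip z = G.flip z from flipOn_of_mem D hzD] at h3
        exact Setoid.trans' _ hz h3
      · rw [flipOn_of_notMem _ hzE]
        exact hz
  exact hx' (hchain _ hfx (chain_flip x.1))

/-- Cutting one edge breaks its chain into two pieces, each of which runs to an end of the chain,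
and the ends are joined outside the chain. The hypothesis `hm` excludes closed chains. -/
theorem NoHalfExternal.bridgeless_of_erase (hG : G.NoHalfExternal)
    (hb : G.eraseBivalent.Bridgeless)
    (hm : ∀ h, G.flip h ≠ h → ∃ x : G.eraseBivalent.HalfEdge, G.chain h x.1) :
    G.Bridgeless := by
  intro h hh
  obtain ⟨x, hx⟩ := hm h hh
  have hfx : G.eraseBivalent.flip x ≠ x := by
    intro hf
    have hf' := (hG.erase_flip_eq_iff x).1 hf
    have hhx : h = x.1 := by
      refine (chain_mem_iff (A := {z | z = x.1}) ?_ ?_ (Setoid.symm' _ hx)).1 rfl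
      · rintro z rfl
        exact crossBivalent_of_notMem x.2
      · rintro z rfl
        exact hf'
    exact hh (hhx ▸ hf')
  let R := (G.cutOutside (G.edgesExcept h)).connSetoid
  -- A path of the erased graph that avoids the edge of `x` runs along other chains, which the cut
  -- at `h` does not affect.
  have hxx : R x.1 (G.eraseBivalent.flip x).1 := by
    have h1 := hb x hfx
    refine (G.eraseBivalent.cutOutside (G.eraseBivalent.edgesExcept x)).connSetoid_le
      (r := R.comap Subtype.val) (fun z => ?_) (fun z => ?_) h1
    · exact (G.cutOutside (G.edgesExcept h)).connSetoid_rot z.1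
    · change R z.1 (G.eraseBivalent.flipOn (G.eraseBivalent.edgesExcept x) z).1
      by_cases hz : z ∈ (G.eraseBivalent.edgesExcept x).1
      · rw [flipOn_of_mem _ hz]
        have hzc : ∀ w, G.chain z.1 w → ¬ G.chain h w := by
          intro w hw hw'
          rcases eq_or_eq_flip_of_chain (Setoid.trans' _ (Setoid.trans' _ (Setoid.symm' _ hx) hw')
            (Setoid.symm' _ hw)) with h2 | h2
          · exact hz.2.1 h2
          · exact hz.2.2 h2
        have key : G.chain z.1 (G.eraseBivalent.flip z).1 ∧ R z.1 (G.eraseBivalent.flip z).1 := by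
          refine (chain_mem_iff (A := {w | G.chain z.1 w ∧ R z.1 w}) ?_ ?_
            (chain_erase_flip z)).1 ⟨Setoid.refl' _ _, Setoid.refl' _ _⟩
          · rintro w ⟨h2, h3⟩
            refine ⟨Setoid.trans' _ h2 (chain_cross w), ?_⟩
            by_cases hw : w ∈ G.bivalent
            · rw [crossBivalent_of_mem hw]
              exact Setoid.trans' _ h3 ((G.cutOutside (G.edgesExcept h)).connSetoid_rot w)
            · rwa [crossBivalent_of_notMem hw]
          · rintro w ⟨h2, h3⟩
            refine ⟨Setoid.trans' _ h2 (chain_flip w), Setoid.trans' _ h3 ?_⟩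
            have h4 := (G.cutOutside (G.edgesExcept h)).connSetoid_flip w
            rwa [show (G.cutOutside (G.edgesExcept h)).flip w = G.flip w from
              flipOn_edgesExcept (fun h' => hzc w h2 (h' ▸ Setoid.refl' _ _))
                (fun h' => hzc w h2 (h' ▸ chain_flip h))] at h4
        exact key.2
      · rw [flipOn_of_notMem _ hz]
        exact Setoid.refl' _ _
  -- Following the chain from the cut leads to an end, unless it leads back to the other side of the
  -- cut.
  have hside : ∀ b, (b = h ∨ b = G.flip h) →
      (∀ y : G.eraseBivalent.HalfEdge, G.chain h y.1 → ¬ R b y.1) → R b (G.flip b) := by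
    intro b hbh hno
    by_contra hcon
    have hexc : G.edgesExcept b = G.edgesExcept h := by
      rcases hbh with rfl | rfl
      · rfl
      · exact edgesExcept_flip h
    have hhb : G.chain h b := by
      rcases hbh with rfl | rfl
      · exact Setoid.refl' _ _
      · exact chain_flip h
    -- The piece of the chain on the side of `b`. If it had no end and did not contain `flip b`,
    -- then `crossBivalent` would pair off `B` and `flip` would pair off `B \ {b}`.
    let B : Set G.HalfEdge := {z | R b z ∧ G.chain h z}
    have hBb : ∀ z ∈ B, z ∈ G.bivalent := fun z hz => by
      by_contra hzb
      exact hno ⟨z, hzb⟩ hz.2 hz.1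
    have h1 : Even B.ncard := by
      refine Set.even_ncard_of_involution B G.crossBivalent (fun z hz => ⟨?_, ?_⟩)
        (fun z _ => crossBivalent_crossBivalent z) (fun z hz => ?_)
      · rw [crossBivalent_of_mem (hBb z hz)]
        exact Setoid.trans' _ hz.1 ((G.cutOutside (G.edgesExcept h)).connSetoid_rot z)
      · exact Setoid.trans' _ hz.2 (chain_cross z)
      · rw [crossBivalent_of_mem (hBb z hz)]
        exact (hBb z hz).1
    have hfb : ∀ z, z ∈ B \ {b} → z ≠ G.flip b := by
      rintro z hz rfl
      exact hcon hz.1.1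
    have h2 : Even (B \ {b}).ncard := by
      refine Set.even_ncard_of_involution _ G.flip (fun z hz => ⟨⟨?_, ?_⟩, ?_⟩)
        (fun z _ => G.flip_flip z) (fun z hz hf => ?_)
      · have h4 := (G.cutOutside (G.edgesExcept h)).connSetoid_flip z
        rw [show (G.cutOutside (G.edgesExcept h)).flip z = G.flip z by
          change G.flipOn (G.edgesExcept h) z = _
          rw [← hexc]
          exact flipOn_edgesExcept hz.2 (hfb z hz)] at h4
        exact Setoid.trans' _ hz.1.1 h4
      · exact Setoid.trans' _ hz.1.2 (chain_flip z)
      · intro h5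
        refine hfb z hz ?_
        rw [← show G.flip z = b from h5, G.flip_flip]
      · exact x.2 (hG.bivalent_of_chain (hBb z hz.1) hf
          (Setoid.trans' _ (Setoid.symm' _ hz.1.2) hx))
    have hbB : b ∈ B := ⟨Setoid.refl' _ _, hhb⟩
    have h3 := Set.ncard_sdiff_singleton_add_one hbB (Set.toFinite B)
    rw [← h3] at h1
    exact (Nat.even_add_one.1 h1) h2
  have hends : ∀ y : G.eraseBivalent.HalfEdge, G.chain h y.1 → R x.1 y.1 := by
    intro y hy
    rcases eq_or_eq_flip_of_chain (Setoid.trans' _ (Setoid.symm' _ hx) hy) with rfl | rfl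
    · exact Setoid.refl' _ _
    · exact hxx
  -- Both ends of the chain are in the class of `x`. A half of the cut edge outside this class
  -- reaches no end, so `hside` joins it to the other half.
  by_cases hc1 : R h x.1
  · by_cases hc2 : R (G.flip h) x.1
    · exact Setoid.trans' _ hc1 (Setoid.symm' _ hc2)
    · have := hside (G.flip h) (Or.inr rfl) fun y hy hr =>
        hc2 (Setoid.trans' _ hr (Setoid.symm' _ (hends y hy)))
      rw [G.flip_flip] at this
      exact Setoid.symm' _ this
  · exact hside h (Or.inl rfl) fun y hy hr => hc1 (Setoid.trans' _ hr (Setoid.symm' _ (hends y hy)))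

/-- Contraction preserves and reflects the absence of bridges. -/
theorem bridgeless_contract_iff {D : G.EdgeSet} (hD : (G.cutOutside D).OneBrokenFace)
    (hDb : (G.cutOutside D).Bridgeless) : (G.contract D).Bridgeless ↔ G.Bridgeless := by
  have key : ∀ x : (G.contract D).HalfEdge,
      ((G.contract D).cutOutside ((G.contract D).edgesExcept x)).connSetoid x
        ((G.contract D).flip x) ↔
      (G.cutOutside (G.edgesExcept x.1)).connSetoid x.1 (G.flip x.1) := by
    intro x
    have hsub : D.1 ⊆ (G.edgesExcept x.1).1 := fun z hz => ⟨(D.2 z hz).2, fun h => x.2 (h ▸ hz),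
      fun h => x.2 ((G.flip_mem_iff D x.1).1 (h ▸ hz))⟩
    have hE : contractEdges D (G.edgesExcept x.1) = (G.contract D).edgesExcept x := by
      refine Subtype.ext (Set.ext fun z => ?_)
      exact and_congr (not_congr (Subtype.ext_iff (a1 := (G.contract D).flip z) (a2 := z)).symm)
        (and_congr (not_congr Subtype.ext_iff.symm)
          (not_congr (Subtype.ext_iff (a1 := z) (a2 := (G.contract D).flip x)).symm))
    rw [← hE]
    exact conn_contract_cutOutside_iff hD hsub x ((G.contract D).flip x)
  constructor
  · intro hb h hh
    by_cases hhD : h ∈ D.1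
    · exact conn_cutOutside_mono (D := removeEdge D h) (D' := G.edgesExcept h)
        (fun z hz => ⟨(D.2 z hz.1).2, hz.2⟩)
        (bridgeless_cutOutside_iff.1 hDb h hhD)
    · exact (key ⟨h, hhD⟩).1 (hb _ fun h' => hh (congrArg Subtype.val h'))
  · intro hb x hx
    exact (key x).2 (hb x.1 fun h => hx (Subtype.ext h))

end RibbonGraph

namespace RibbonGraph

variable {G : RibbonGraph}

open FirstReturn

/-! ### Components -/

theorem conn_iff_of_equivariant {A B : RibbonGraph} (i : B.HalfEdge → A.HalfEdge)
    (hi : Function.Injective i) (hr : ∀ x, i (B.rot x) = A.rot (i x))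
    (hf : ∀ x, i (B.flip x) = A.flip (i x)) (x y : B.HalfEdge) :
    B.connSetoid x y ↔ A.connSetoid (i x) (i y) := by
  constructor
  · refine B.connSetoid_le (r := A.connSetoid.comap i) (fun z => ?_) (fun z => ?_)
    · change A.connSetoid (i z) (i (B.rot z))
      rw [hr]
      exact A.connSetoid_rot _
    · change A.connSetoid (i z) (i (B.flip z))
      rw [hf]
      exact A.connSetoid_flip _
  · intro h
    obtain ⟨z, hz, hxz⟩ := (conn_mem_iff (A := {h | ∃ z, i z = h ∧ B.connSetoid x z})
      (by
        rintro _ ⟨z, rfl, hz⟩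
        exact ⟨B.rot z, hr z, Setoid.trans' _ hz (B.connSetoid_rot z)⟩)
      (by
        rintro _ ⟨z, rfl, hz⟩
        exact ⟨B.flip z, hf z, Setoid.trans' _ hz (B.connSetoid_flip z)⟩) h).1
      ⟨x, rfl, B.connSetoid.refl x⟩
    rwa [← hi hz]

theorem conn_component (c : Quotient G.connSetoid) (x y : (G.component c).HalfEdge) :
    (G.component c).connSetoid x y :=
  (conn_iff_of_equivariant (A := G) (B := G.component c) Subtype.val Subtype.val_injective
    (fun _ => rfl) (fun _ => rfl) x y).2 (Quotient.exact (x.2.trans y.2.symm))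

theorem isConnected_component (c : Quotient G.connSetoid) : (G.component c).IsConnected := by
  refine ⟨?_, conn_component c⟩
  induction c using Quotient.inductionOn with
  | h x => exact ⟨⟨x, rfl⟩⟩

theorem component_sameCycle_rot (c : Quotient G.connSetoid) (x y : (G.component c).HalfEdge) :
    (G.component c).rot.SameCycle x y ↔ G.rot.SameCycle x.1 y.1 :=
  Equiv.Perm.sameCycle_subtypePerm (f := G.rot) (h := fun h => by
    rw [Quotient.sound (s := G.connSetoid) (G.connSetoid_rot h)])

theorem component_sameCycle_face (c : Quotient G.connSetoid) (x y : (G.component c).HalfEdge) :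
    ((G.component c).rot * (G.component c).flip).SameCycle x y ↔
      (G.rot * G.flip).SameCycle x.1 y.1 :=
  Equiv.Perm.sameCycle_subtypePerm (f := G.rot * G.flip) (h := fun h => by
    have h1 : Quotient.mk G.connSetoid h = Quotient.mk _ ((G.rot * G.flip) h) :=
      Quotient.sound (s := G.connSetoid) (G.connSetoid.trans (G.connSetoid_flip h)
        (G.connSetoid_rot _))
    rw [h1])

/-- The edges of `E` in a component. -/
def componentEdges (E : G.EdgeSet) (c : Quotient G.connSetoid) : (G.component c).EdgeSet :=
  ⟨{x | x.1 ∈ E.1}, fun x hx => ⟨(E.2 x.1 hx).1, fun h => (E.2 x.1 hx).2 (congrArg Subtype.val h)⟩⟩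

theorem coe_flipOn_componentEdges (E : G.EdgeSet) (c : Quotient G.connSetoid)
    (x : (G.component c).HalfEdge) :
    ((G.component c).flipOn (componentEdges E c) x).1 = G.flipOn E x.1 := by
  by_cases hx : x.1 ∈ E.1
  · rw [flipOn_of_mem (componentEdges E c) (h := x) hx, flipOn_of_mem E hx]
    rfl
  · rw [flipOn_of_notMem (componentEdges E c) (h := x) hx, flipOn_of_notMem E hx]

theorem conn_component_cutOutside_iff (E : G.EdgeSet) (c : Quotient G.connSetoid)
    (x y : (G.component c).HalfEdge) :
    ((G.component c).cutOutside (componentEdges E c)).connSetoid x y ↔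
      (G.cutOutside E).connSetoid x.1 y.1 :=
  conn_iff_of_equivariant (A := G.cutOutside E)
    (B := (G.component c).cutOutside (componentEdges E c)) Subtype.val Subtype.val_injective
    (fun _ => rfl) (fun x => coe_flipOn_componentEdges E c x) x y

theorem component_edgesExcept (c : Quotient G.connSetoid) (x : (G.component c).HalfEdge) :
    (G.component c).edgesExcept x = componentEdges (G.edgesExcept x.1) c :=
  Subtype.ext (Set.ext fun z => and_congr
    (not_congr (Subtype.ext_iff (a1 := (G.component c).flip z) (a2 := z)))
    (and_congr (not_congr Subtype.ext_iff)
      (not_congr (Subtype.ext_iff (a1 := z) (a2 := (G.component c).flip x)))))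

theorem bridgeless_component_iff (c : Quotient G.connSetoid) :
    (G.component c).Bridgeless ↔ ∀ x : (G.component c).HalfEdge, G.flip x.1 ≠ x.1 →
      (G.cutOutside (G.edgesExcept x.1)).connSetoid x.1 (G.flip x.1) := by
  refine forall_congr' fun x => imp_congr (not_congr
    (Subtype.ext_iff (a1 := (G.component c).flip x) (a2 := x))) ?_
  rw [component_edgesExcept, conn_component_cutOutside_iff]
  rfl

theorem bridgeless_iff_component : G.Bridgeless ↔ ∀ c, (G.component c).Bridgeless := by
  simp_rw [bridgeless_component_iff]
  exact ⟨fun h c x hx => h x.1 hx, fun h x hx => h (Quotient.mk _ x) ⟨x, rfl⟩ hx⟩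

theorem is1PI_component_iff (c : Quotient G.connSetoid) : (G.component c).Is1PI ↔
    (∃ x : (G.component c).HalfEdge, G.flip x.1 ≠ x.1) ∧ (G.component c).Bridgeless := by
  rw [is1PI_iff]
  refine ⟨fun h => ⟨?_, h.2.2⟩, fun h => ⟨isConnected_component c, ?_, h.2⟩⟩
  · obtain ⟨x, hx⟩ := h.2.1
    exact ⟨x, fun h' => hx (Subtype.ext h')⟩
  · obtain ⟨x, hx⟩ := h.1
    exact ⟨x, fun h' => hx (congrArg Subtype.val h')⟩

theorem isQuartic_component (hG : G.IsQuartic) (c : Quotient G.connSetoid) :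
    (G.component c).IsQuartic := by
  intro x
  rw [minimalPeriod_eq_card_sameCycle, ← hG x.1, minimalPeriod_eq_card_sameCycle]
  refine Nat.card_congr ⟨fun y => ⟨y.1.1, (component_sameCycle_rot c x y.1).1 y.2⟩,
    fun y => ⟨⟨y.1, ?_⟩, ?_⟩, fun _ => rfl, fun _ => rfl⟩
  · exact (Quotient.sound (s := G.connSetoid) (conn_of_sameCycle_rot y.2)).symm.trans x.2
  · exact (component_sameCycle_rot c x _).2 y.2

/-! ### Euler characteristic and broken faces -/

/-- With `r` connectedness and `s` the cycle relation of `rot` or of `rot * flip`, this adds up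
vertices and faces over the components. -/
theorem card_quotient_eq_sum {X : Type} [Finite X] (r s : Setoid X) (h : ∀ x y, s x y → r x y)
    (t : ∀ c : Quotient r, Setoid {x // Quotient.mk r x = c})
    (ht : ∀ c x y, t c x y ↔ s x.1 y.1) [Fintype (Quotient r)] :
    Nat.card (Quotient s) = ∑ c, Nat.card (Quotient (t c)) := by
  let f : Quotient s → Quotient r := Quotient.lift (Quotient.mk r) fun a b hab =>
    Quotient.sound (h a b hab)
  rw [← Nat.card_congr (Equiv.sigmaFiberEquiv f), Nat.card_sigma]
  refine Finset.sum_congr rfl fun c _ => ?_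
  refine Nat.card_congr (Equiv.trans (Equiv.subtypeEquivRight fun q => ?_)
    (quotientEquivMeets (t c) s Subtype.val (ht c)).symm)
  induction q using Quotient.inductionOn with
  | h x =>
    constructor
    · intro hx
      exact ⟨⟨x, hx⟩, rfl⟩
    · rintro ⟨a, ha⟩
      rw [← ha]
      exact a.2

theorem card_subtype_eq_sum {X : Type} [Finite X] (r : Setoid X) (P : X → Prop)
    [Fintype (Quotient r)] :
    Nat.card {x // P x} = ∑ c : Quotient r, Nat.card {x : {x // Quotient.mk r x = c} // P x.1} := by
  rw [← Nat.card_congr (Equiv.sigmaFiberEquiv fun x : {x // P x} => Quotient.mk r x.1),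
    Nat.card_sigma]
  refine Finset.sum_congr rfl fun c _ => Nat.card_congr
    ⟨fun x => ⟨⟨x.1.1, x.2⟩, x.1.2⟩, fun x => ⟨⟨x.1.1, x.2⟩, x.1.2⟩, fun _ => rfl, fun _ => rfl⟩

/-- The Euler characteristic `V - I + F`. -/
def euler (G : RibbonGraph) : ℚ :=
  (G.numVertices : ℚ) - (G.numInternalHalfEdges : ℚ) / 2 + (G.numFaces : ℚ)

theorem genus_eq_zero_iff : G.genus = 0 ↔ G.euler = 2 := by
  rw [genus, ← euler]
  constructor <;> intro h <;> linarith

theorem euler_eq_sum [Fintype (Quotient G.connSetoid)] :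
    G.euler = ∑ c, (G.component c).euler := by
  have hV : G.numVertices = ∑ c, (G.component c).numVertices :=
    card_quotient_eq_sum G.connSetoid (Equiv.Perm.SameCycle.setoid G.rot)
      (fun x y => conn_of_sameCycle_rot)
      (fun c => Equiv.Perm.SameCycle.setoid (G.component c).rot)
      (fun c x y => component_sameCycle_rot c x y)
  have hF : G.numFaces = ∑ c, (G.component c).numFaces :=
    card_quotient_eq_sum G.connSetoid (Equiv.Perm.SameCycle.setoid (G.rot * G.flip))
      (fun x y => conn_of_sameCycle_face)
      (fun c => Equiv.Perm.SameCycle.setoid ((G.component c).rot * (G.component c).flip))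
      (fun c x y => component_sameCycle_face c x y)
  have hI : G.numInternalHalfEdges = ∑ c, (G.component c).numInternalHalfEdges := by
    refine (card_subtype_eq_sum G.connSetoid _).trans (Finset.sum_congr rfl fun c _ =>
      Nat.card_congr (Equiv.subtypeEquivRight fun x => ?_))
    exact (not_congr (Subtype.ext_iff (a1 := (G.component c).flip x) (a2 := x))).symm
  simp only [euler, hV, hF, hI, Nat.cast_sum, Finset.sum_add_distrib, Finset.sum_sub_distrib,
    Finset.sum_div]

/-- The relation on the external edges of lying on the same face. -/
def externalSetoid (G : RibbonGraph) : Setoid {h : G.HalfEdge // G.flip h = h} :=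
  (Equiv.Perm.SameCycle.setoid (G.rot * G.flip)).comap Subtype.val

theorem numBrokenFaces_eq : G.numBrokenFaces = Nat.card (Quotient G.externalSetoid) := by
  refine (Nat.card_congr ((quotientEquivMeets G.externalSetoid _ Subtype.val
    (fun _ _ => Iff.rfl)).trans (Equiv.subtypeEquivRight fun f => ?_))).symm
  exact ⟨fun ⟨a, ha⟩ => ⟨a.1, a.2, ha⟩, fun ⟨a, h, ha⟩ => ⟨⟨a, h⟩, ha⟩⟩

/-- Graphs with the same external edges, which lie in the same way on the faces, have the same
numbers of external edges and of broken faces. -/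
theorem external_congr {A B : RibbonGraph}
    (e : {h : A.HalfEdge // A.flip h = h} ≃ {h : B.HalfEdge // B.flip h = h})
    (he : ∀ x y, (A.rot * A.flip).SameCycle x.1 y.1 ↔
      (B.rot * B.flip).SameCycle (e x).1 (e y).1) :
    A.numExternalEdges = B.numExternalEdges ∧ A.numBrokenFaces = B.numBrokenFaces := by
  refine ⟨Nat.card_congr e, ?_⟩
  rw [numBrokenFaces_eq, numBrokenFaces_eq]
  exact Nat.card_congr (Quotient.congr e he)

theorem numBrokenFaces_eq_one_iff : G.numBrokenFaces = 1 ↔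
    (∀ x y, G.flip x = x → G.flip y = y → (G.rot * G.flip).SameCycle x y) ∧
      ∃ x, G.flip x = x := by
  rw [numBrokenFaces_eq, Nat.card_eq_one_iff_unique]
  constructor
  · rintro ⟨h1, ⟨q⟩⟩
    refine ⟨fun x y hx hy => ?_, ?_⟩
    · exact Quotient.exact (Subsingleton.elim (Quotient.mk G.externalSetoid ⟨x, hx⟩)
        (Quotient.mk G.externalSetoid ⟨y, hy⟩))
    · induction q using Quotient.inductionOn with
      | h x => exact ⟨x.1, x.2⟩
  · rintro ⟨h1, x, hx⟩
    refine ⟨⟨fun a b => ?_⟩, ⟨Quotient.mk _ ⟨x, hx⟩⟩⟩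
    induction a using Quotient.inductionOn with
    | h a =>
      induction b using Quotient.inductionOn with
      | h b => exact Quotient.sound (h1 a.1 b.1 a.2 b.2)

/-- All components are planar regular with two or four external edges. -/
def LocallyDivergent (G : RibbonGraph) : Prop := ∀ c, (G.component c).IsPrimitivelyDivergent

theorem LocallyDivergent.oneBrokenFace (hG : G.LocallyDivergent) : G.OneBrokenFace := by
  refine ⟨fun x y hx hy hxy => ?_, fun x => ?_⟩
  · have h := (numBrokenFaces_eq_one_iff.1 (hG (Quotient.mk _ x)).2.1).1
      ⟨x, rfl⟩ ⟨y, Quotient.sound (Setoid.symm' _ hxy)⟩ (Subtype.ext hx) (Subtype.ext hy)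
    exact (component_sameCycle_face _ _ _).1 h
  · obtain ⟨y, hy⟩ := (numBrokenFaces_eq_one_iff.1 (hG (Quotient.mk _ x)).2.1).2
    exact ⟨y.1, congrArg Subtype.val hy, Quotient.exact y.2.symm⟩

/-- The valence of the new vertex is the number of external edges of the component: all of them lie
on one face of the cut graph, hence in one cycle of the first return. -/
theorem contract_minimalPeriod {D : G.EdgeSet} (hD : (G.cutOutside D).LocallyDivergent)
    (x : (G.contract D).HalfEdge) :
    Function.minimalPeriod (G.contract D).rot x = 2 ∨
      Function.minimalPeriod (G.contract D).rot x = 4 := by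
  have h := (hD (Quotient.mk _ x.1)).2.2
  suffices heq : Function.minimalPeriod (G.contract D).rot x =
      ((G.cutOutside D).component (Quotient.mk _ x.1)).numExternalEdges by rwa [heq]
  rw [minimalPeriod_eq_card_sameCycle]
  refine Nat.card_congr ⟨fun y => ⟨⟨y.1.1, ?_⟩, Subtype.ext (flipOn_of_notMem D y.1.2)⟩,
    fun y => ⟨⟨y.1.1, ?_⟩, ?_⟩, fun _ => rfl, fun _ => rfl⟩
  · refine Quotient.sound (s := (G.cutOutside D).connSetoid) (Setoid.symm' _ ?_)
    exact conn_of_sameCycle_face (G := G.cutOutside D) ((contract_sameCycle_rot D x y.1).1 y.2)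
  · exact (flipOn_eq_iff D y.1.1).1 (congrArg Subtype.val y.2)
  · refine (contract_sameCycle_rot D x _).2 ?_
    exact hD.oneBrokenFace.1 _ _ (flipOn_of_notMem D x.2) (congrArg Subtype.val y.2)
      (Quotient.exact y.1.2.symm)

theorem minimalPeriod_erase (x : G.eraseBivalent.HalfEdge) :
    Function.minimalPeriod G.eraseBivalent.rot x = Function.minimalPeriod G.rot x.1 := by
  rw [minimalPeriod_eq_card_sameCycle, minimalPeriod_eq_card_sameCycle]
  refine Nat.card_congr ⟨fun y => ⟨y.1.1, (erase_sameCycle_rot x y.1).1 y.2⟩,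
    fun y => ⟨⟨y.1, ?_⟩, ?_⟩, fun _ => rfl, fun _ => rfl⟩
  · exact (y.2.mem_iff (A := (G.bivalent)ᶜ)
      fun z hz => fun h => hz ((G.rot_mem_bivalent z).1 h)).1 x.2
  · exact (erase_sameCycle_rot x _).2 y.2

theorem mem_bivalent_iff (h : G.HalfEdge) :
    h ∈ G.bivalent ↔ Function.minimalPeriod G.rot h = 2 := by
  constructor
  · rintro ⟨h1, h2⟩
    exact Function.minimalPeriod_eq_prime h2 h1
  · intro h2
    have hp := Function.isPeriodicPt_minimalPeriod G.rot h
    rw [h2] at hp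
    refine ⟨fun h1 => ?_, hp⟩
    have := Function.minimalPeriod_eq_one_iff_isFixedPt.2 (show Function.IsFixedPt G.rot h from h1)
    omega

theorem isQuartic_shrink {D : G.EdgeSet} (hD : (G.cutOutside D).LocallyDivergent) :
    (G.shrink D).IsQuartic := by
  intro x
  have h1 : Function.minimalPeriod (G.shrink D).rot x = _ :=
    minimalPeriod_erase (G := G.contract D) x
  rw [h1]
  exact (contract_minimalPeriod hD x.1).resolve_left fun h => x.2 ((mem_bivalent_iff x.1).2 h)

/-! ### The Euler characteristic under contraction and erasure -/

theorem sameCycle_congr {X : Type} [Finite X] {p q : Equiv.Perm X} {x y : X}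
    (h : ∀ z, p.SameCycle x z → p z = q z) : p.SameCycle x y ↔ q.SameCycle x y := by
  have hn : ∀ n : ℕ, (p ^ n) x = (q ^ n) x := by
    intro n
    induction n with
    | zero => rfl
    | succ n ih =>
      rw [pow_succ', pow_succ', Equiv.Perm.mul_apply, Equiv.Perm.mul_apply, ← ih]
      exact h _ ⟨n, by simp⟩
  constructor
  · intro hxy
    obtain ⟨n, rfl⟩ := hxy.exists_nat_pow_eq
    rw [hn]
    exact ⟨n, by simp⟩
  · intro hxy
    obtain ⟨n, rfl⟩ := hxy.exists_nat_pow_eq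
    rw [← hn]
    exact ⟨n, by simp⟩

/-- Permutations that agree on `S` have the same number of cycles contained in `S`. -/
theorem card_cycles_subset {X : Type} [Finite X] (p q : Equiv.Perm X) (S : Set X)
    (h : ∀ x ∈ S, p x = q x) :
    Nat.card {c : Quotient (Equiv.Perm.SameCycle.setoid p) //
        ¬ ∃ x : (Sᶜ : Set X), Quotient.mk _ x.1 = c} =
      Nat.card {c : Quotient (Equiv.Perm.SameCycle.setoid q) //
        ¬ ∃ x : (Sᶜ : Set X), Quotient.mk _ x.1 = c} := by
  -- Such cycles are counted as classes of the points whose whole cycle stays in `S`; on these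
  -- points `p` and `q` have the same orbits.
  have hW : ∀ p : Equiv.Perm X, Nat.card {c : Quotient (Equiv.Perm.SameCycle.setoid p) //
        ¬ ∃ x : (Sᶜ : Set X), Quotient.mk _ x.1 = c} =
      Nat.card (Quotient ((Equiv.Perm.SameCycle.setoid p).comap
        (Subtype.val : {x // ∀ y, p.SameCycle x y → y ∈ S} → X))) := by
    intro p
    refine (Nat.card_congr ((quotientEquivMeets _ (Equiv.Perm.SameCycle.setoid p)
      (Subtype.val : {x // ∀ y, p.SameCycle x y → y ∈ S} → X) (fun _ _ => Iff.rfl)).trans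
      (Equiv.subtypeEquivRight fun c => ?_))).symm
    induction c using Quotient.inductionOn with
    | h x =>
      constructor
      · rintro ⟨a, ha⟩ ⟨b, hb⟩
        exact b.2 (a.2 b.1 (Quotient.exact (ha.trans hb.symm)))
      · intro hx
        refine ⟨⟨x, fun y hy => ?_⟩, rfl⟩
        by_contra hyS
        exact hx ⟨⟨y, hyS⟩, Quotient.sound (Equiv.Perm.SameCycle.symm hy)⟩
  have hpq : ∀ {p q : Equiv.Perm X}, (∀ x ∈ S, p x = q x) → ∀ x,
      (∀ y, p.SameCycle x y → y ∈ S) → ∀ y, p.SameCycle x y ↔ q.SameCycle x y :=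
    fun h x hx y => sameCycle_congr fun z hz => h z (hx z hz)
  rw [hW p, hW q]
  refine Nat.card_congr (Quotient.congr (Equiv.subtypeEquivRight fun x => ?_) fun a b => ?_)
  · constructor
    · exact fun hx y hy => hx y ((hpq h x hx y).2 hy)
    · exact fun hx y hy => hx y ((hpq (fun z hz => (h z hz).symm) x hx y).2 hy)
  · exact hpq h a.1 a.2 b.1

theorem card_eq_card_add_card_not {X : Type} [Finite X] (P : X → Prop) :
    Nat.card X = Nat.card {x // P x} + Nat.card {x // ¬ P x} := by
  classical
  rw [← Nat.card_sum]
  exact Nat.card_congr (Equiv.sumCompl P).symm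

/-- Let `n` be the number of components of the cut graph, which is the number of new vertices, and
`w` the number of faces of `G` contained in `D`. The cut graph has the vertices of `G`, the edges of
`D` and `n + w` faces, and planarity makes its Euler characteristic `2 n`; so `V - I(D) + w = n`.
Contraction replaces precisely the left side by `n`. -/
theorem euler_contract {D : G.EdgeSet} (hD : (G.cutOutside D).LocallyDivergent) :
    (G.contract D).euler = G.euler := by
  classical
  have : Fintype (Quotient (G.cutOutside D).connSetoid) := Fintype.ofFinite _
  have hV : (G.contract D).numVertices = Nat.card (Quotient (G.cutOutside D).connSetoid) := by
    refine Nat.card_congr ((quotientEquivMeets _ (G.cutOutside D).connSetoid Subtype.val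
      fun x y => ?_).trans (Equiv.subtypeUnivEquiv fun c => ?_))
    · refine (contract_sameCycle_rot D x y).trans
        ⟨fun h => conn_of_sameCycle_face (G := G.cutOutside D) h, fun h => ?_⟩
      exact hD.oneBrokenFace.1 _ _ (flipOn_of_notMem D x.2) (flipOn_of_notMem D y.2) h
    · induction c using Quotient.inductionOn with
      | h x =>
        obtain ⟨y, hy, hxy⟩ := hD.oneBrokenFace.2 x
        exact ⟨⟨y, (flipOn_eq_iff D y).1 hy⟩, Quotient.sound (Setoid.symm' _ hxy)⟩
  have hVf : Nat.card {f : (G.cutOutside D).Face //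
      ∃ x : ((D.1)ᶜ : Set G.HalfEdge), Quotient.mk _ x.1 = f} = (G.contract D).numVertices :=
    (Nat.card_congr (quotientEquivMeets _ _ _ (contract_sameCycle_rot D))).symm
  have hFf : Nat.card {f : G.Face //
      ∃ x : ((D.1)ᶜ : Set G.HalfEdge), Quotient.mk _ x.1 = f} = (G.contract D).numFaces :=
    (Nat.card_congr (quotientEquivMeets _ _ _ (contract_sameCycle_face D))).symm
  have hw := card_cycles_subset (G.rot * G.flip) (G.rot * G.flipOn D) D.1 fun x hx => by
    rw [Equiv.Perm.mul_apply, Equiv.Perm.mul_apply, flipOn_of_mem D hx]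
  have hF1 : G.numFaces = _ := card_eq_card_add_card_not
    fun f : G.Face => ∃ x : ((D.1)ᶜ : Set G.HalfEdge), Quotient.mk _ x.1 = f
  have hF2 : (G.cutOutside D).numFaces = _ := card_eq_card_add_card_not
    fun f : (G.cutOutside D).Face => ∃ x : ((D.1)ᶜ : Set G.HalfEdge), Quotient.mk _ x.1 = f
  have hw' : Nat.card {f : G.Face //
      ¬ ∃ x : ((D.1)ᶜ : Set G.HalfEdge), Quotient.mk _ x.1 = f} =
    Nat.card {f : (G.cutOutside D).Face //
      ¬ ∃ x : ((D.1)ᶜ : Set G.HalfEdge), Quotient.mk _ x.1 = f} := hw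
  rw [hFf] at hF1
  rw [hVf, ← hw'] at hF2
  have hI1 : (G.cutOutside D).numInternalHalfEdges = Nat.card D.1 :=
    Nat.card_congr (Equiv.subtypeEquivRight fun x => flipOn_ne_iff D x)
  have hI2 : G.numInternalHalfEdges =
      Nat.card D.1 + (G.contract D).numInternalHalfEdges := by
    rw [numInternalHalfEdges,
      card_eq_card_add_card_not fun x : {h : G.HalfEdge // G.flip h ≠ h} => x.1 ∈ D.1]
    congr 1
    · exact Nat.card_congr ⟨fun x => ⟨x.1.1, x.2⟩, fun x => ⟨⟨x.1, (D.2 x.1 x.2).2⟩, x.2⟩,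
        fun _ => rfl, fun _ => rfl⟩
    · exact Nat.card_congr ⟨fun x => ⟨⟨x.1.1, x.2⟩, fun h => x.1.2 (congrArg Subtype.val h)⟩,
        fun x => ⟨⟨x.1.1, fun h => x.2 (Subtype.ext h)⟩, x.1.2⟩, fun _ => rfl, fun _ => rfl⟩
  -- Each component has Euler characteristic `2`, by genus zero.
  have hsum : (G.cutOutside D).euler = 2 * (G.contract D).numVertices := by
    rw [euler_eq_sum, Finset.sum_congr rfl fun c _ => genus_eq_zero_iff.1 (hD c).1,
      Finset.sum_const, hV, Nat.card_eq_fintype_card, nsmul_eq_mul, mul_comm]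
    rfl
  have hVG : (G.cutOutside D).numVertices = G.numVertices := rfl
  rw [euler, hI1, hF2, hVG] at hsum
  rw [euler, euler, hF1, hI2]
  push_cast at hsum ⊢
  linarith

theorem isPrimitivelyDivergent_contract_iff {D : G.EdgeSet}
    (hD : (G.cutOutside D).LocallyDivergent) :
    (G.contract D).IsPrimitivelyDivergent ↔ G.IsPrimitivelyDivergent := by
  have h := external_congr (A := G.contract D) (B := G)
    ⟨fun x => ⟨x.1.1, congrArg Subtype.val x.2⟩,
      fun x => ⟨⟨x.1, fun h => (D.2 _ h).2 x.2⟩, Subtype.ext x.2⟩, fun _ => rfl, fun _ => rfl⟩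
    (fun x y => contract_sameCycle_face D x.1 y.1)
  rw [IsPrimitivelyDivergent, IsPrimitivelyDivergent, h.1, h.2, genus_eq_zero_iff,
    genus_eq_zero_iff, euler_contract hD]

/-- Otherwise the chain of `b` would have no end, but in a connected graph with a vertex that is not
bivalent every chain has one. -/
theorem NoHalfExternal.flip_ne_of_isConnected (hG : G.NoHalfExternal) (hc : G.IsConnected)
    (hn : Nonempty G.eraseBivalent.HalfEdge) {b : G.HalfEdge} (hb : b ∈ G.bivalent) :
    G.flip b ≠ b := by
  intro hf
  obtain ⟨y⟩ := hn
  obtain ⟨x, hx⟩ := exists_chain_of_conn y (hc.2 b y.1)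
  exact x.2 (hG.bivalent_of_chain hb hf hx)

/-- If a face passes through bivalent vertices only, its half-edges together with their images under
`flip` are closed under `rot` and `flip`. By connectedness they are everything, and no other vertex
remains. -/
theorem exists_sameCycle_face (hc : G.IsConnected) (hn : Nonempty G.eraseBivalent.HalfEdge)
    (x : G.HalfEdge) : ∃ y : G.eraseBivalent.HalfEdge, (G.rot * G.flip).SameCycle x y.1 := by
  by_contra! hcon
  have hb : ∀ z, (G.rot * G.flip).SameCycle x z → z ∈ G.bivalent := fun z hz => by
    by_contra hzb
    exact hcon ⟨z, hzb⟩ hz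
  obtain ⟨y⟩ := hn
  have hstep : ∀ z, (G.rot * G.flip).SameCycle x (G.flip z) →
      (G.rot * G.flip).SameCycle x (G.rot z) := fun z hz =>
    hz.trans ⟨1, by rw [zpow_one, Equiv.Perm.mul_apply, G.flip_flip]⟩
  have hy := (conn_mem_iff (A := {z | (G.rot * G.flip).SameCycle x z ∨
    (G.rot * G.flip).SameCycle x (G.flip z)}) ?_ ?_ (hc.2 x y.1)).1 (Or.inl (.refl _ _))
  · rcases hy with hy | hy
    · exact hcon y hy
    · exact y.2 ((G.rot_mem_bivalent _).1 (hb _ (hstep _ hy)))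
  · rintro z (hz | hz)
    · refine Or.inr (hz.trans (Equiv.Perm.SameCycle.symm ⟨1, ?_⟩))
      rw [zpow_one, Equiv.Perm.mul_apply, G.flip_flip]
      exact (hb z hz).2
    · exact Or.inl (hstep z hz)
  · rintro z (hz | hz)
    · exact Or.inr (by rwa [G.flip_flip])
    · exact Or.inl hz

/-- No face is lost, and erasing a bivalent vertex merges two edges: vertices and internal edges
decrease by the same number. -/
theorem euler_erase (hG : G.NoHalfExternal) (hc : G.IsConnected)
    (hn : Nonempty G.eraseBivalent.HalfEdge) : G.eraseBivalent.euler = G.euler := by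
  classical
  have hF : G.eraseBivalent.numFaces = G.numFaces := by
    refine Nat.card_congr ((quotientEquivMeets
      (Equiv.Perm.SameCycle.setoid (G.eraseBivalent.rot * G.eraseBivalent.flip))
      (Equiv.Perm.SameCycle.setoid (G.rot * G.flip)) Subtype.val erase_sameCycle_face).trans
      (Equiv.subtypeUnivEquiv fun c => ?_))
    induction c using Quotient.inductionOn with
    | h x =>
      obtain ⟨y, hy⟩ := exists_sameCycle_face hc hn x
      exact ⟨y, Quotient.sound (Equiv.Perm.SameCycle.symm hy)⟩
  have hV : G.numVertices = _ := card_eq_card_add_card_not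
    fun v : G.Vertex => ∃ x : G.eraseBivalent.HalfEdge, Quotient.mk _ x.1 = v
  have hV1 : Nat.card {v : G.Vertex // ∃ x : G.eraseBivalent.HalfEdge, Quotient.mk _ x.1 = v} =
    G.eraseBivalent.numVertices :=
    (Nat.card_congr (quotientEquivMeets _ _ _ erase_sameCycle_rot)).symm
  -- The fibre of half-edges over each erased vertex has two elements.
  have hV2 : Nat.card G.bivalent = 2 * Nat.card {v : G.Vertex //
      ¬ ∃ x : G.eraseBivalent.HalfEdge, Quotient.mk _ x.1 = v} := by
    have : Fintype {v : G.Vertex //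
      ¬ ∃ x : G.eraseBivalent.HalfEdge, Quotient.mk _ x.1 = v} := Fintype.ofFinite _
    have hbr : ∀ {x y : G.HalfEdge}, G.rot.SameCycle x y → (x ∈ G.bivalent ↔ y ∈ G.bivalent) :=
      fun h => h.mem_iff fun z hz => (G.rot_mem_bivalent z).2 hz
    let f : G.bivalent → {v : G.Vertex //
      ¬ ∃ x : G.eraseBivalent.HalfEdge, Quotient.mk _ x.1 = v} := fun b =>
      ⟨Quotient.mk _ b.1, fun ⟨x, hx⟩ => x.2 ((hbr (Quotient.exact hx)).2 b.2)⟩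
    rw [← Nat.card_congr (Equiv.sigmaFiberEquiv f), Nat.card_sigma,
      Finset.sum_congr rfl (g := fun _ => 2), Finset.sum_const, Finset.card_univ,
      ← Nat.card_eq_fintype_card, smul_eq_mul, mul_comm]
    rintro ⟨v, hv⟩ -
    induction v using Quotient.inductionOn with
    | h x =>
      have hx : x ∈ G.bivalent := by
        by_contra hx
        exact hv ⟨⟨x, hx⟩, rfl⟩
      rw [← (mem_bivalent_iff x).1 hx, minimalPeriod_eq_card_sameCycle]
      refine Nat.card_congr ⟨fun y => ⟨y.1.1, ?_⟩, fun y => ⟨⟨y.1, (hbr y.2).1 hx⟩, ?_⟩,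
        fun _ => rfl, fun _ => rfl⟩
      · exact Equiv.Perm.SameCycle.symm (Quotient.exact (congrArg Subtype.val y.2))
      · exact Subtype.ext (Quotient.sound (Equiv.Perm.SameCycle.symm y.2))
  have hI : G.numInternalHalfEdges =
      Nat.card G.bivalent + G.eraseBivalent.numInternalHalfEdges := by
    rw [numInternalHalfEdges,
      card_eq_card_add_card_not fun x : {h : G.HalfEdge // G.flip h ≠ h} => x.1 ∈ G.bivalent]
    congr 1
    · exact Nat.card_congr ⟨fun x => ⟨x.1.1, x.2⟩,
        fun x => ⟨⟨x.1, hG.flip_ne_of_isConnected hc hn x.2⟩, x.2⟩, fun _ => rfl, fun _ => rfl⟩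
    · exact Nat.card_congr ⟨fun x => ⟨⟨x.1.1, x.2⟩,
          fun h => x.1.2 ((hG.erase_flip_eq_iff ⟨x.1.1, x.2⟩).1 h)⟩,
        fun x => ⟨⟨x.1.1, fun h => x.2 ((hG.erase_flip_eq_iff x.1).2 h)⟩, x.1.2⟩,
        fun _ => rfl, fun _ => rfl⟩
  rw [hV1] at hV
  rw [euler, euler, hF, hI, hV2, hV]
  push_cast
  ring

theorem isPrimitivelyDivergent_erase_iff (hG : G.NoHalfExternal) (hc : G.IsConnected)
    (hn : Nonempty G.eraseBivalent.HalfEdge) :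
    G.eraseBivalent.IsPrimitivelyDivergent ↔ G.IsPrimitivelyDivergent := by
  have h := external_congr (A := G.eraseBivalent) (B := G)
    ⟨fun x => ⟨x.1.1, (hG.erase_flip_eq_iff x.1).1 x.2⟩,
      fun x => ⟨⟨x.1, fun h => hG.flip_ne_of_isConnected hc hn h x.2⟩,
        (hG.erase_flip_eq_iff ⟨x.1, _⟩).2 x.2⟩, fun _ => rfl, fun _ => rfl⟩
    (fun x y => erase_sameCycle_face x.1 y.1)
  rw [IsPrimitivelyDivergent, IsPrimitivelyDivergent, h.1, h.2, genus_eq_zero_iff,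
    genus_eq_zero_iff, euler_erase hG hc hn]

/-- A single vertex of valence four is planar regular with four external edges. -/
theorem isPrimitivelyDivergent_of_flip_eq (hq : G.IsQuartic) (hc : G.IsConnected)
    (hf : ∀ h, G.flip h = h) : G.IsPrimitivelyDivergent := by
  have hf1 : G.flip = 1 := Equiv.ext hf
  obtain ⟨⟨x⟩, hc⟩ := hc
  have hcyc : ∀ y, G.rot.SameCycle x y := by
    intro y
    refine (conn_mem_iff (A := {z | G.rot.SameCycle x z}) (fun z hz => ?_) (fun z hz => ?_)
      (hc x y)).1 (.refl _ _)
    · exact hz.trans ⟨1, by simp⟩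
    · rwa [hf]
  have hcyc' : ∀ y z, G.rot.SameCycle y z := fun y z => (hcyc y).symm.trans (hcyc z)
  have hV : G.numVertices = 1 := by
    rw [numVertices, Nat.card_eq_one_iff_unique]
    refine ⟨⟨fun a b => ?_⟩, ⟨Quotient.mk _ x⟩⟩
    induction a using Quotient.inductionOn with
    | h a =>
      induction b using Quotient.inductionOn with
      | h b => exact Quotient.sound (hcyc' a b)
  have hF : G.numFaces = 1 := by
    rw [← hV, numFaces, Face, hf1, mul_one]
    rfl
  have hI : G.numInternalHalfEdges = 0 := by
    rw [numInternalHalfEdges, Nat.card_eq_zero]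
    exact Or.inl ⟨fun z => z.2 (hf z.1)⟩
  refine ⟨?_, ?_, Or.inr ?_⟩
  · rw [genus, hV, hF, hI]
    norm_num
  · rw [numBrokenFaces_eq_one_iff, hf1, mul_one]
    exact ⟨fun y z _ _ => hcyc' y z, x, rfl⟩
  · rw [← hq x, minimalPeriod_eq_card_sameCycle]
    exact Nat.card_congr (Equiv.subtypeEquivRight fun y => ⟨fun _ => hcyc y, fun _ => hf y⟩)

/-! ### Divergence as a condition on the whole cut graph -/

/-- The components of the subgraph with edge set `D` are all 1PI and primitively divergent. -/
def IsDivergent (D : G.EdgeSet) : Prop :=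
  ∀ c, (G.subComponent D c).Is1PI ∧ (G.subComponent D c).IsPrimitivelyDivergent

/-- The cut graph has further components: the vertices not hooked to `D`. Being quartic and without
internal edges, they are bridgeless and planar regular with four external edges, so they may be
included in the condition. Later arguments can thus treat the cut graph as a whole. -/
theorem isDivergent_iff (hG : G.IsQuartic) (D : G.EdgeSet) :
    IsDivergent D ↔ (G.cutOutside D).Bridgeless ∧ (G.cutOutside D).LocallyDivergent := by
  have hex : ∀ c : Quotient (G.cutOutside D).connSetoid,
      (∃ x : ((G.cutOutside D).component c).HalfEdge, (G.cutOutside D).flip x.1 ≠ x.1) ↔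
      ∃ h : G.HalfEdge, h ∈ D.1 ∧ Quotient.mk (G.cutOutside D).connSetoid h = c := fun c =>
    ⟨fun ⟨x, hx⟩ => ⟨x.1, (flipOn_ne_iff D x.1).1 hx, x.2⟩,
      fun ⟨h, hh, hc⟩ => ⟨⟨h, hc⟩, (flipOn_ne_iff D h).2 hh⟩⟩
  rw [bridgeless_iff_component]
  constructor
  · intro h
    refine ⟨fun c => ?_, fun c => ?_⟩
    · by_cases hc : ∃ h : G.HalfEdge, h ∈ D.1 ∧ Quotient.mk (G.cutOutside D).connSetoid h = c
      · exact ((is1PI_component_iff c).1 (h ⟨c, hc⟩).1).2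
      · rw [← hex] at hc
        rw [bridgeless_component_iff]
        exact fun x hx => absurd ⟨x, hx⟩ hc
    · by_cases hc : ∃ h : G.HalfEdge, h ∈ D.1 ∧ Quotient.mk (G.cutOutside D).connSetoid h = c
      · exact (h ⟨c, hc⟩).2
      · rw [← hex] at hc
        push Not at hc
        exact isPrimitivelyDivergent_of_flip_eq
          (isQuartic_component (G := G.cutOutside D) hG c) (isConnected_component c)
          fun x => Subtype.ext (hc x)
  · rintro ⟨h1, h2⟩ ⟨c, hc⟩
    exact ⟨(is1PI_component_iff c).2 ⟨(hex c).2 hc, h1 c⟩, h2 c⟩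

end RibbonGraph

namespace RibbonGraph

variable {A B : RibbonGraph}

open FirstReturn

/-! ### Embeddings -/

/-- An injective map of half-edges compatible with the involutions, which preserves or reverses
all the cyclic orderings. Its range is a union of components. -/
structure Emb (B A : RibbonGraph) where
  toFun : B.HalfEdge → A.HalfEdge
  injective : Function.Injective toFun
  flip : ∀ x, toFun (B.flip x) = A.flip (toFun x)
  rot : (∀ x, toFun (B.rot x) = A.rot (toFun x)) ∨ ∀ x, toFun (B.rot x) = A.rot.symm (toFun x)

namespace Emb

instance : CoeFun (Emb B A) fun _ => B.HalfEdge → A.HalfEdge := ⟨toFun⟩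

theorem conn_iff (m : Emb B A) (x y : B.HalfEdge) :
    B.connSetoid x y ↔ A.connSetoid (m x) (m y) := by
  constructor
  · refine B.connSetoid_le (r := A.connSetoid.comap m) (fun z => ?_) (fun z => ?_)
    · change A.connSetoid (m z) (m (B.rot z))
      rcases m.rot with h | h
      · rw [h]
        exact A.connSetoid_rot _
      · rw [h]
        have := A.connSetoid_rot (A.rot.symm (m z))
        rw [Equiv.apply_symm_apply] at this
        exact Setoid.symm' _ this
    · change A.connSetoid (m z) (m (B.flip z))
      rw [m.flip]
      exact A.connSetoid_flip _
  · intro h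
    obtain ⟨z, hz, hxz⟩ := (conn_mem_iff (A := {h | ∃ z, m z = h ∧ B.connSetoid x z})
      (by
        rintro _ ⟨z, rfl, hz⟩
        rcases m.rot with h | h
        · exact ⟨B.rot z, h z, Setoid.trans' _ hz (B.connSetoid_rot z)⟩
        · refine ⟨B.rot.symm z, ?_, Setoid.trans' _ hz ?_⟩
          · rw [← Equiv.symm_apply_eq, ← h, Equiv.apply_symm_apply]
          · have := B.connSetoid_rot (B.rot.symm z)
            rw [Equiv.apply_symm_apply] at this
            exact Setoid.symm' _ this)
      (by
        rintro _ ⟨z, rfl, hz⟩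
        exact ⟨B.flip z, m.flip z, Setoid.trans' _ hz (B.connSetoid_flip z)⟩) h).1
      ⟨x, rfl, B.connSetoid.refl x⟩
    rwa [← m.injective hz]

theorem exists_of_conn (m : Emb B A) (x : B.HalfEdge) (y : A.HalfEdge)
    (h : A.connSetoid (m x) y) : ∃ z, m z = y := by
  refine (conn_mem_iff (A := {h | ∃ z, m z = h}) ?_ ?_ h).1 ⟨x, rfl⟩
  · rintro _ ⟨z, rfl⟩
    rcases m.rot with h | h
    · exact ⟨B.rot z, h z⟩
    · exact ⟨B.rot.symm z, by rw [← Equiv.symm_apply_eq, ← h, Equiv.apply_symm_apply]⟩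
  · rintro _ ⟨z, rfl⟩
    exact ⟨B.flip z, m.flip z⟩

theorem isomorphic_of_surjective (m : Emb B A) (hs : Function.Surjective m) : Isomorphic B A :=
  ⟨Equiv.ofBijective m ⟨m.injective, hs⟩, m.flip, m.rot⟩

/-- The inclusion of a component. -/
def ofComponent (A : RibbonGraph) (c : Quotient A.connSetoid) : Emb (A.component c) A where
  toFun := Subtype.val
  injective := Subtype.val_injective
  flip _ := rfl
  rot := Or.inl fun _ => rfl

/-- An embedding of a connected graph is an isomorphism to a component. -/
theorem isomorphic_component (m : Emb B A) (hB : B.IsConnected) (c : Quotient A.connSetoid)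
    (b : B.HalfEdge) (hb : Quotient.mk _ (m b) = c) : Isomorphic B (A.component c) := by
  let m' : Emb B (A.component c) :=
    { toFun := fun x => ⟨m x, by
        rw [← hb]
        exact Quotient.sound ((m.conn_iff x b).1 (hB.2 x b))⟩
      injective := fun x y h => m.injective (congrArg Subtype.val h)
      flip := fun x => Subtype.ext (m.flip x)
      rot := m.rot.imp (fun h x => Subtype.ext (h x)) (fun h x => Subtype.ext ((h x).trans (by
        rw [Equiv.symm_apply_eq]
        exact (congrArg Subtype.val ((A.component c).rot.apply_symm_apply ⟨m x, _⟩)).symm))) }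
  refine m'.isomorphic_of_surjective fun y => ?_
  obtain ⟨z, hz⟩ := m.exists_of_conn b y.1 (Quotient.exact (hb.trans y.2.symm))
  exact ⟨z, Subtype.ext hz⟩

theorem isomorphic_of_isConnected (m : Emb B A) (hB : B.IsConnected) (hA : A.IsConnected) :
    Isomorphic B A := by
  obtain ⟨b⟩ := hB.1
  exact m.isomorphic_of_surjective fun y => m.exists_of_conn b y (hA.2 _ _)

theorem flipOn (m : Emb B A) {F : B.EdgeSet} {E : A.EdgeSet} (h : ∀ x, x ∈ F.1 ↔ m x ∈ E.1)
    (x : B.HalfEdge) : m (B.flipOn F x) = A.flipOn E (m x) := by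
  by_cases hx : x ∈ F.1
  · rw [flipOn_of_mem F hx, flipOn_of_mem E ((h x).1 hx), m.flip]
  · rw [flipOn_of_notMem F hx, flipOn_of_notMem E fun hE => hx ((h x).2 hE)]

/-- Embeddings are compatible with cutting edges. -/
def cutOutside (m : Emb B A) (F : B.EdgeSet) (E : A.EdgeSet) (h : ∀ x, x ∈ F.1 ↔ m x ∈ E.1) :
    Emb (B.cutOutside F) (A.cutOutside E) where
  toFun := m
  injective := m.injective
  flip := m.flipOn h
  rot := m.rot

/-- Embeddings are compatible with contraction. -/
def contract (m : Emb B A) (F : B.EdgeSet) (E : A.EdgeSet) (h : ∀ x, x ∈ F.1 ↔ m x ∈ E.1) :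
    Emb (B.contract F) (A.contract E) where
  toFun x := ⟨m x.1, fun h' => x.2 ((h x.1).2 h')⟩
  injective x y hxy := Subtype.ext (m.injective (congrArg Subtype.val hxy))
  flip x := Subtype.ext (m.flip x.1)
  rot := by
    have hc : ∀ x, x ∈ (F.1)ᶜ ↔ m x ∈ (E.1)ᶜ := fun x => not_congr (h x)
    refine m.rot.imp (fun hr x => Subtype.ext ?_) (fun hr x => Subtype.ext ?_)
    · refine map_ret' (p := B.rot * B.flipOn F) (q := A.rot * A.flipOn E) m (fun y => ?_) hc x.1
      rw [Equiv.Perm.mul_apply, Equiv.Perm.mul_apply, hr, m.flipOn h]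
    · refine (map_ret' (p := B.rot * B.flipOn F) (q := A.rot⁻¹ * A.flipOn E) m (fun y => ?_) hc
        x.1).trans ?_
      · rw [Equiv.Perm.mul_apply, Equiv.Perm.mul_apply, hr, m.flipOn h]
        rfl
      -- Reversing the orientation gives returns of `rot⁻¹ * flipOn E`, whereas the inverse of the
      -- new rotation is a return of `flipOn E * rot⁻¹`. The order is irrelevant, as `flipOn E`
      -- fixes the complement of `E`.
      · have hx := ret_mul_comm (p := A.rot⁻¹) (s := (E.1)ᶜ) (flipOn_flipOn E)
          (fun y hy => flipOn_of_notMem E hy) ((hc x.1).1 x.2)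
        have hinv : A.flipOn E * A.rot⁻¹ = (A.rot * A.flipOn E)⁻¹ := by
          rw [mul_inv_rev]
          congr 1
        rw [hinv] at hx
        exact hx.symm

theorem mem_bivalent_iff (m : Emb B A) (x : B.HalfEdge) :
    x ∈ B.bivalent ↔ m x ∈ A.bivalent := by
  change (_ ∧ _) ↔ (_ ∧ _)
  rcases m.rot with h | h
  · rw [← h, ← h, m.injective.ne_iff, m.injective.eq_iff]
  · rw [← m.injective.ne_iff, ← m.injective.eq_iff, h, h]
    rw [Equiv.symm_apply_eq, ne_eq, Equiv.symm_apply_eq, h, Equiv.symm_apply_eq]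
    exact and_congr (not_congr eq_comm) eq_comm

/-- At a vertex of valence two the rotation is its own inverse, so the orientation does not matter.
-/
theorem crossBivalent (m : Emb B A) (x : B.HalfEdge) :
    m (B.crossBivalent x) = A.crossBivalent (m x) := by
  by_cases hx : x ∈ B.bivalent
  · have hx' := (m.mem_bivalent_iff x).1 hx
    rw [crossBivalent_of_mem hx, crossBivalent_of_mem hx']
    rcases m.rot with h | h
    · exact h x
    · rw [h, Equiv.symm_apply_eq]
      exact hx'.2.symm
  · rw [crossBivalent_of_notMem hx, crossBivalent_of_notMem fun h => hx ((m.mem_bivalent_iff x).2 h)]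

/-- Embeddings are compatible with erasing vertices of valence two. -/
def eraseBivalent (m : Emb B A) : Emb B.eraseBivalent A.eraseBivalent where
  toFun x := ⟨m x.1, fun h' => x.2 ((m.mem_bivalent_iff x.1).2 h')⟩
  injective x y hxy := Subtype.ext (m.injective (congrArg Subtype.val hxy))
  flip x := Subtype.ext (map_ret' (p := B.flip * B.crossBivalent) (q := A.flip * A.crossBivalent) m
    (fun y => by
      rw [Equiv.Perm.mul_apply, Equiv.Perm.mul_apply, m.flip, m.crossBivalent])
    (fun y => not_congr (m.mem_bivalent_iff y)) x.1)
  rot := m.rot.imp (fun h x => Subtype.ext (h x.1)) (fun h x => Subtype.ext ((h x.1).trans (by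
    rw [Equiv.symm_apply_eq]
    exact (congrArg Subtype.val (A.eraseBivalent.rot.apply_symm_apply ⟨m x.1, _⟩)).symm)))

/-- Embeddings are compatible with shrinking. -/
def shrink (m : Emb B A) (F : B.EdgeSet) (E : A.EdgeSet) (h : ∀ x, x ∈ F.1 ↔ m x ∈ E.1) :
    Emb (B.shrink F) (A.shrink E) :=
  (m.contract F E h).eraseBivalent

end Emb

/-! ### Isomorphism invariance -/

variable {G G' : RibbonGraph}

theorem Isomorphic.exists_emb (h : Isomorphic G G') :
    ∃ m : Emb G G', Function.Bijective m := by
  obtain ⟨e, hf, hr⟩ := h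
  exact ⟨⟨e, e.injective, hf, hr⟩, e.bijective⟩

theorem sameCycle_iff_of_semiconj {X Y : Type} [Finite X] [Finite Y] {p : Equiv.Perm X}
    {q : Equiv.Perm Y} {i : X → Y} (hi : Function.Injective i) (h : ∀ x, i (p x) = q (i x))
    (x y : X) : p.SameCycle x y ↔ q.SameCycle (i x) (i y) := by
  have hpow : ∀ n : ℕ, i ((p ^ n) x) = (q ^ n) (i x) := by
    intro n
    induction n with
    | zero => rfl
    | succ n ih => rw [pow_succ', pow_succ', Equiv.Perm.mul_apply, Equiv.Perm.mul_apply, h, ih]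
  constructor
  · intro hxy
    obtain ⟨n, rfl⟩ := hxy.exists_nat_pow_eq
    exact ⟨n, by rw [hpow, zpow_natCast]⟩
  · intro hxy
    obtain ⟨n, hn⟩ := hxy.exists_nat_pow_eq
    exact ⟨n, hi (by rw [zpow_natCast, hpow, hn])⟩

theorem Emb.sameCycle_rot_iff (m : Emb B A) (x y : B.HalfEdge) :
    B.rot.SameCycle x y ↔ A.rot.SameCycle (m x) (m y) := by
  rcases m.rot with h | h
  · exact sameCycle_iff_of_semiconj m.injective h x y
  · rw [← Equiv.Perm.sameCycle_inv (f := A.rot)]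
    exact sameCycle_iff_of_semiconj m.injective h x y

/-- Faces correspond under isomorphisms. -/
theorem Emb.exists_sameCycle_face_iff (m : Emb B A) (hm : Function.Bijective m) :
    ∃ e : B.HalfEdge ≃ A.HalfEdge, (∀ x, B.flip x = x → e x = m x) ∧
      ∀ x y, (B.rot * B.flip).SameCycle x y ↔ (A.rot * A.flip).SameCycle (e x) (e y) := by
  rcases m.rot with h | h
  · refine ⟨Equiv.ofBijective m hm, fun _ _ => rfl,
      sameCycle_iff_of_semiconj m.injective fun z => ?_⟩
    change m (B.rot (B.flip z)) = A.rot (A.flip (m z))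
    rw [h, m.flip]
  -- When the orientation is reversed, `m` followed by `flip` carries the face permutation to the
  -- inverse of the other one; on external half-edges this `flip` is trivial.
  · refine ⟨(Equiv.ofBijective m hm).trans A.flip, fun x hx => ?_, fun x y => ?_⟩
    · change A.flip (m x) = m x
      rw [← m.flip, hx]
    · rw [← Equiv.Perm.sameCycle_inv (f := A.rot * A.flip)]
      refine sameCycle_iff_of_semiconj ((Equiv.ofBijective m hm).trans A.flip).injective
        (fun z => ?_) x y
      rw [Equiv.Perm.eq_inv_iff_eq]
      change A.rot (A.flip (A.flip (m (B.rot (B.flip z))))) = A.flip (m z)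
      rw [A.flip_flip, h, Equiv.apply_symm_apply, m.flip]

theorem Isomorphic.isQuartic (h : Isomorphic G G') (hG : G.IsQuartic) : G'.IsQuartic := by
  obtain ⟨m, hm⟩ := h.exists_emb
  intro y
  obtain ⟨x, rfl⟩ := hm.2 y
  rw [← hG x, minimalPeriod_eq_card_sameCycle, minimalPeriod_eq_card_sameCycle]
  exact (Nat.card_congr ((Equiv.ofBijective m hm).subtypeEquiv fun z =>
    m.sameCycle_rot_iff x z)).symm

theorem Isomorphic.isPrimitivelyDivergent (h : Isomorphic G G')
    (hG : G.IsPrimitivelyDivergent) : G'.IsPrimitivelyDivergent := by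
  obtain ⟨m, hm⟩ := h.exists_emb
  obtain ⟨e, he, hf⟩ := m.exists_sameCycle_face_iff hm
  have hV : G.numVertices = G'.numVertices :=
    Nat.card_congr (Quotient.congr (Equiv.ofBijective m hm) fun x y => m.sameCycle_rot_iff x y)
  have hF : G.numFaces = G'.numFaces := Nat.card_congr (Quotient.congr e hf)
  have hext := external_congr (A := G) (B := G')
    ((Equiv.ofBijective m hm).subtypeEquiv fun x => by
      change _ ↔ G'.flip (m x) = m x
      rw [← m.flip, m.injective.eq_iff])
    (fun x y => by
      refine (hf x.1 y.1).trans ?_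
      rw [he x.1 x.2, he y.1 y.2]
      rfl)
  rw [IsPrimitivelyDivergent, genus, hV, hF, h.numInternalHalfEdges_eq, hext.1, hext.2] at hG
  exact hG

/-- The preimage of an edge set under an embedding. -/
def Emb.pullEdges (m : Emb B A) (E : A.EdgeSet) : B.EdgeSet :=
  ⟨{x | m x ∈ E.1}, fun x hx => ⟨by
    change m (B.flip x) ∈ E.1
    rw [m.flip]
    exact (E.2 _ hx).1, fun h => (E.2 _ hx).2 (by rw [← m.flip, h])⟩⟩

theorem Emb.isConnected (m : Emb B A) (hm : Function.Bijective m) (h : B.IsConnected) :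
    A.IsConnected := by
  refine ⟨h.1.map m, fun a b => ?_⟩
  obtain ⟨x, rfl⟩ := hm.2 a
  obtain ⟨y, rfl⟩ := hm.2 b
  exact (m.conn_iff x y).1 (h.2 x y)

theorem Isomorphic.is1PI (h : Isomorphic G G') (hG : G.Is1PI) : G'.Is1PI := by
  obtain ⟨m, hm⟩ := h.exists_emb
  have hflip : ∀ x, G'.flip (m x) = m x ↔ G.flip x = x := fun x => by
    rw [← m.flip, m.injective.eq_iff]
  refine ⟨m.isConnected hm hG.1, ?_, fun y hy => ?_⟩
  · obtain ⟨x, hx⟩ := hG.2.1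
    exact ⟨m x, fun h => hx ((hflip x).1 h)⟩
  · obtain ⟨x, rfl⟩ := hm.2 y
    refine (m.cutOutside (G.edgesExcept x) (G'.edgesExcept (m x)) fun z => ?_).isConnected hm
      (hG.2.2 x fun h => hy ((hflip x).2 h))
    change (_ ∧ _ ∧ _) ↔ (_ ∧ _ ∧ _)
    rw [ne_eq, ne_eq, ne_eq, ne_eq, ne_eq, ne_eq, hflip, m.injective.eq_iff, ← m.flip,
      m.injective.eq_iff]

theorem Isomorphic.isFeynman1PI (h : Isomorphic G G') (hG : G.IsFeynman1PI) : G'.IsFeynman1PI :=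
  ⟨h.isQuartic hG.1, h.is1PI hG.2⟩

/-- Inclusions of components of subgraphs. -/
def Emb.subComponentMap (m : Emb B A) {F : B.EdgeSet} {E : A.EdgeSet}
    (h : ∀ x, x ∈ F.1 ↔ m x ∈ E.1) (c : B.SubComponent F) : A.SubComponent E :=
  ⟨Quotient.map m (fun x y => ((m.cutOutside F E h).conn_iff x y).1) c.1, by
    obtain ⟨c, x, hx, rfl⟩ := c
    exact ⟨m x, (h x).1 hx, rfl⟩⟩

theorem Emb.isomorphic_subComponent (m : Emb B A) {F : B.EdgeSet} {E : A.EdgeSet}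
    (h : ∀ x, x ∈ F.1 ↔ m x ∈ E.1) (c : B.SubComponent F) :
    Isomorphic (B.subComponent F c) (A.subComponent E (m.subComponentMap h c)) := by
  obtain ⟨_, x, hx, rfl⟩ := c
  let m' : Emb (B.subComponent F ⟨_, x, hx, rfl⟩) (A.cutOutside E) :=
    { toFun := fun z => m z.1
      injective := fun a b hab => Subtype.ext (m.injective hab)
      flip := fun z => m.flipOn h z.1
      rot := m.rot.imp (fun h z => h z.1) (fun h z => h z.1) }
  exact m'.isomorphic_component (isConnected_component _) _ ⟨x, rfl⟩ rfl

end RibbonGraph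

namespace RibbonGraph

variable {G A B : RibbonGraph}

open FirstReturn

/-! ### Shrinking divergent subgraphs -/

/-- A component that contracts to a bivalent vertex has only the two half-edges of this vertex as
exits. -/
theorem eq_or_eq_rot_of_bivalent {D : G.EdgeSet} (hD : (G.cutOutside D).OneBrokenFace)
    {b z : (G.contract D).HalfEdge} (hb : b ∈ (G.contract D).bivalent)
    (h : (G.cutOutside D).connSetoid b.1 z.1) : z = b ∨ z = (G.contract D).rot b := by
  have hc : (G.contract D).rot.SameCycle b z := (contract_sameCycle_rot D b z).2
    (hD.1 _ _ (flipOn_of_notMem D b.2) (flipOn_of_notMem D z.2) h)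
  refine (hc.mem_iff (A := {z | z = b ∨ z = (G.contract D).rot b}) ?_).1 (Or.inl rfl)
  rintro z (rfl | rfl)
  · exact Or.inr rfl
  · exact Or.inl hb.2

/-- A bridgeless set of edges contains both or none of the external edges of a component with two
external edges. -/
theorem saturated_contractEdges {D D' : G.EdgeSet} (hD : (G.cutOutside D).OneBrokenFace)
    (hb : (G.cutOutside D').Bridgeless) : Saturated (contractEdges D D') := by
  intro b hbb hbD
  by_contra hcon
  have hbr := bridgeless_cutOutside_iff.1 hb b.1 hbD
  -- Suppose `D'` contains `b` but not `rot b`. A path in `D'` from `b` to `flip b` that avoids this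
  -- edge cannot leave the component of `b`, whose only exits are `b` and `rot b`. So `flip b` is
  -- itself one of these exits, and neither is possible.
  have hmem : (G.cutOutside D).connSetoid b.1 (G.flip b.1) := by
    refine (conn_mem_iff (G := G.cutOutside (removeEdge D' b.1))
      (A := {z | (G.cutOutside D).connSetoid b.1 z}) (fun z hz => ?_) (fun z hz => ?_) hbr).1
      ((G.cutOutside D).connSetoid.refl b.1)
    · exact Setoid.trans' _ hz ((G.cutOutside D).connSetoid_rot z)
    · change (G.cutOutside D).connSetoid b.1 (G.flipOn (removeEdge D' b.1) z)
      by_cases hzr : z ∈ (removeEdge D' b.1).1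
      · by_cases hzD : z ∈ D.1
        · have h1 := (G.cutOutside D).connSetoid_flip z
          rw [show (G.cutOutside D).flip z = G.flip z from flipOn_of_mem D hzD] at h1
          rw [flipOn_of_mem _ hzr]
          exact Setoid.trans' _ hz h1
        · exfalso
          rcases eq_or_eq_rot_of_bivalent hD (z := ⟨z, hzD⟩) hbb hz with h1 | h1
          · exact hzr.2.1 (congrArg Subtype.val h1)
          · exact hcon (h1 ▸ hzr.1)
      · rw [flipOn_of_notMem _ hzr]
        exact hz
  rcases eq_or_eq_rot_of_bivalent hD (z := (G.contract D).flip b) hbb hmem with h1 | h1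
  · exact (D'.2 _ hbD).2 (congrArg Subtype.val h1)
  · refine hcon ?_
    rw [← h1]
    exact (D'.2 _ hbD).1

/-- Saturation of the set of all internal edges of a bridgeless graph. -/
theorem noHalfExternal_contract {D : G.EdgeSet} (hD : (G.cutOutside D).OneBrokenFace)
    (hb : G.Bridgeless) : (G.contract D).NoHalfExternal := by
  have hs := saturated_contractEdges (D' := G.allEdges) hD
    (by rwa [cutOutside_allEdges])
  intro b hbb hf
  by_contra hcon
  have h1 := hs _ (((G.contract D).rot_mem_bivalent b).2 hbb)
    (fun h => hcon (Subtype.ext h))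
  rw [show (G.contract D).rot ((G.contract D).rot b) = b from hbb.2] at h1
  exact h1 (congrArg Subtype.val hf)

/-- The edges which `D'` leaves in the cograph of `D`. -/
def shrinkEdges (D D' : G.EdgeSet) : (G.shrink D).EdgeSet :=
  eraseEdges (G := G.contract D) (contractEdges D D')

theorem mem_shrinkEdges {D D' : G.EdgeSet} (h : Saturated (contractEdges D D'))
    (x : (G.shrink D).HalfEdge) : x ∈ (shrinkEdges D D').1 ↔ x.1.1 ∈ D'.1 :=
  h.mem_eraseEdges x

/-- Identifies the subgraph `D'/D` of the cograph with the cograph of `D` inside `D'`, so that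
results on cographs apply to `D'/D`. -/
theorem shrink_cutOutside {D D' : G.EdgeSet} (h : D.1 ⊆ D'.1)
    (hs : Saturated (contractEdges D D')) :
    (G.cutOutside D').shrink (cutEdges D D' h) =
      (G.shrink D).cutOutside (shrinkEdges D D') := by
  rw [shrink, contract_cutOutside, erase_cutOutside hs]
  rfl

theorem conn_shrink_iff {D : G.EdgeSet} (hD : (G.cutOutside D).OneBrokenFace)
    (x y : (G.shrink D).HalfEdge) : (G.shrink D).connSetoid x y ↔ G.connSetoid x.1.1 y.1.1 :=
  (conn_erase_iff (G := G.contract D) x y).trans (conn_contract_iff hD x.1 y.1)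

theorem isConnected_shrink {D : G.EdgeSet} (hD : (G.cutOutside D).OneBrokenFace)
    (hG : G.IsConnected) (hn : Nonempty (G.shrink D).HalfEdge) : (G.shrink D).IsConnected :=
  ⟨hn, fun x y => (conn_shrink_iff hD x y).2 (hG.2 _ _)⟩

theorem isConnected_contract {D : G.EdgeSet} (hD : (G.cutOutside D).OneBrokenFace)
    (hG : G.IsConnected) : (G.contract D).IsConnected := by
  obtain ⟨⟨x⟩, hc⟩ := hG
  obtain ⟨y, hy, -⟩ := hD.2 x
  exact ⟨⟨⟨y, (flipOn_eq_iff D y).1 hy⟩⟩, fun x y => (conn_contract_iff hD x y).2 (hc _ _)⟩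

theorem NoHalfExternal.erase_flip_ne (hG : G.NoHalfExternal) {h : G.HalfEdge}
    (hh : G.flip h ≠ h) {x : G.eraseBivalent.HalfEdge} (hx : G.chain h x.1) :
    G.eraseBivalent.flip x ≠ x := by
  intro hf
  have hf' := (hG.erase_flip_eq_iff x).1 hf
  have hhx : h = x.1 := by
    refine (chain_mem_iff (A := {z | z = x.1}) ?_ ?_ (Setoid.symm' _ hx)).1 rfl
    · rintro z rfl
      exact crossBivalent_of_notMem x.2
    · rintro z rfl
      exact hf'
  exact hh (hhx ▸ hf')

theorem bridgeless_shrink {D : G.EdgeSet} (hD : (G.cutOutside D).OneBrokenFace)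
    (hDb : (G.cutOutside D).Bridgeless) (hG : G.Bridgeless) : (G.shrink D).Bridgeless :=
  (noHalfExternal_contract hD hG).bridgeless_erase ((bridgeless_contract_iff hD hDb).2 hG)

theorem mem_divergentSubgraphs {D : G.EdgeSet} : D ∈ G.divergentSubgraphs ↔
    D.1.Nonempty ∧ D.1 ≠ G.allEdges.1 ∧ IsDivergent D ∧ Nonempty (G.shrink D).HalfEdge :=
  Set.Finite.mem_toFinset _

/-- Each edge outside `D` belongs to an edge of the cograph. -/
theorem exists_chain_shrink {D : G.EdgeSet} (hD : (G.cutOutside D).OneBrokenFace)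
    (hG : G.IsConnected) (hn : Nonempty (G.shrink D).HalfEdge) (h : (G.contract D).HalfEdge) :
    ∃ x : (G.shrink D).HalfEdge, (G.contract D).chain h x.1 := by
  obtain ⟨y⟩ := hn
  exact exists_chain_of_conn (G := G.contract D) y ((isConnected_contract hD hG).2 _ _)

theorem exists_notMem_of_ne_allEdges {D : G.EdgeSet} (h : D.1 ≠ G.allEdges.1) :
    ∃ z, z ∉ D.1 ∧ G.flip z ≠ z := by
  by_contra! hcon
  refine h (Set.Subset.antisymm (subset_allEdges D) fun z hz => ?_)
  by_contra hzD
  exact hz (hcon z hzD)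

/-- Valence, connectedness and absence of bridges pass to the cograph. An internal edge outside `D`
lies on a chain with an end, which gives an internal edge of the cograph. -/
theorem isFeynman1PI_shrink (hG : G.IsFeynman1PI) {D : G.EdgeSet} (hne : D.1 ≠ G.allEdges.1)
    (hdiv : IsDivergent D) (hn : Nonempty (G.shrink D).HalfEdge) :
    (G.shrink D).IsFeynman1PI := by
  obtain ⟨hDb, hDl⟩ := (isDivergent_iff hG.1 D).1 hdiv
  obtain ⟨hc, -, hb⟩ := is1PI_iff.1 hG.2
  have hone := hDl.oneBrokenFace
  refine ⟨isQuartic_shrink hDl, is1PI_iff.2 ⟨isConnected_shrink hone hc hn, ?_,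
    bridgeless_shrink hone hDb hb⟩⟩
  obtain ⟨z, hz, hzf⟩ := exists_notMem_of_ne_allEdges hne
  obtain ⟨x, hx⟩ := exists_chain_shrink hone hc hn ⟨z, hz⟩
  exact ⟨x, (noHalfExternal_contract hone hb).erase_flip_ne (h := ⟨z, hz⟩)
    (fun h => hzf (congrArg Subtype.val h)) hx⟩

theorem isFeynman1PI_subComponent (hG : G.IsQuartic) {D : G.EdgeSet} (hD : IsDivergent D)
    (c : G.SubComponent D) : (G.subComponent D c).IsFeynman1PI :=
  ⟨isQuartic_component (G := G.cutOutside D) hG c.1, (hD c).1⟩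

/-! ### Iterated shrinking -/

/-- Both graphs are compared inside a common set `X`. The condition is on `rot ∘ flip` instead of
`flip`, because faces are first returns of faces; injectivity of `rot` recovers `flip`. -/
theorem isomorphic_of_coe {X : Type} (i : A.HalfEdge → X) (j : B.HalfEdge → X)
    (hi : Function.Injective i) (hj : Function.Injective j) (hrange : Set.range i = Set.range j)
    (hr : ∀ a b, i a = j b → i (A.rot a) = j (B.rot b))
    (hf : ∀ a b, i a = j b → i (A.rot (A.flip a)) = j (B.rot (B.flip b))) : Isomorphic A B := by
  have hex : ∀ a, ∃ b, j b = i a := fun a => by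
    have : i a ∈ Set.range j := hrange ▸ Set.mem_range_self a
    exact this
  choose e he using hex
  have hbij : Function.Bijective e := by
    refine ⟨fun a a' h => hi (by rw [← he, h, he]), fun b => ?_⟩
    obtain ⟨a, ha⟩ : j b ∈ Set.range i := hrange ▸ Set.mem_range_self b
    exact ⟨a, hj (by rw [he, ha])⟩
  have hrot : ∀ a, e (A.rot a) = B.rot (e a) := fun a =>
    hj (by rw [he, hr a (e a) (he a).symm])
  refine ⟨Equiv.ofBijective e hbij, fun a => ?_, Or.inl hrot⟩
  refine B.rot.injective ?_
  change B.rot (e (A.flip a)) = B.rot (B.flip (e a))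
  rw [← hrot]
  exact hj (by rw [he, hf a (e a) (he a).symm])

theorem ret_congr_set {X : Type} {p : Equiv.Perm X} {s t : Set X} {x : X}
    (h : ∀ n : ℕ, (p ^ n) x ∈ s ↔ (p ^ n) x ∈ t) : ret p s x = ret p t x := by
  have : time p s x = time p t x := by
    simp only [time, h]
  rw [ret, ret, this]

/-- A bivalent vertex has both half-edges in `E`, and disappears in the contraction, or both
outside, and is erased at the end. Hence erasing such vertices beforehand makes no difference. -/
theorem isomorphic_shrink_erase {E : G.EdgeSet} (hE : Saturated E) :
    Isomorphic (G.eraseBivalent.shrink (eraseEdges E)) (G.shrink E) := by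
  let K := G.eraseBivalent.contract (eraseEdges E)
  let L := G.contract E
  let r : Set G.HalfEdge := (G.bivalent)ᶜ ∩ (E.1)ᶜ
  have hmem : ∀ x : G.eraseBivalent.HalfEdge, x ∈ ((eraseEdges E).1)ᶜ ↔ x.1 ∈ r := fun x =>
    ⟨fun h => ⟨x.2, fun h' => h ((hE.mem_eraseEdges x).2 h')⟩,
      fun h h' => h.2 ((hE.mem_eraseEdges x).1 h')⟩
  have hrotK : ∀ x : K.HalfEdge, (K.rot x).1.1 = ret (G.rot * G.flipOn E) r x.1.1 := by
    intro x
    refine (map_ret_of_ret (p := G.eraseBivalent.rot * G.eraseBivalent.flipOn (eraseEdges E))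
      (q := G.rot * G.flipOn E) Subtype.val (r := (G.bivalent)ᶜ) (fun z => ?_)
      (fun z => .of_mem z.2) Set.inter_subset_left hmem (.of_mem x.2)).2
    have h1 := coe_erase_face (G := G.cutOutside E) z
    rw [show (G.cutOutside E).eraseBivalent.flip z = G.eraseBivalent.flipOn (eraseEdges E) z from
      congrArg (fun t : Equiv.Perm G.eraseBivalent.HalfEdge => t z) (erase_flip_cutOutside hE)]
      at h1
    exact h1
  have hfaceK : ∀ x : K.HalfEdge, (K.rot (K.flip x)).1.1 = ret (G.rot * G.flip) r x.1.1 := by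
    intro x
    refine (congrArg Subtype.val (coe_contract_face (eraseEdges E) x)).trans ?_
    exact (map_ret_of_ret (p := G.eraseBivalent.rot * G.eraseBivalent.flip)
      (q := G.rot * G.flip) Subtype.val (r := (G.bivalent)ᶜ) coe_erase_face
      (fun z => .of_mem z.2) Set.inter_subset_left hmem (.of_mem x.2)).2
  let k : K.HalfEdge → L.HalfEdge := fun x => ⟨x.1.1, ((hmem x.1).1 x.2).2⟩
  have hk : Function.Injective k := fun x y h =>
    Subtype.ext (Subtype.ext (congrArg (fun z : L.HalfEdge => z.1) h))
  -- These half-edges form cycles of `rot * flipOn E` of their own. An orbit that starts elsewhere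
  -- never enters them, so its returns to `r` and to the complement of `E` coincide.
  have hcl : ∀ z ∈ G.bivalent ∩ (E.1)ᶜ, (G.rot * G.flipOn E) z ∈ G.bivalent ∩ (E.1)ᶜ := by
    rintro z ⟨hz, hzE⟩
    rw [Equiv.Perm.mul_apply, flipOn_of_notMem E hzE]
    refine ⟨(G.rot_mem_bivalent z).2 hz, fun h => hzE ?_⟩
    have := hE _ ((G.rot_mem_bivalent z).2 hz) h
    rwa [show G.rot (G.rot z) = z from hz.2] at this
  have hkrot : ∀ x, k (K.rot x) = L.rot (k x) := by
    intro x
    refine Subtype.ext ((hrotK x).trans (ret_congr_set fun n => ?_))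
    refine ⟨fun h => h.2, fun h => ⟨fun hb => ?_, h⟩⟩
    have hsc : (G.rot * G.flipOn E).SameCycle x.1.1 (((G.rot * G.flipOn E) ^ n) x.1.1) :=
      ⟨n, by simp⟩
    exact x.1.2 ((hsc.mem_iff hcl).2 ⟨hb, h⟩).1
  have hkbiv : ∀ x, x ∈ K.bivalent ↔ k x ∈ L.bivalent := by
    intro x
    change (_ ∧ _) ↔ (_ ∧ _)
    rw [← hkrot, ← hkrot, hk.ne_iff, hk.eq_iff]
  have hLbiv : ∀ y : L.HalfEdge, y.1 ∈ G.bivalent → y ∈ L.bivalent := by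
    intro y hy
    have hstep : ∀ y : L.HalfEdge, y.1 ∈ G.bivalent → (L.rot y).1 = G.rot y.1 := by
      intro y hy
      have h1 : (G.rot * G.flipOn E) y.1 = G.rot y.1 := by
        rw [Equiv.Perm.mul_apply, flipOn_of_notMem E y.2]
      have h2 : (G.rot * G.flipOn E) y.1 ∈ (E.1)ᶜ := (hcl y.1 ⟨hy, y.2⟩).2
      exact (ret_of_apply_mem h2).trans h1
    have hy1 := hstep y hy
    have hy2 := hstep (L.rot y) (by rw [hy1]; exact (G.rot_mem_bivalent _).2 hy)
    rw [hy1] at hy2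
    refine ⟨fun h => hy.1 ?_, Subtype.ext (hy2.trans hy.2)⟩
    rw [← hy1, h]
  -- The common image in `G` of the half-edges of both graphs; both face permutations are first
  -- returns of `rot * flip` to it.
  let W : Set G.HalfEdge := {h | ∃ y : L.HalfEdge, y ∉ L.bivalent ∧ y.1 = h}
  have hWL : ∀ y : L.HalfEdge, y ∈ (L.bivalent)ᶜ ↔ y.1 ∈ W := fun y =>
    ⟨fun h => ⟨y, h, rfl⟩, fun ⟨z, hz, hzy⟩ => by rwa [← (Subtype.ext hzy : z = y)]⟩
  have hWK : ∀ x : K.HalfEdge, x ∈ (K.bivalent)ᶜ ↔ x.1.1 ∈ W := fun x =>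
    (not_congr (hkbiv x)).trans (hWL (k x))
  have hWr : W ⊆ r := by
    rintro _ ⟨y, hy, rfl⟩
    exact ⟨fun h => hy (hLbiv y h), y.2⟩
  have hWE : W ⊆ (E.1)ᶜ := fun z hz => (hWr hz).2
  refine isomorphic_of_coe (X := G.HalfEdge) (A := K.eraseBivalent) (B := L.eraseBivalent)
    (fun x => x.1.1.1) (fun y => y.1.1)
    (fun x y h => Subtype.ext (Subtype.ext (Subtype.ext h)))
    (fun x y h => Subtype.ext (Subtype.ext h)) ?_ ?_ ?_
  · ext z
    constructor
    · rintro ⟨x, rfl⟩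
      exact ⟨⟨k x.1, fun h => x.2 ((hkbiv x.1).2 h)⟩, rfl⟩
    · rintro ⟨y, rfl⟩
      have hy : y.1.1 ∈ r := hWr ((hWL y.1).1 y.2)
      refine ⟨⟨⟨⟨y.1.1, hy.1⟩, (hmem _).2 hy⟩, ?_⟩, rfl⟩
      exact (hWK _).2 ((hWL y.1).1 y.2)
  · intro a b hab
    have h1 : k a.1 = b.1 := Subtype.ext hab
    have h2 := hkrot a.1
    rw [h1] at h2
    exact congrArg Subtype.val h2
  · intro a b hab
    have h1 := congrArg (fun z : K.HalfEdge => z.1.1) (coe_erase_face a)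
    have h2 := congrArg (fun z : L.HalfEdge => z.1) (coe_erase_face b)
    refine h1.trans (Eq.trans ?_ h2.symm)
    have h3 := (map_ret_of_ret (p := K.rot * K.flip) (q := G.rot * G.flip)
      (fun z : K.HalfEdge => z.1.1) hfaceK (fun z => .of_mem ((hmem z.1).1 z.2)) hWr hWK
      (.of_mem a.2)).2
    have h4 := (map_ret_of_ret (p := L.rot * L.flip) (q := G.rot * G.flip)
      (fun z : L.HalfEdge => z.1) (coe_contract_face E) (fun z => .of_mem z.2) hWE hWL
      (.of_mem b.2)).2
    refine h3.trans (Eq.trans ?_ h4.symm)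
    exact congrArg _ hab

theorem Emb.eraseBivalent_surjective (m : Emb B A) (hm : Function.Surjective m) :
    Function.Surjective m.eraseBivalent := by
  rintro ⟨y, hy⟩
  obtain ⟨x, rfl⟩ := hm y
  exact ⟨⟨x, fun h => hy ((m.mem_bivalent_iff x).1 h)⟩, rfl⟩

/-- Contracting in two steps. -/
def embContractContract (D D' : G.EdgeSet) (h : D.1 ⊆ D'.1) :
    Emb ((G.contract D).contract (contractEdges D D')) (G.contract D') where
  toFun x := ⟨x.1.1, x.2⟩
  injective x y hxy := Subtype.ext (Subtype.ext
    (congrArg (fun z : (G.contract D').HalfEdge => z.1) hxy))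
  flip _ := rfl
  rot := Or.inl fun x => Subtype.ext (by
    refine (map_ret_of_ret (p := (G.contract D).rot * (G.contract D).flipOn (contractEdges D D'))
      (q := G.rot * G.flipOn D') Subtype.val (r := (D.1)ᶜ) (s := (D'.1)ᶜ) (fun z => ?_)
      (fun z => .of_mem z.2) (fun z hz hzD => hz (h hzD)) (fun z => Iff.rfl) (.of_mem x.2)).2
    have h1 := coe_contract_face (G := G.cutOutside D') (cutEdges D D' h) z
    have h2 : ((G.cutOutside D').contract (cutEdges D D' h)).rot
        (((G.cutOutside D').contract (cutEdges D D' h)).flip z) =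
        (G.contract D).rot ((G.contract D).flipOn (contractEdges D D') z) :=
      (congrArg (fun t : Equiv.Perm (G.contract D).HalfEdge =>
        t (((G.cutOutside D').contract (cutEdges D D' h)).flip z))
        (contract_rot_cutOutside D D' h)).trans
      (congrArg (fun t : Equiv.Perm (G.contract D).HalfEdge => (G.contract D).rot (t z))
        (contract_flip_cutOutside D D' h))
    exact (congrArg Subtype.val h2).symm.trans h1)

/-- Shrinking in two steps. -/
theorem isomorphic_shrink_shrink {D D' : G.EdgeSet} (h : D.1 ⊆ D'.1)
    (hs : Saturated (contractEdges D D')) :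
    Isomorphic ((G.shrink D).shrink (shrinkEdges D D')) (G.shrink D') := by
  refine (isomorphic_shrink_erase hs).trans
    ((embContractContract D D' h).eraseBivalent.isomorphic_of_surjective
      (Emb.eraseBivalent_surjective _ fun y => ?_))
  exact ⟨⟨⟨y.1, fun hy => y.2 (h hy)⟩, y.2⟩, rfl⟩

theorem Isomorphic.nonempty (h : Isomorphic A B) (hA : Nonempty A.HalfEdge) :
    Nonempty B.HalfEdge := by
  obtain ⟨e, -⟩ := h
  exact hA.map e

/-! ### Divergent subgraphs of cographs -/

theorem Emb.exists_isomorphic_component (m : Emb B A) (c : Quotient B.connSetoid) :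
    ∃ c', Isomorphic (B.component c) (A.component c') := by
  induction c using Quotient.inductionOn with
  | h x =>
    let m' : Emb (B.component (Quotient.mk _ x)) A :=
      { toFun := fun z => m z.1
        injective := fun a b hab => Subtype.ext (m.injective hab)
        flip := fun z => m.flip z.1
        rot := m.rot.imp (fun h z => h z.1) (fun h z => h z.1) }
    exact ⟨_, m'.isomorphic_component (isConnected_component _) _ ⟨x, rfl⟩ rfl⟩

theorem LocallyDivergent.of_emb (hA : A.LocallyDivergent) (m : Emb B A) :
    B.LocallyDivergent := by
  intro c
  obtain ⟨c', h⟩ := m.exists_isomorphic_component c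
  exact h.symm.isPrimitivelyDivergent (hA c')

theorem NoHalfExternal.of_emb (hA : A.NoHalfExternal) (m : Emb B A) : B.NoHalfExternal := by
  intro b hb hf
  have h1 := hA (m b) ((m.mem_bivalent_iff b).1 hb) (by rw [← m.flip, hf])
  have h2 : m (B.rot b) = A.rot (m b) := by
    rw [← crossBivalent_of_mem hb, m.crossBivalent,
      crossBivalent_of_mem ((m.mem_bivalent_iff b).1 hb)]
  exact m.injective (by rw [m.flip, h2, h1])

theorem isPrimitivelyDivergent_shrink_iff {D : G.EdgeSet} (hc : G.IsConnected)
    (hD : (G.cutOutside D).LocallyDivergent) (hN : (G.contract D).NoHalfExternal)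
    (hn : Nonempty (G.shrink D).HalfEdge) :
    (G.shrink D).IsPrimitivelyDivergent ↔ G.IsPrimitivelyDivergent :=
  (isPrimitivelyDivergent_erase_iff hN (isConnected_contract hD.oneBrokenFace hc) hn).trans
    (isPrimitivelyDivergent_contract_iff hD)

/-- The components of a cograph are the cographs of the components. -/
theorem isomorphic_component_shrink {F : A.EdgeSet} (hF : (A.cutOutside F).LocallyDivergent)
    (x : (A.shrink F).HalfEdge) :
    Isomorphic ((A.component (Quotient.mk _ x.1.1)).shrink (componentEdges F _))
      ((A.shrink F).component (Quotient.mk _ x)) ∧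
    Nonempty ((A.component (Quotient.mk _ x.1.1)).shrink (componentEdges F _)).HalfEdge := by
  let c : Quotient A.connSetoid := Quotient.mk _ x.1.1
  let m : Emb ((A.component c).shrink (componentEdges F c)) (A.shrink F) :=
    (Emb.ofComponent A c).shrink (componentEdges F c) F fun _ => Iff.rfl
  have hF' : ((A.component c).cutOutside (componentEdges F c)).LocallyDivergent :=
    hF.of_emb ((Emb.ofComponent A c).cutOutside (componentEdges F c) F fun _ => Iff.rfl)
  let x₁ : ((A.component c).contract (componentEdges F c)).HalfEdge := ⟨⟨x.1.1, rfl⟩, x.1.2⟩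
  let x' : ((A.component c).shrink (componentEdges F c)).HalfEdge := ⟨x₁, fun h => x.2
    ((((Emb.ofComponent A c).contract (componentEdges F c) F fun _ => Iff.rfl).mem_bivalent_iff
      x₁).1 h)⟩
  exact ⟨m.isomorphic_component (isConnected_shrink hF'.oneBrokenFace (isConnected_component c)
    ⟨x'⟩) _ x' rfl, ⟨x'⟩⟩

/-- A component of the cograph is the cograph of a component, where Euler characteristic, external
edges and broken faces are unchanged. -/
theorem isPrimitivelyDivergent_component_shrink_iff {F : A.EdgeSet}
    (hF : (A.cutOutside F).LocallyDivergent) (hN : (A.contract F).NoHalfExternal)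
    (x : (A.shrink F).HalfEdge) :
    ((A.shrink F).component (Quotient.mk _ x)).IsPrimitivelyDivergent ↔
      (A.component (Quotient.mk _ x.1.1)).IsPrimitivelyDivergent := by
  obtain ⟨hiso, hn⟩ := isomorphic_component_shrink hF x
  rw [← isPrimitivelyDivergent_shrink_iff (isConnected_component (Quotient.mk _ x.1.1))
    (hF.of_emb ((Emb.ofComponent A _).cutOutside (componentEdges F _) F fun _ => Iff.rfl))
    (hN.of_emb ((Emb.ofComponent A _).contract (componentEdges F _) F fun _ => Iff.rfl)) hn]
  exact ⟨hiso.symm.isPrimitivelyDivergent, hiso.isPrimitivelyDivergent⟩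

/-- Through `shrink_cutOutside` both conditions of `isDivergent_iff` are conditions on the cograph
of `D` inside `D'`, to which they pass from `D'`. -/
theorem isDivergent_shrinkEdges (hG : G.IsQuartic) {D D' : G.EdgeSet} (hD : IsDivergent D)
    (hD' : IsDivergent D') (h : D.1 ⊆ D'.1) : IsDivergent (shrinkEdges D D') := by
  obtain ⟨hDb, hDl⟩ := (isDivergent_iff hG D).1 hD
  obtain ⟨hDb', hDl'⟩ := (isDivergent_iff hG D').1 hD'
  have hs := saturated_contractEdges hDl.oneBrokenFace hDb'
  have hFb : ((G.cutOutside D').cutOutside (cutEdges D D' h)).Bridgeless := by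
    rwa [cutOutside_cutEdges]
  have hFl : ((G.cutOutside D').cutOutside (cutEdges D D' h)).LocallyDivergent := by
    rwa [cutOutside_cutEdges]
  rw [isDivergent_iff (isQuartic_shrink hDl), ← shrink_cutOutside h hs]
  refine ⟨bridgeless_shrink hFl.oneBrokenFace hFb hDb', fun c => ?_⟩
  induction c using Quotient.inductionOn with
  | h x =>
    exact (isPrimitivelyDivergent_component_shrink_iff hFl
      (noHalfExternal_contract hFl.oneBrokenFace hDb') x).2 (hDl' _)

/-- The edges of `D` together with those that form edges of `E` in the cograph. -/
def unionLift {D : G.EdgeSet} (hN : (G.contract D).NoHalfExternal) (E : (G.shrink D).EdgeSet) :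
    G.EdgeSet :=
  ⟨{h | h ∈ D.1 ∨ ∃ hh : h ∈ (D.1)ᶜ,
      (⟨h, hh⟩ : (G.contract D).HalfEdge) ∈ (liftEdges hN E).1}, by
    rintro h (hh | ⟨hh, hE⟩)
    · exact ⟨Or.inl (D.2 h hh).1, (D.2 h hh).2⟩
    · have := (liftEdges hN E).2 _ hE
      exact ⟨Or.inr ⟨fun h' => hh ((G.flip_mem_iff D h).1 h'), this.1⟩,
        fun h' => this.2 (Subtype.ext h')⟩⟩

theorem subset_unionLift {D : G.EdgeSet} (hN : (G.contract D).NoHalfExternal)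
    (E : (G.shrink D).EdgeSet) : D.1 ⊆ (unionLift hN E).1 := fun _ => Or.inl

theorem contractEdges_unionLift {D : G.EdgeSet} (hN : (G.contract D).NoHalfExternal)
    (E : (G.shrink D).EdgeSet) : contractEdges D (unionLift hN E) = liftEdges hN E := by
  refine Subtype.ext (Set.ext fun x => ⟨?_, fun h => Or.inr ⟨x.2, h⟩⟩)
  rintro (h | ⟨_, h⟩)
  · exact absurd h x.2
  · exact h

theorem shrinkEdges_unionLift {D : G.EdgeSet} (hN : (G.contract D).NoHalfExternal)
    (E : (G.shrink D).EdgeSet) : shrinkEdges D (unionLift hN E) = E := by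
  rw [shrinkEdges, contractEdges_unionLift]
  exact eraseEdges_liftEdges hN E

theorem Saturated.chain_cutOutside {E : G.EdgeSet} (hE : Saturated E) {x y : G.HalfEdge}
    (hx : x ∈ E.1) (h : G.chain x y) : (G.cutOutside E).chain x y := by
  refine ((chain_mem_iff (A := {z | z ∈ E.1 ∧ (G.cutOutside E).chain x z}) ?_ ?_ h).1
    ⟨hx, (G.cutOutside E).chain.refl x⟩).2
  · rintro z ⟨h1, h2⟩
    exact ⟨hE.cross_mem h1, Setoid.trans' _ h2 (chain_cross (G := G.cutOutside E) z)⟩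
  · rintro z ⟨h1, h2⟩
    refine ⟨(E.2 z h1).1, Setoid.trans' _ h2 ?_⟩
    have := chain_flip (G := G.cutOutside E) z
    rwa [show (G.cutOutside E).flip z = G.flip z from flipOn_of_mem E h1] at this

/-- Components of the subgraph that leave a trace in the cograph are divergent because their images
in `E` are. A component without trace has all its edges in `D` and is already a component for `D`.
-/
theorem isDivergent_unionLift (hG : G.IsQuartic) {D : G.EdgeSet} (hD : IsDivergent D)
    (hN : (G.contract D).NoHalfExternal) (E : (G.shrink D).EdgeSet) (hE : IsDivergent E) :
    IsDivergent (unionLift hN E) := by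
  obtain ⟨hDb, hDl⟩ := (isDivergent_iff hG D).1 hD
  obtain ⟨hEb, hEl⟩ := (isDivergent_iff (isQuartic_shrink hDl) E).1 hE
  set D' := unionLift hN E with hD'
  have h : D.1 ⊆ D'.1 := subset_unionLift hN E
  have hcE : contractEdges D D' = liftEdges hN E := contractEdges_unionLift hN E
  have hs : Saturated (contractEdges D D') := by
    rw [hcE]
    exact saturated_liftEdges hN E
  have hFb : ((G.cutOutside D').cutOutside (cutEdges D D' h)).Bridgeless := by
    rwa [cutOutside_cutEdges]
  have hFl : ((G.cutOutside D').cutOutside (cutEdges D D' h)).LocallyDivergent := by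
    rwa [cutOutside_cutEdges]
  have hN' : ((G.cutOutside D').contract (cutEdges D D' h)).NoHalfExternal := by
    rw [contract_cutOutside]
    exact hs.noHalfExternal_cutOutside
  have hshr : (G.cutOutside D').shrink (cutEdges D D' h) = (G.shrink D).cutOutside E := by
    rw [shrink_cutOutside h hs, shrinkEdges_unionLift]
  -- By construction the edges added to `D` lie on chains with ends; closed chains, invisible in the
  -- cograph, do not occur.
  have hlift : ∀ z : (G.contract D).HalfEdge, z.1 ∈ D'.1 →
      ∃ x : (G.shrink D).HalfEdge, (G.contract D).chain z x.1 := by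
    intro z hz
    have hz' : z ∈ (contractEdges D D').1 := hz
    rw [hcE] at hz'
    obtain ⟨x, -, hx⟩ := hz'
    exact ⟨x, Setoid.symm' _ hx⟩
  have hlift' : ∀ z : (G.contract D).HalfEdge, z.1 ∈ D'.1 →
      ∃ x : (G.shrink D).HalfEdge,
        ((G.contract D).cutOutside (contractEdges D D')).chain z x.1 := by
    intro z hz
    obtain ⟨x, hx⟩ := hlift z hz
    exact ⟨x, hs.chain_cutOutside (x := z) hz hx⟩
  rw [isDivergent_iff hG]
  constructor
  · rw [← bridgeless_contract_iff hFl.oneBrokenFace hFb]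
    refine hN'.bridgeless_of_erase ?_ ?_
    · have : ((G.cutOutside D').shrink (cutEdges D D' h)).Bridgeless := by rwa [hshr]
      exact this
    · rw [contract_cutOutside]
      intro z hz
      obtain ⟨x, hx⟩ := hlift' z ((flipOn_ne_iff (contractEdges D D') z).1 hz)
      exact ⟨x, hx⟩
  · intro c
    induction c using Quotient.inductionOn with
    | h z =>
      by_cases hz : ∃ x : (G.shrink D).HalfEdge, (G.cutOutside D').connSetoid x.1.1 z
      · obtain ⟨x, hx⟩ := hz
        have hq : Quotient.mk (G.cutOutside D').connSetoid z = Quotient.mk _ x.1.1 :=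
          Quotient.sound (Setoid.symm' _ hx)
        rw [hq]
        have hSl : ((G.cutOutside D').shrink (cutEdges D D' h)).LocallyDivergent := by
          rwa [hshr]
        have hbiv : ∀ y : (G.contract D).HalfEdge,
            y ∈ ((G.cutOutside D').contract (cutEdges D D' h)).bivalent ↔
              y ∈ (G.contract D).bivalent := by
          intro y
          have hr := contract_rot_cutOutside D D' h
          change (_ ∧ _) ↔ (_ ∧ _)
          rw [hr]
          rfl
        exact (isPrimitivelyDivergent_component_shrink_iff hFl hN'
          ⟨x.1, fun h' => x.2 ((hbiv x.1).1 h')⟩).1 (hSl _)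
      · push Not at hz
        -- An edge of `D'` outside `D` would connect `z` to an end of its chain, hence to the
        -- cograph.
        have hsub : ∀ w, (G.cutOutside D').connSetoid z w → w ∈ D'.1 → w ∈ D.1 := by
          intro w hw hwD'
          by_contra hwD
          obtain ⟨x, hx⟩ := hlift' ⟨w, hwD⟩ hwD'
          have h1 := (conn_contract_cutOutside_iff hDl.oneBrokenFace h ⟨w, hwD⟩ x.1).1
            (conn_of_chain hx)
          exact hz x (Setoid.symm' _ (Setoid.trans' _ hw h1))
        let m : Emb ((G.cutOutside D).component (Quotient.mk _ z)) (G.cutOutside D') :=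
          { toFun := fun w => w.1
            injective := Subtype.val_injective
            flip := fun w => by
              have hw : (G.cutOutside D').connSetoid z w.1 :=
                conn_cutOutside_mono h (Quotient.exact w.2.symm)
              change G.flipOn D w.1 = G.flipOn D' w.1
              by_cases hwD : w.1 ∈ D.1
              · rw [flipOn_of_mem D hwD, flipOn_of_mem D' (h hwD)]
              · rw [flipOn_of_notMem D hwD, flipOn_of_notMem D' fun h' => hwD (hsub _ hw h')]
            rot := Or.inl fun _ => rfl }
        exact (m.isomorphic_component (isConnected_component _) _ ⟨z, rfl⟩
          rfl).isPrimitivelyDivergent (hDl _)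

end RibbonGraph

namespace RibbonGraph

variable {G A B : RibbonGraph}

open FirstReturn

/-! ### Nested divergent subgraphs -/

/-- The cograph of `D` cannot be empty, since that of the larger `D'` is obtained from it by further
shrinking. -/
theorem mem_divergentSubgraphs_of_subset (hG : G.IsQuartic) {D D' : G.EdgeSet}
    (hD' : D' ∈ G.divergentSubgraphs) (hD : IsDivergent D) (hne : D.1.Nonempty)
    (h : D.1 ⊆ D'.1) : D ∈ G.divergentSubgraphs := by
  obtain ⟨-, h2, h3, h4⟩ := mem_divergentSubgraphs.1 hD'
  refine mem_divergentSubgraphs.2 ⟨hne, fun h' => h2 ?_, hD, ?_⟩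
  · exact Set.Subset.antisymm (subset_allEdges D') (h' ▸ h)
  · have hs := saturated_contractEdges ((isDivergent_iff hG D).1 hD).2.oneBrokenFace
      ((isDivergent_iff hG D').1 h3).1
    obtain ⟨x⟩ := (isomorphic_shrink_shrink h hs).symm.nonempty h4
    exact ⟨x.1.1⟩

/-- Every internal edge outside `D` is visible at an end of its chain in the cograph; so an edge in
`D'` but not in `D`, and one outside `D'`, show that the image is neither empty nor full. -/
theorem shrinkEdges_mem (hG : G.IsFeynman1PI) {D D' : G.EdgeSet} (hD : D ∈ G.divergentSubgraphs)
    (hD' : D' ∈ G.divergentSubgraphs) (h : D.1 ⊂ D'.1) :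
    shrinkEdges D D' ∈ (G.shrink D).divergentSubgraphs := by
  obtain ⟨-, -, hd, hn⟩ := mem_divergentSubgraphs.1 hD
  obtain ⟨-, hne', hd', hn'⟩ := mem_divergentSubgraphs.1 hD'
  have hone := ((isDivergent_iff hG.1 D).1 hd).2.oneBrokenFace
  obtain ⟨hc, -, hb⟩ := is1PI_iff.1 hG.2
  have hs := saturated_contractEdges hone ((isDivergent_iff hG.1 D').1 hd').1
  refine mem_divergentSubgraphs.2 ⟨?_, fun hall => ?_, isDivergent_shrinkEdges hG.1 hd hd' h.1,
    (isomorphic_shrink_shrink h.1 hs).symm.nonempty hn'⟩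
  · obtain ⟨z, hz, hzD⟩ := Set.exists_of_ssubset h
    obtain ⟨x, hx⟩ := exists_chain_shrink hone hc hn ⟨z, hzD⟩
    exact ⟨x, (mem_shrinkEdges hs x).2 ((hs.mem_iff_of_chain hx).1 hz)⟩
  · obtain ⟨z, hz, hzf⟩ := exists_notMem_of_ne_allEdges hne'
    obtain ⟨x, hx⟩ := exists_chain_shrink hone hc hn ⟨z, fun h' => hz (h.1 h')⟩
    have hxi : x ∈ (G.shrink D).allEdges.1 := (noHalfExternal_contract hone hb).erase_flip_ne
      (h := ⟨z, fun h' => hz (h.1 h')⟩) (fun h => hzf (congrArg Subtype.val h)) hx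
    rw [← hall, mem_shrinkEdges hs] at hxi
    exact hz ((hs.mem_iff_of_chain hx).2 hxi)

/-- Outside `D`, saturated sets are determined by the ends of the chains they contain. -/
theorem shrinkEdges_injective (hG : G.IsFeynman1PI) {D D' D'' : G.EdgeSet}
    (hD : D ∈ G.divergentSubgraphs) (hD' : IsDivergent D') (hD'' : IsDivergent D'')
    (h' : D.1 ⊆ D'.1) (h'' : D.1 ⊆ D''.1) (heq : shrinkEdges D D' = shrinkEdges D D'') :
    D' = D'' := by
  obtain ⟨-, -, hd, hn⟩ := mem_divergentSubgraphs.1 hD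
  have hone := ((isDivergent_iff hG.1 D).1 hd).2.oneBrokenFace
  obtain ⟨hc, -, -⟩ := is1PI_iff.1 hG.2
  have hs' := saturated_contractEdges hone ((isDivergent_iff hG.1 D').1 hD').1
  have hs'' := saturated_contractEdges hone ((isDivergent_iff hG.1 D'').1 hD'').1
  refine Subtype.ext (Set.ext fun z => ?_)
  by_cases hz : z ∈ D.1
  · exact ⟨fun _ => h'' hz, fun _ => h' hz⟩
  · obtain ⟨x, hx⟩ := exists_chain_shrink hone hc hn ⟨z, hz⟩
    refine (hs'.mem_iff_of_chain hx).trans (Iff.trans ?_ (hs''.mem_iff_of_chain hx).symm)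
    refine (mem_shrinkEdges hs' x).symm.trans (Iff.trans ?_ (mem_shrinkEdges hs'' x))
    rw [heq]

/-- The preimage is `unionLift`: `D` together with all chains that form an edge of `E`. -/
theorem exists_shrinkEdges_eq (hG : G.IsFeynman1PI) {D : G.EdgeSet}
    (hD : D ∈ G.divergentSubgraphs) {E : (G.shrink D).EdgeSet}
    (hE : E ∈ (G.shrink D).divergentSubgraphs) :
    ∃ D' ∈ G.divergentSubgraphs, D.1 ⊂ D'.1 ∧ shrinkEdges D D' = E := by
  obtain ⟨⟨z, hz⟩, -, hd, hn⟩ := mem_divergentSubgraphs.1 hD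
  obtain ⟨⟨y, hy⟩, hEne, hEd, hEn⟩ := mem_divergentSubgraphs.1 hE
  have hone := ((isDivergent_iff hG.1 D).1 hd).2.oneBrokenFace
  have hN := noHalfExternal_contract hone (is1PI_iff.1 hG.2).2.2
  have hdiv := isDivergent_unionLift hG.1 hd hN E hEd
  have hsub := subset_unionLift hN E
  have hs := saturated_contractEdges hone ((isDivergent_iff hG.1 _).1 hdiv).1
  have hmem : ∀ x : (G.shrink D).HalfEdge, x ∈ E.1 ↔ x.1.1 ∈ (unionLift hN E).1 := by
    intro x
    rw [← mem_shrinkEdges hs x, shrinkEdges_unionLift]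
  refine ⟨unionLift hN E, mem_divergentSubgraphs.2 ⟨⟨z, hsub hz⟩, fun hall => ?_, hdiv, ?_⟩,
    ⟨hsub, fun h => y.1.2 (h ((hmem y).1 hy))⟩, shrinkEdges_unionLift hN E⟩
  · obtain ⟨x, hx, hxf⟩ := exists_notMem_of_ne_allEdges hEne
    refine hx ((hmem x).2 ?_)
    rw [hall]
    intro hf
    exact hxf ((hN.erase_flip_eq_iff x).2 (Subtype.ext hf))
  · refine (isomorphic_shrink_shrink hsub hs).nonempty ?_
    rwa [shrinkEdges_unionLift]

/-- The empty edge set. -/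
def noEdges (G : RibbonGraph) : G.EdgeSet := ⟨∅, fun _ h => h.elim⟩

theorem isDivergent_noEdges : IsDivergent G.noEdges := by
  rintro ⟨c, h, hh, -⟩
  exact hh.elim

/-- Shrinking nothing changes nothing. -/
theorem exists_emb_shrink_noEdges (hG : G.IsQuartic) :
    ∃ m : Emb (G.shrink G.noEdges) G, Function.Bijective m := by
  have hrot : ∀ x : (G.contract G.noEdges).HalfEdge,
      ((G.contract G.noEdges).rot x).1 = G.rot x.1 := by
    intro x
    have h1 : (G.rot * G.flipOn G.noEdges) x.1 = G.rot x.1 := by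
      rw [Equiv.Perm.mul_apply, flipOn_of_notMem G.noEdges x.2]
    have h2 : (G.rot * G.flipOn G.noEdges) x.1 ∈ (G.noEdges.1)ᶜ := fun h => h.elim
    exact (ret_of_apply_mem h2).trans h1
  let m : Emb (G.contract G.noEdges) G :=
    { toFun := Subtype.val
      injective := Subtype.val_injective
      flip := fun _ => rfl
      rot := Or.inl hrot }
  have hbiv : ∀ x, x ∉ (G.contract G.noEdges).bivalent := by
    intro x hx
    have := (mem_bivalent_iff _).1 ((m.mem_bivalent_iff x).1 hx)
    rw [hG] at this
    omega
  refine ⟨⟨fun x => x.1.1, fun x y h => Subtype.ext (Subtype.ext h), fun x => ?_,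
    Or.inl fun x => hrot x.1⟩, fun x y h => Subtype.ext (Subtype.ext h),
    fun y => ⟨⟨⟨y, fun h => h.elim⟩, hbiv _⟩, rfl⟩⟩
  have h1 : ((G.contract G.noEdges).flip * (G.contract G.noEdges).crossBivalent) x.1 =
      (G.contract G.noEdges).flip x.1 := by
    rw [Equiv.Perm.mul_apply, crossBivalent_of_notMem x.2]
  have h2 : ((G.contract G.noEdges).flip * (G.contract G.noEdges).crossBivalent) x.1 ∈
    ((G.contract G.noEdges).bivalent)ᶜ := hbiv _
  exact congrArg Subtype.val ((ret_of_apply_mem h2).trans h1)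

/-- Shrinking all edges leaves no internal edges. -/
theorem shrink_allEdges_flip (x : (G.shrink G.allEdges).HalfEdge) :
    (G.shrink G.allEdges).flip x = x := by
  have h1 : ((G.contract G.allEdges).flip * (G.contract G.allEdges).crossBivalent) x.1 = x.1 := by
    rw [Equiv.Perm.mul_apply, crossBivalent_of_notMem x.2]
    exact Subtype.ext (not_not.1 x.1.2)
  have h2 : ((G.contract G.allEdges).flip * (G.contract G.allEdges).crossBivalent) x.1 ∈
      ((G.contract G.allEdges).bivalent)ᶜ := by
    rw [h1]
    exact x.2
  exact Subtype.ext ((ret_of_apply_mem h2).trans h1)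

theorem flip_ne_of_shrink_flip_ne {D : G.EdgeSet} {x : (G.shrink D).HalfEdge}
    (hx : (G.shrink D).flip x ≠ x) : G.flip x.1.1 ≠ x.1.1 := by
  intro h
  refine hx ?_
  have h1 : ((G.contract D).flip * (G.contract D).crossBivalent) x.1 = x.1 := by
    rw [Equiv.Perm.mul_apply, crossBivalent_of_notMem x.2]
    exact Subtype.ext h
  have h2 : ((G.contract D).flip * (G.contract D).crossBivalent) x.1 ∈
      ((G.contract D).bivalent)ᶜ := by
    rw [h1]
    exact x.2
  exact Subtype.ext ((ret_of_apply_mem h2).trans h1)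

/-- The cograph of a proper subgraph of a 1PI graph with external edges is not a closed line. -/
theorem nonempty_shrink (hG : G.IsFeynman1PI) (hext : ∃ h, G.flip h = h) {D : G.EdgeSet}
    (hD : IsDivergent D) (hne : D.1 ≠ G.allEdges.1) : Nonempty (G.shrink D).HalfEdge := by
  obtain ⟨h, hh⟩ := hext
  have hone := ((isDivergent_iff hG.1 D).1 hD).2.oneBrokenFace
  obtain ⟨hc, -, hb⟩ := is1PI_iff.1 hG.2
  have hN := noHalfExternal_contract hone hb
  have hhD : h ∉ D.1 := fun h' => (D.2 h h').2 hh
  by_contra hemp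
  have hbiv : (⟨h, hhD⟩ : (G.contract D).HalfEdge) ∈ (G.contract D).bivalent := by
    by_contra hnb
    exact hemp ⟨⟨⟨h, hhD⟩, hnb⟩⟩
  -- If the cograph were empty, `h` would sit at a bivalent vertex of the contraction, whose two
  -- half-edges are then both external. The component of `h` has no way out and is the whole graph,
  -- contrary to the edge outside `D`.
  have hext : ∀ z, (G.cutOutside D).connSetoid h z → z ∉ D.1 → G.flip z = z := by
    intro z hz hzD
    rcases eq_or_eq_rot_of_bivalent hone (z := ⟨z, hzD⟩) hbiv hz with h1 | h1
    · rw [show z = h from congrArg Subtype.val h1, hh]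
    · have h2 := hN _ hbiv (Subtype.ext hh)
      rw [← h1] at h2
      exact congrArg Subtype.val h2
  obtain ⟨z, hz, hzf⟩ := exists_notMem_of_ne_allEdges hne
  refine hzf (hext z ?_ hz)
  refine (conn_mem_iff (G := G) (A := {z : G.HalfEdge | (G.cutOutside D).connSetoid h z})
    (fun w hw => ?_)
    (fun w hw => ?_) (hc.2 h z)).1 ((G.cutOutside D).connSetoid.refl h)
  · exact Setoid.trans' _ hw ((G.cutOutside D).connSetoid_rot w)
  · by_cases hwD : w ∈ D.1
    · have h1 := (G.cutOutside D).connSetoid_flip w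
      rw [show (G.cutOutside D).flip w = G.flip w from flipOn_of_mem D hwD] at h1
      exact Setoid.trans' _ hw h1
    · change (G.cutOutside D).connSetoid h (G.flip w)
      rw [hext w hw hwD]
      exact hw

theorem locallyDivergent_of_isConnected (hc : G.IsConnected) (hG : G.IsPrimitivelyDivergent) :
    G.LocallyDivergent := fun c =>
  ((Emb.ofComponent G c).isomorphic_of_isConnected (isConnected_component c)
    hc).symm.isPrimitivelyDivergent hG

theorem isDivergent_allEdges (hG : G.IsFeynman1PI) (hd : G.IsPrimitivelyDivergent) :
    IsDivergent G.allEdges := by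
  rw [isDivergent_iff hG.1, cutOutside_allEdges]
  exact ⟨(is1PI_iff.1 hG.2).2.2, locallyDivergent_of_isConnected hG.2.1 hd⟩

/-! ### Isomorphic graphs have the same divergent subgraphs -/

theorem Emb.isDivergent_pullEdges_iff (m : Emb B A) (hm : Function.Bijective m) (E : A.EdgeSet) :
    IsDivergent (m.pullEdges E) ↔ IsDivergent E := by
  constructor
  · rintro h ⟨_, y, hy, rfl⟩
    obtain ⟨x, rfl⟩ := hm.2 y
    have hiso := m.isomorphic_subComponent (F := m.pullEdges E) (E := E) (fun _ => Iff.rfl)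
      ⟨_, x, hy, rfl⟩
    have hx := h ⟨_, x, hy, rfl⟩
    exact ⟨hiso.is1PI hx.1, hiso.isPrimitivelyDivergent hx.2⟩
  · intro h c
    have hiso := m.isomorphic_subComponent (F := m.pullEdges E) (E := E) (fun _ => Iff.rfl) c
    have hx := h (m.subComponentMap (F := m.pullEdges E) (E := E) (fun _ => Iff.rfl) c)
    exact ⟨hiso.symm.is1PI hx.1, hiso.symm.isPrimitivelyDivergent hx.2⟩

theorem Emb.isomorphic_shrink (m : Emb B A) (hm : Function.Bijective m) (E : A.EdgeSet) :
    Isomorphic (B.shrink (m.pullEdges E)) (A.shrink E) := by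
  refine (m.shrink (m.pullEdges E) E fun _ => Iff.rfl).isomorphic_of_surjective
    (Emb.eraseBivalent_surjective _ fun y => ?_)
  obtain ⟨x, hx⟩ := hm.2 y.1
  exact ⟨⟨x, fun h => y.2 (hx ▸ h)⟩, Subtype.ext hx⟩

theorem Emb.pullEdges_mem_iff (m : Emb B A) (hm : Function.Bijective m) (E : A.EdgeSet) :
    m.pullEdges E ∈ B.divergentSubgraphs ↔ E ∈ A.divergentSubgraphs := by
  rw [mem_divergentSubgraphs, mem_divergentSubgraphs, m.isDivergent_pullEdges_iff hm]
  have hflip : ∀ x, A.flip (m x) = m x ↔ B.flip x = x := fun x => by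
    rw [← m.flip, m.injective.eq_iff]
  refine and_congr ?_ (and_congr (not_congr ?_) (and_congr Iff.rfl
    ⟨(m.isomorphic_shrink hm E).nonempty, (m.isomorphic_shrink hm E).symm.nonempty⟩))
  · exact ⟨fun ⟨x, hx⟩ => ⟨m x, hx⟩, fun ⟨y, hy⟩ => by
      obtain ⟨x, rfl⟩ := hm.2 y
      exact ⟨x, hy⟩⟩
  · simp only [Set.ext_iff]
    refine ⟨fun h y => ?_, fun h x => ?_⟩
    · obtain ⟨x, rfl⟩ := hm.2 y
      exact (h x).trans (not_congr (hflip x)).symm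
    · exact (h (m x)).trans (not_congr (hflip x))

theorem Emb.pullEdges_injective (m : Emb B A) (hm : Function.Bijective m) :
    Function.Injective m.pullEdges := by
  intro E E' h
  refine Subtype.ext (Set.ext fun y => ?_)
  obtain ⟨x, rfl⟩ := hm.2 y
  exact Set.ext_iff.1 (congrArg Subtype.val h) x

theorem Emb.pullEdges_surjective (m : Emb B A) : Function.Surjective m.pullEdges := by
  intro F
  refine ⟨⟨{y | ∃ x ∈ F.1, m x = y}, ?_⟩, Subtype.ext (Set.ext fun x => ⟨?_, fun h => ⟨x, h, rfl⟩⟩)⟩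
  · rintro _ ⟨x, hx, rfl⟩
    exact ⟨⟨B.flip x, (F.2 x hx).1, m.flip x⟩, fun h => (F.2 x hx).2 (m.injective
      (by rw [m.flip, h]))⟩
  · rintro ⟨z, hz, hzx⟩
    rwa [← m.injective hzx]

end RibbonGraph

namespace RibbonGraph

variable {G A B : RibbonGraph}

/-! ### Components with internal edges -/

/-- The connected components that have internal edges. -/
abbrev EdgeComponent (A : RibbonGraph) : Type :=
  {c : Quotient A.connSetoid // ∃ h, A.flip h ≠ h ∧ Quotient.mk A.connSetoid h = c}

instance (A : RibbonGraph) : Finite A.EdgeComponent :=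
  inferInstanceAs (Finite {c : Quotient A.connSetoid //
    ∃ h, A.flip h ≠ h ∧ Quotient.mk A.connSetoid h = c})

instance (A : RibbonGraph) : Fintype A.EdgeComponent := Fintype.ofFinite _

/-- Components of an embedded graph are components. -/
def Emb.edgeComponentMap (m : Emb B A) (c : B.EdgeComponent) : A.EdgeComponent :=
  ⟨Quotient.map m (fun x y => (m.conn_iff x y).1) c.1, by
    obtain ⟨c, x, hx, rfl⟩ := c
    exact ⟨m x, fun h => hx (m.injective (by rw [m.flip, h])), rfl⟩⟩

theorem Emb.isomorphic_edgeComponent (m : Emb B A) (c : B.EdgeComponent) :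
    Isomorphic (B.component c.1) (A.component (m.edgeComponentMap c).1) := by
  obtain ⟨_, x, hx, rfl⟩ := c
  let m' : Emb (B.component (Quotient.mk _ x)) A :=
    { toFun := fun z => m z.1
      injective := fun a b hab => Subtype.ext (m.injective hab)
      flip := fun z => m.flip z.1
      rot := m.rot.imp (fun h z => h z.1) (fun h z => h z.1) }
  exact m'.isomorphic_component (isConnected_component _) _ ⟨x, rfl⟩ rfl

/-- The edge sets of the divergent subgraphs, the empty and the full one included. -/
def divergentSets (G : RibbonGraph) : Finset G.EdgeSet :=
  Set.Finite.toFinset (s := {D : G.EdgeSet | IsDivergent D}) (Set.toFinite _)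

theorem mem_divergentSets {D : G.EdgeSet} : D ∈ G.divergentSets ↔ IsDivergent D :=
  Set.Finite.mem_toFinset _

theorem isDivergent_iff_componentEdges {F : A.EdgeSet} :
    IsDivergent F ↔ ∀ c : A.EdgeComponent, IsDivergent (componentEdges F c.1) := by
  constructor
  · intro h c d
    have hiso := (Emb.ofComponent A c.1).isomorphic_subComponent (F := componentEdges F c.1)
      (E := F) (fun _ => Iff.rfl) d
    exact ⟨hiso.symm.is1PI (h _).1, hiso.symm.isPrimitivelyDivergent (h _).2⟩
  · rintro h ⟨_, y, hy, rfl⟩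
    have hiso := (Emb.ofComponent A (Quotient.mk _ y)).isomorphic_subComponent
      (F := componentEdges F _) (E := F) (fun _ => Iff.rfl) ⟨_, ⟨y, rfl⟩, hy, rfl⟩
    have hc := h ⟨Quotient.mk _ y, y, (F.2 y hy).2, rfl⟩ ⟨_, ⟨y, rfl⟩, hy, rfl⟩
    exact ⟨hiso.is1PI hc.1, hiso.isPrimitivelyDivergent hc.2⟩

/-- The union of edge sets of the components. -/
def unionComponents (p : ∀ c : A.EdgeComponent, (A.component c.1).EdgeSet) : A.EdgeSet :=
  ⟨{h | ∃ (c : A.EdgeComponent) (x : (A.component c.1).HalfEdge), x ∈ (p c).1 ∧ x.1 = h}, by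
    rintro _ ⟨c, x, hx, rfl⟩
    exact ⟨⟨c, (A.component c.1).flip x, ((p c).2 x hx).1, rfl⟩,
      fun h => ((p c).2 x hx).2 (Subtype.ext h)⟩⟩

theorem componentEdges_unionComponents
    (p : ∀ c : A.EdgeComponent, (A.component c.1).EdgeSet) (c : A.EdgeComponent) :
    componentEdges (unionComponents p) c.1 = p c := by
  refine Subtype.ext (Set.ext fun x => ⟨?_, fun h => ⟨c, x, h, rfl⟩⟩)
  rintro ⟨c', x', hx', heq⟩
  have hc : c' = c := Subtype.ext (by rw [← x.2, ← x'.2, heq])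
  subst hc
  rwa [← Subtype.ext (a1 := x') (a2 := x) heq]

theorem componentEdges_injective {F F' : A.EdgeSet}
    (h : ∀ c : A.EdgeComponent, componentEdges F c.1 = componentEdges F' c.1) : F = F' := by
  refine Subtype.ext (Set.ext fun y => ?_)
  have key : ∀ {F F' : A.EdgeSet},
      (∀ c : A.EdgeComponent, componentEdges F c.1 = componentEdges F' c.1) →
      y ∈ F.1 → y ∈ F'.1 := by
    intro F F' h hy
    have h1 := congrArg Subtype.val (h ⟨Quotient.mk _ y, y, (F.2 y hy).2, rfl⟩)
    exact (Set.ext_iff.1 h1 ⟨y, rfl⟩).1 hy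
  exact ⟨key h, key fun c => (h c).symm⟩

end RibbonGraph

/-! ### Graphs as monomials: products over components -/

namespace HStar

open RibbonGraph

variable (K : Type*) [Field K] {A B G : RibbonGraph}

theorem ofGraph_eq (h : G.IsFeynman1PI) :
    ofGraph K G = MvPolynomial.X (Quotient.mk feynmanSetoid ⟨G, h⟩) := dif_pos h

theorem ofGraph_out (g : FeynmanClass) : ofGraph K g.out.1 = MvPolynomial.X g := by
  rw [ofGraph_eq K g.out.2]
  exact congrArg _ (Quotient.out_eq g)

theorem ofGraph_eq_of_isomorphic (h : Isomorphic A B) : ofGraph K A = ofGraph K B := by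
  by_cases hA : A.IsFeynman1PI
  · rw [ofGraph_eq K hA, ofGraph_eq K (h.isFeynman1PI hA)]
    exact congrArg _ (Quotient.sound h)
  · rw [ofGraph, dif_neg hA, ofGraph, dif_neg fun hB => hA (h.symm.isFeynman1PI hB)]

/-- The product of the components that have internal edges. -/
def ofComponents (A : RibbonGraph) : HStar K := ∏ c : A.EdgeComponent, ofGraph K (A.component c.1)

/-- Components without internal edges are left out of `ofComponents`, so the vertices outside the
subgraph contribute no factor. -/
theorem ofSubgraph_eq (D : G.EdgeSet) : ofSubgraph K G D = ofComponents K (G.cutOutside D) := by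
  let e : G.SubComponent D ≃ (G.cutOutside D).EdgeComponent :=
    Equiv.subtypeEquivRight fun c => exists_congr fun h => and_congr_left' (flipOn_ne_iff D h).symm
  exact Fintype.prod_equiv e _ _ fun c => rfl

/-- A graph covered by disjoint embedded graphs. -/
theorem ofComponents_eq_prod {ι : Type} [Fintype ι] {B : ι → RibbonGraph} (m : ∀ i, Emb (B i) A)
    (h : ∀ y, A.flip y ≠ y → ∃! i, ∃ x, m i x = y) :
    ofComponents K A = ∏ i, ofComponents K (B i) := by
  simp only [ofComponents]
  rw [← Fintype.prod_sigma']
  symm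
  refine Fintype.prod_bijective
    (fun p : Σ i, (B i).EdgeComponent => (m p.1).edgeComponentMap p.2) ⟨?_, ?_⟩ _ _
    fun p => ofGraph_eq_of_isomorphic K ((m p.1).isomorphic_edgeComponent p.2)
  · rintro ⟨i, _, x, hx, rfl⟩ ⟨j, _, y, hy, rfl⟩ heq
    have hxy : A.connSetoid (m i x) (m j y) := Quotient.exact (congrArg Subtype.val heq)
    obtain ⟨z, hz⟩ := (m i).exists_of_conn x _ hxy
    have hij : i = j := (h (m j y) fun h' => hy ((m j).injective (by rw [(m j).flip, h']))).unique
      ⟨z, hz⟩ ⟨y, rfl⟩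
    subst hij
    exact congrArg _ (Subtype.ext (Quotient.sound (((m i).conn_iff x y).2 hxy)))
  · rintro ⟨_, y, hy, rfl⟩
    obtain ⟨i, ⟨x, rfl⟩, -⟩ := h y hy
    exact ⟨⟨i, Quotient.mk _ x, x, fun h' => hy (by rw [← (m i).flip, h']), rfl⟩, rfl⟩

theorem ofComponents_eq_of_emb (m : Emb B A) (hm : Function.Bijective m) :
    ofComponents K A = ofComponents K B := by
  rw [ofComponents_eq_prod K (B := fun _ : Unit => B) (fun _ => m)
    fun y _ => ⟨(), hm.2 y, fun _ _ => rfl⟩]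
  exact Fintype.prod_unique _

theorem ofComponents_eq_one (h : ∀ x, A.flip x = x) : ofComponents K A = 1 := by
  have : IsEmpty A.EdgeComponent := ⟨fun ⟨_, x, hx, _⟩ => hx (h x)⟩
  exact Fintype.prod_empty _

theorem ofComponents_of_isConnected (hA : A.IsConnected) (h : ∃ x, A.flip x ≠ x) :
    ofComponents K A = ofGraph K A := by
  obtain ⟨x, hx⟩ := h
  have : Unique A.EdgeComponent :=
    { default := ⟨Quotient.mk _ x, x, hx, rfl⟩
      uniq := by
        rintro ⟨_, y, hy, rfl⟩
        exact Subtype.ext (Quotient.sound (hA.2 _ _)) }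
  rw [ofComponents, Fintype.prod_unique]
  exact ofGraph_eq_of_isomorphic K
    ((Emb.ofComponent A _).isomorphic_of_isConnected (isConnected_component _) hA)

theorem ofComponents_cutOutside_noEdges : ofComponents K (A.cutOutside A.noEdges) = 1 :=
  ofComponents_eq_one K fun _ => flipOn_of_notMem A.noEdges fun h => h.elim

theorem ofComponents_shrink_allEdges : ofComponents K (A.shrink A.allEdges) = 1 :=
  ofComponents_eq_one K shrink_allEdges_flip

theorem ofComponents_shrink_noEdges (hA : A.IsQuartic) :
    ofComponents K (A.shrink A.noEdges) = ofComponents K A := by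
  obtain ⟨m, hm⟩ := exists_emb_shrink_noEdges hA
  exact (ofComponents_eq_of_emb K m hm).symm

theorem ofComponents_cutOutside_eq_prod (F : A.EdgeSet) :
    ofComponents K (A.cutOutside F) = ∏ c : A.EdgeComponent,
      ofComponents K ((A.component c.1).cutOutside (componentEdges F c.1)) := by
  refine ofComponents_eq_prod K (fun c : A.EdgeComponent =>
    (Emb.ofComponent A c.1).cutOutside (componentEdges F c.1) F fun _ => Iff.rfl) fun y hy => ?_
  have hyF : y ∈ F.1 := (flipOn_ne_iff F y).1 hy
  refine ⟨⟨Quotient.mk _ y, y, (F.2 y hyF).2, rfl⟩, ⟨⟨y, rfl⟩, rfl⟩, ?_⟩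
  rintro c ⟨x, rfl⟩
  exact Subtype.ext x.2.symm

theorem ofComponents_shrink_eq_prod (F : A.EdgeSet) :
    ofComponents K (A.shrink F) = ∏ c : A.EdgeComponent,
      ofComponents K ((A.component c.1).shrink (componentEdges F c.1)) := by
  refine ofComponents_eq_prod K (fun c : A.EdgeComponent =>
    (Emb.ofComponent A c.1).shrink (componentEdges F c.1) F fun _ => Iff.rfl) fun y hy => ?_
  have hyf := flip_ne_of_shrink_flip_ne hy
  let c : Quotient A.connSetoid := Quotient.mk _ y.1.1
  let m := (Emb.ofComponent A c).contract (componentEdges F c) F fun _ => Iff.rfl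
  let z : ((A.component c).contract (componentEdges F c)).HalfEdge := ⟨⟨y.1.1, rfl⟩, y.1.2⟩
  have hz : m z = y.1 := rfl
  refine ⟨⟨c, y.1.1, hyf, rfl⟩, ⟨⟨z, fun h => y.2 ?_⟩, rfl⟩, ?_⟩
  · rw [← hz]
    exact (m.mem_bivalent_iff z).1 h
  · rintro c ⟨x, rfl⟩
    exact Subtype.ext x.1.1.2.symm

end HStar

/-! ### Sums over divergent sets, and divergent sets of cut graphs -/

namespace RibbonGraph

variable {G A B : RibbonGraph}

/-- The full and the empty set, distinct by `hne`, produce the two primitive terms of the coproduct.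
-/
theorem sum_divergentSets {M : Type*} [AddCommMonoid M] (f : A.EdgeSet → M)
    (hA : IsDivergent A.allEdges) (hne : ∃ x, A.flip x ≠ x)
    {s : Finset A.EdgeSet}
    (hs : ∀ F, F ∈ s ↔ IsDivergent F ∧ F.1.Nonempty ∧ F.1 ≠ A.allEdges.1) :
    ∑ F ∈ A.divergentSets, f F = f A.allEdges + f A.noEdges + ∑ F ∈ s, f F := by
  classical
  have h1 : A.noEdges ∉ s := fun h => ((hs _).1 h).2.1.ne_empty rfl
  have h2 : A.allEdges ∉ insert A.noEdges s := by
    rw [Finset.mem_insert, not_or]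
    refine ⟨fun h => ?_, fun h => ((hs _).1 h).2.2 rfl⟩
    obtain ⟨x, hx⟩ := hne
    have hx' : x ∈ A.allEdges.1 := hx
    rw [h] at hx'
    exact hx'
  have h3 : A.divergentSets = insert A.allEdges (insert A.noEdges s) := by
    ext F
    rw [mem_divergentSets, Finset.mem_insert, Finset.mem_insert, hs]
    constructor
    · intro h
      by_cases hall : F.1 = A.allEdges.1
      · exact Or.inl (Subtype.ext hall)
      · rcases Set.eq_empty_or_nonempty F.1 with h' | h'
        · exact Or.inr (Or.inl (Subtype.ext h'))
        · exact Or.inr (Or.inr ⟨h, h', hall⟩)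
    · rintro (rfl | rfl | h)
      · exact hA
      · exact isDivergent_noEdges
      · exact h.1
  rw [h3, Finset.sum_insert h2, Finset.sum_insert h1, add_assoc]

theorem IsPrimitivelyDivergent.exists_flip_eq (h : G.IsPrimitivelyDivergent) :
    ∃ x, G.flip x = x :=
  (numBrokenFaces_eq_one_iff.1 h.2.1).2

/-- An edge set of a graph with edges cut, as an edge set of the graph. -/
def uncutEdges {D : G.EdgeSet} (F : (G.cutOutside D).EdgeSet) : G.EdgeSet :=
  ⟨F.1, fun x hx => by
    have hxD : x ∈ D.1 := (flipOn_ne_iff D x).1 (F.2 x hx).2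
    have h1 : (G.cutOutside D).flip x = G.flip x := flipOn_of_mem D hxD
    have h2 := F.2 x hx
    rwa [h1] at h2⟩

theorem uncutEdges_subset {D : G.EdgeSet} (F : (G.cutOutside D).EdgeSet) :
    (uncutEdges F).1 ⊆ D.1 := fun x hx => (flipOn_ne_iff D x).1 (F.2 x hx).2

theorem allEdges_cutOutside (D : G.EdgeSet) : (G.cutOutside D).allEdges.1 = D.1 :=
  Set.ext fun x => flipOn_ne_iff D x

theorem isDivergent_cutEdges_iff (hG : G.IsQuartic) {D D' : G.EdgeSet} (h : D.1 ⊆ D'.1) :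
    IsDivergent (cutEdges D D' h) ↔ IsDivergent D := by
  rw [isDivergent_iff (G := G.cutOutside D') hG, isDivergent_iff hG, cutOutside_cutEdges]

end RibbonGraph

namespace HStar

open RibbonGraph

variable (K : Type*) [Field K] {A B G : RibbonGraph}

/-! ### The structure maps on graphs -/

/-- The coproduct is defined through the representative `out` of a class; this shows that the choice
does not matter. -/
theorem reducedCoproduct_eq_of_isomorphic (h : Isomorphic A B) :
    reducedCoproduct K A = reducedCoproduct K B := by
  obtain ⟨m, hm⟩ := h.exists_emb
  symm
  refine Finset.sum_bij (fun D _ => m.pullEdges D)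
    (fun D hD => (m.pullEdges_mem_iff hm D).2 hD)
    (fun D _ D' _ h => m.pullEdges_injective hm h) (fun F hF => ?_) (fun D hD => ?_)
  · obtain ⟨D, rfl⟩ := m.pullEdges_surjective F
    exact ⟨D, (m.pullEdges_mem_iff hm D).1 hF, rfl⟩
  · rw [ofSubgraph_eq, ofSubgraph_eq, ofGraph_eq_of_isomorphic K (m.isomorphic_shrink hm D),
      ofComponents_eq_of_emb K (m.cutOutside (m.pullEdges D) D fun _ => Iff.rfl) hm]

theorem coproduct_ofGraph (hG : G.IsFeynman1PI) :
    coproduct K (ofGraph K G) =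
      ofGraph K G ⊗ₜ[K] 1 + 1 ⊗ₜ[K] ofGraph K G + reducedCoproduct K G := by
  have hiso : Isomorphic (Quotient.mk feynmanSetoid ⟨G, hG⟩).out.1 G :=
    Quotient.mk_out (s := feynmanSetoid) ⟨G, hG⟩
  rw [ofGraph_eq K hG, coproduct, MvPolynomial.aeval_X, reducedCoproduct_eq_of_isomorphic K hiso]

theorem counit_ofGraph (G : RibbonGraph) : counit K (ofGraph K G) = 0 := by
  by_cases hG : G.IsFeynman1PI
  · rw [ofGraph_eq K hG, counit, MvPolynomial.aeval_X]
  · rw [ofGraph, dif_neg hG, map_zero]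

theorem counit_ofSubgraph {D : G.EdgeSet} (hD : D.1.Nonempty) :
    counit K (ofSubgraph K G D) = 0 := by
  obtain ⟨x, hx⟩ := hD
  rw [ofSubgraph, map_prod]
  exact Finset.prod_eq_zero (Finset.mem_univ ⟨_, x, hx, rfl⟩) (counit_ofGraph K _)

theorem antipode_ofGraph (hG : G.IsFeynman1PI) :
    antipode K (ofGraph K G) = - ofGraph K G - ∑ D ∈ G.divergentSubgraphs,
      antipode K (ofSubgraph K G D) * ofGraph K (G.shrink D) := by
  have hgen : ∀ g : FeynmanClass, antipodeGen K g = - MvPolynomial.X g -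
      ∑ D ∈ g.out.1.divergentSubgraphs,
        antipode K (ofSubgraph K g.out.1 D) * ofGraph K (g.out.1.shrink D) := by
    intro g
    rw [antipodeGen, ← Finset.sum_attach g.out.1.divergentSubgraphs]
    congr 1
    refine Finset.sum_congr rfl fun D _ => ?_
    congr 1
    rw [ofSubgraph, map_prod]
    refine Finset.prod_congr rfl fun c _ => ?_
    by_cases h : (g.out.1.subComponent D.1 c).IsFeynman1PI
    · rw [dif_pos h, ofGraph_eq K h, antipode, MvPolynomial.aeval_X]
    · rw [dif_neg h, ofGraph, dif_neg h, map_zero]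
  -- Written through `reducedCoproduct`, the sum is invariant under isomorphism, so `out` may be
  -- replaced by `G`.
  have hred : ∀ H : RibbonGraph, ∑ D ∈ H.divergentSubgraphs,
      antipode K (ofSubgraph K H D) * ofGraph K (H.shrink D) =
      Algebra.TensorProduct.productMap (antipode K) (AlgHom.id K _) (reducedCoproduct K H) := by
    intro H
    simp [reducedCoproduct]
  have hiso : Isomorphic (Quotient.mk feynmanSetoid ⟨G, hG⟩).out.1 G :=
    Quotient.mk_out (s := feynmanSetoid) ⟨G, hG⟩
  rw [hred, ← reducedCoproduct_eq_of_isomorphic K hiso, ← hred, ofGraph_eq K hG]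
  conv_lhs => rw [antipode, MvPolynomial.aeval_X, hgen]

/-! ### The coproduct of divergent graphs -/

/-- A divergent graph has external edges, so the condition on nonempty cographs is automatic. Its
coproduct is then one uniform sum, as needed for taking products. -/
theorem coproduct_ofGraph_of_isPrimitivelyDivergent (hG : G.IsFeynman1PI)
    (hd : G.IsPrimitivelyDivergent) :
    coproduct K (ofGraph K G) = ∑ D ∈ G.divergentSets,
      ofComponents K (G.cutOutside D) ⊗ₜ[K] ofComponents K (G.shrink D) := by
  have hc := ofComponents_of_isConnected K hG.2.1 hG.2.2.1
  rw [sum_divergentSets _ (isDivergent_allEdges hG hd) hG.2.2.1 (s := G.divergentSubgraphs),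
    cutOutside_allEdges, ofComponents_shrink_allEdges, ofComponents_cutOutside_noEdges,
    ofComponents_shrink_noEdges K hG.1, hc, coproduct_ofGraph K hG, reducedCoproduct]
  · congr 1
    refine Finset.sum_congr rfl fun D hD => ?_
    obtain ⟨-, h2, h3, h4⟩ := mem_divergentSubgraphs.1 hD
    have hF := isFeynman1PI_shrink hG h2 h3 h4
    rw [ofSubgraph_eq, ofComponents_of_isConnected K hF.2.1 hF.2.2.1]
  · intro F
    rw [mem_divergentSubgraphs]
    exact ⟨fun ⟨h1, h2, h3, h4⟩ => ⟨h3, h1, h2⟩,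
      fun ⟨h3, h1, h2⟩ => ⟨h1, h2, h3, nonempty_shrink hG hd.exists_flip_eq h3 h2⟩⟩

theorem prod_tmul {ι : Type*} (s : Finset ι) (a b : ι → HStar K) :
    ∏ i ∈ s, (a i ⊗ₜ[K] b i) = (∏ i ∈ s, a i) ⊗ₜ[K] ∏ i ∈ s, b i := by
  classical
  induction s using Finset.induction_on with
  | empty => rfl
  | insert i s hi ih =>
    rw [Finset.prod_insert hi, Finset.prod_insert hi, Finset.prod_insert hi, ih,
      Algebra.TensorProduct.tmul_mul_tmul]

/-- The product of the sums over the components expands into choices of one divergent set in each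
component, and these are the divergent sets of `A`. -/
theorem coproduct_ofComponents (hq : A.IsQuartic) (hA : IsDivergent A.allEdges) :
    coproduct K (ofComponents K A) = ∑ F ∈ A.divergentSets,
      ofComponents K (A.cutOutside F) ⊗ₜ[K] ofComponents K (A.shrink F) := by
  classical
  rw [isDivergent_iff hq, cutOutside_allEdges] at hA
  have hc : ∀ c : A.EdgeComponent, coproduct K (ofGraph K (A.component c.1)) =
      ∑ D ∈ (A.component c.1).divergentSets,
        ofComponents K ((A.component c.1).cutOutside D) ⊗ₜ[K]
          ofComponents K ((A.component c.1).shrink D) := by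
    intro c
    refine coproduct_ofGraph_of_isPrimitivelyDivergent K ⟨isQuartic_component hq c.1,
      (is1PI_component_iff c.1).2 ⟨?_, bridgeless_iff_component.1 hA.1 c.1⟩⟩ (hA.2 c.1)
    obtain ⟨x, hx, hxc⟩ := c.2
    exact ⟨⟨x, hxc⟩, hx⟩
  rw [ofComponents, map_prod, Finset.prod_congr rfl fun c _ => hc c, Finset.prod_univ_sum]
  symm
  refine Finset.sum_bij (fun F _ c => componentEdges F c.1) (fun F hF => ?_)
    (fun F _ F' _ h => componentEdges_injective fun c => congrFun h c) (fun p hp => ?_)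
    (fun F hF => ?_)
  · exact Fintype.mem_piFinset.2 fun c => mem_divergentSets.2
      (isDivergent_iff_componentEdges.1 (mem_divergentSets.1 hF) c)
  · refine ⟨unionComponents p, mem_divergentSets.2 (isDivergent_iff_componentEdges.2 fun c => ?_),
      funext fun c => componentEdges_unionComponents p c⟩
    rw [componentEdges_unionComponents]
    exact mem_divergentSets.1 (Fintype.mem_piFinset.1 hp c)
  · rw [prod_tmul, ← ofComponents_cutOutside_eq_prod, ← ofComponents_shrink_eq_prod]

/-- Applies `coproduct_ofComponents` to the cut graph, whose divergent sets are the divergent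
subsets of `D`. By `shrink_cutOutside`, the right factors are subgraphs of the cographs of `G`. -/
theorem coproduct_ofSubgraph (hG : G.IsQuartic) {D : G.EdgeSet} (hD : D ∈ G.divergentSubgraphs)
    {s : Finset G.EdgeSet} (hs : ∀ D', D' ∈ s ↔ D' ∈ G.divergentSubgraphs ∧ D'.1 ⊂ D.1) :
    coproduct K (ofSubgraph K G D) = ofSubgraph K G D ⊗ₜ[K] 1 + 1 ⊗ₜ[K] ofSubgraph K G D +
      ∑ D' ∈ s, ofSubgraph K G D' ⊗ₜ[K] ofSubgraph K (G.shrink D') (shrinkEdges D' D) := by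
  classical
  obtain ⟨⟨x, hx⟩, -, hdiv, -⟩ := mem_divergentSubgraphs.1 hD
  have hall : IsDivergent (G.cutOutside D).allEdges := by
    rw [isDivergent_iff (G := G.cutOutside D) hG, cutOutside_allEdges]
    exact (isDivergent_iff hG D).1 hdiv
  rw [ofSubgraph_eq, coproduct_ofComponents K (A := G.cutOutside D) hG hall,
    sum_divergentSets _ hall ⟨x, (flipOn_ne_iff D x).2 hx⟩
      (s := {F ∈ (G.cutOutside D).divergentSets | F.1.Nonempty ∧
        F.1 ≠ (G.cutOutside D).allEdges.1})
      (fun F => by rw [Finset.mem_filter, mem_divergentSets]),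
    cutOutside_allEdges, ofComponents_shrink_allEdges, ofComponents_cutOutside_noEdges,
    ofComponents_shrink_noEdges K (A := G.cutOutside D) hG]
  congr 1
  have hcut : ∀ F : (G.cutOutside D).EdgeSet,
      cutEdges (uncutEdges F) D (uncutEdges_subset F) = F := fun F => rfl
  have hmem : ∀ F : (G.cutOutside D).EdgeSet, IsDivergent F ↔ IsDivergent (uncutEdges F) :=
    fun F => isDivergent_cutEdges_iff hG (uncutEdges_subset F)
  refine Finset.sum_bij (fun F _ => uncutEdges F) (fun F hF => ?_)
    (fun F _ F' _ h => Subtype.ext (congrArg (fun E : G.EdgeSet => E.1) h)) (fun D' hD' => ?_)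
    (fun F hF => ?_)
  · rw [Finset.mem_filter, mem_divergentSets, hmem, allEdges_cutOutside] at hF
    exact (hs _).2 ⟨mem_divergentSubgraphs_of_subset hG hD hF.1 hF.2.1 (uncutEdges_subset F),
      (uncutEdges_subset F).ssubset_of_ne hF.2.2⟩
  · obtain ⟨h1, h2⟩ := (hs _).1 hD'
    obtain ⟨h3, -, h4, -⟩ := mem_divergentSubgraphs.1 h1
    refine ⟨cutEdges D' D h2.1, ?_, rfl⟩
    rw [Finset.mem_filter, mem_divergentSets, isDivergent_cutEdges_iff hG, allEdges_cutOutside]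
    exact ⟨h4, h3, h2.ne⟩
  · rw [Finset.mem_filter, mem_divergentSets, hmem] at hF
    have hsat := saturated_contractEdges ((isDivergent_iff hG _).1 hF.1).2.oneBrokenFace
      ((isDivergent_iff hG D).1 hdiv).1
    rw [ofSubgraph_eq, ofSubgraph_eq, ← shrink_cutOutside (uncutEdges_subset F) hsat, hcut,
      ← cutOutside_cutEdges (uncutEdges F) D (uncutEdges_subset F), hcut]

end HStar

namespace HStar

open RibbonGraph

variable (K : Type*) [Field K] {G : RibbonGraph}

/-! ### The Hopf algebra axioms -/

theorem algHom_ext_ofGraph {C : Type*} [CommSemiring C] [Algebra K C] {f g : HStar K →ₐ[K] C}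
    (h : ∀ G : RibbonGraph, G.IsFeynman1PI → f (ofGraph K G) = g (ofGraph K G)) : f = g := by
  refine MvPolynomial.algHom_ext fun i => ?_
  rw [← ofGraph_out K i]
  exact h _ i.out.2

/-- After exchanging the sums, `shrinkEdges D'` matches the subgraphs above `D'` with those of its
cograph, and two-step shrinking identifies the last factor. -/
theorem sum_nested (hG : G.IsFeynman1PI) {s : G.EdgeSet → Finset G.EdgeSet}
    (hs : ∀ D D', D' ∈ s D ↔ D' ∈ G.divergentSubgraphs ∧ D'.1 ⊂ D.1) :
    ∑ D ∈ G.divergentSubgraphs, ∑ D' ∈ s D, ofSubgraph K G D' ⊗ₜ[K]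
        (ofSubgraph K (G.shrink D') (shrinkEdges D' D) ⊗ₜ[K] ofGraph K (G.shrink D)) =
      ∑ D' ∈ G.divergentSubgraphs, ∑ E ∈ (G.shrink D').divergentSubgraphs,
        ofSubgraph K G D' ⊗ₜ[K] (ofSubgraph K (G.shrink D') E ⊗ₜ[K]
          ofGraph K ((G.shrink D').shrink E)) := by
  classical
  rw [Finset.sum_comm' (t' := G.divergentSubgraphs)
    (s' := fun D' => {D ∈ G.divergentSubgraphs | D'.1 ⊂ D.1})
    (fun D D' => by rw [hs, Finset.mem_filter]; tauto)]
  refine Finset.sum_congr rfl fun D' hD' => ?_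
  obtain ⟨-, -, hd', -⟩ := mem_divergentSubgraphs.1 hD'
  refine Finset.sum_bij (fun D _ => shrinkEdges D' D) (fun D hD => ?_) (fun D₁ h₁ D₂ h₂ h => ?_)
    (fun E hE => ?_) (fun D hD => ?_)
  · obtain ⟨hD, hlt⟩ := Finset.mem_filter.1 hD
    exact shrinkEdges_mem hG hD' hD hlt
  · obtain ⟨h₁, hlt₁⟩ := Finset.mem_filter.1 h₁
    obtain ⟨h₂, hlt₂⟩ := Finset.mem_filter.1 h₂
    exact shrinkEdges_injective hG hD' (mem_divergentSubgraphs.1 h₁).2.2.1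
      (mem_divergentSubgraphs.1 h₂).2.2.1 hlt₁.1 hlt₂.1 h
  · obtain ⟨D, hD, hlt, h⟩ := exists_shrinkEdges_eq hG hD' hE
    exact ⟨D, Finset.mem_filter.2 ⟨hD, hlt⟩, h⟩
  · obtain ⟨hD, hlt⟩ := Finset.mem_filter.1 hD
    have hsat := saturated_contractEdges ((isDivergent_iff hG.1 D').1 hd').2.oneBrokenFace
      ((isDivergent_iff hG.1 D).1 (mem_divergentSubgraphs.1 hD).2.2.1).1
    rw [ofGraph_eq_of_isomorphic K (isomorphic_shrink_shrink hlt.1 hsat)]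

/-- On a generator both sides have three terms with `Γ` in one slot, three single sums over `γ`, and
one double sum over nested pairs; only the double sums need an argument, `sum_nested`. -/
theorem coassoc_algHom :
    (Algebra.TensorProduct.assoc K K K (HStar K) (HStar K) (HStar K)).toAlgHom.comp
      ((Algebra.TensorProduct.map (coproduct K) (AlgHom.id K _)).comp (coproduct K)) =
    (Algebra.TensorProduct.map (AlgHom.id K _) (coproduct K)).comp (coproduct K) := by
  classical
  refine algHom_ext_ofGraph K (C := HStar K ⊗[K] (HStar K ⊗[K] HStar K)) fun G hG => ?_
  let s : G.EdgeSet → Finset G.EdgeSet := fun D => {D' ∈ G.divergentSubgraphs | D'.1 ⊂ D.1}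
  have hs : ∀ D D', D' ∈ s D ↔ D' ∈ G.divergentSubgraphs ∧ D'.1 ⊂ D.1 :=
    fun D D' => Finset.mem_filter
  have hl : ∀ D ∈ G.divergentSubgraphs,
      Algebra.TensorProduct.assoc K K K (HStar K) (HStar K) (HStar K)
        (coproduct K (ofSubgraph K G D) ⊗ₜ[K] ofGraph K (G.shrink D)) =
      ofSubgraph K G D ⊗ₜ[K] (1 ⊗ₜ[K] ofGraph K (G.shrink D)) +
      1 ⊗ₜ[K] (ofSubgraph K G D ⊗ₜ[K] ofGraph K (G.shrink D)) +
      ∑ D' ∈ s D, ofSubgraph K G D' ⊗ₜ[K]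
        (ofSubgraph K (G.shrink D') (shrinkEdges D' D) ⊗ₜ[K] ofGraph K (G.shrink D)) := by
    intro D hD
    rw [coproduct_ofSubgraph K hG.1 hD (hs D)]
    simp only [TensorProduct.add_tmul, TensorProduct.sum_tmul, map_add, map_sum,
      Algebra.TensorProduct.assoc_tmul]
  have hr : ∀ D ∈ G.divergentSubgraphs,
      ofSubgraph K G D ⊗ₜ[K] coproduct K (ofGraph K (G.shrink D)) =
      ofSubgraph K G D ⊗ₜ[K] (ofGraph K (G.shrink D) ⊗ₜ[K] 1) +
      ofSubgraph K G D ⊗ₜ[K] (1 ⊗ₜ[K] ofGraph K (G.shrink D)) +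
      ∑ E ∈ (G.shrink D).divergentSubgraphs, ofSubgraph K G D ⊗ₜ[K]
        (ofSubgraph K (G.shrink D) E ⊗ₜ[K] ofGraph K ((G.shrink D).shrink E)) := by
    intro D hD
    obtain ⟨-, h2, h3, h4⟩ := mem_divergentSubgraphs.1 hD
    rw [coproduct_ofGraph K (isFeynman1PI_shrink hG h2 h3 h4), reducedCoproduct,
      TensorProduct.tmul_add, TensorProduct.tmul_add, TensorProduct.tmul_sum]
  have hΔ := coproduct_ofGraph K hG
  rw [reducedCoproduct] at hΔ
  change Algebra.TensorProduct.assoc K K K (HStar K) (HStar K) (HStar K)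
    (Algebra.TensorProduct.map (coproduct K) (AlgHom.id K _) (coproduct K (ofGraph K G))) =
    Algebra.TensorProduct.map (AlgHom.id K _) (coproduct K) (coproduct K (ofGraph K G))
  rw [hΔ]
  simp only [map_add, map_sum, Algebra.TensorProduct.map_tmul, AlgHom.id_apply, map_one]
  rw [Finset.sum_congr rfl hl, Finset.sum_congr rfl hr, hΔ]
  simp only [Finset.sum_add_distrib, TensorProduct.add_tmul, TensorProduct.tmul_add,
    TensorProduct.sum_tmul, TensorProduct.tmul_sum, map_add, map_sum,
    Algebra.TensorProduct.assoc_tmul, Algebra.TensorProduct.one_def]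
  rw [sum_nested K hG hs]
  abel

theorem counit_left_algHom :
    (Algebra.TensorProduct.map (counit K) (AlgHom.id K (HStar K))).comp (coproduct K) =
      Algebra.TensorProduct.includeRight := by
  refine algHom_ext_ofGraph K fun G hG => ?_
  rw [AlgHom.comp_apply, coproduct_ofGraph K hG, reducedCoproduct]
  simp only [map_add, map_sum, Algebra.TensorProduct.map_tmul, AlgHom.id_apply, map_one,
    counit_ofGraph, TensorProduct.zero_tmul, zero_add, Algebra.TensorProduct.includeRight_apply]
  rw [Finset.sum_eq_zero, add_zero]
  intro D hD
  rw [counit_ofSubgraph K (mem_divergentSubgraphs.1 hD).1, TensorProduct.zero_tmul]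

theorem counit_right_algHom :
    (Algebra.TensorProduct.map (AlgHom.id K (HStar K)) (counit K)).comp (coproduct K) =
      Algebra.TensorProduct.includeLeft := by
  refine algHom_ext_ofGraph K fun G hG => ?_
  rw [AlgHom.comp_apply, coproduct_ofGraph K hG, reducedCoproduct]
  simp [counit_ofGraph]

/-- The convolution product of algebra endomorphisms. -/
def conv (f g : HStar K →ₐ[K] HStar K) : HStar K →ₐ[K] HStar K :=
  (Algebra.TensorProduct.productMap f g).comp (coproduct K)

theorem conv_assoc (f g h : HStar K →ₐ[K] HStar K) :
    conv K (conv K f g) h = conv K f (conv K g h) := by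
  have h1 : conv K (conv K f g) h =
      (Algebra.TensorProduct.productMap (Algebra.TensorProduct.productMap f g) h).comp
        ((Algebra.TensorProduct.map (coproduct K) (AlgHom.id K _)).comp (coproduct K)) := by
    rw [← AlgHom.comp_assoc, conv]
    congr 1
    refine Algebra.TensorProduct.ext' fun a b => ?_
    simp [conv]
  have h2 : conv K f (conv K g h) =
      (Algebra.TensorProduct.productMap f (Algebra.TensorProduct.productMap g h)).comp
        ((Algebra.TensorProduct.map (AlgHom.id K _) (coproduct K)).comp (coproduct K)) := by
    rw [← AlgHom.comp_assoc, conv]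
    congr 1
    refine Algebra.TensorProduct.ext' fun a b => ?_
    simp [conv]
  have h3 : Algebra.TensorProduct.productMap (Algebra.TensorProduct.productMap f g) h =
      (Algebra.TensorProduct.productMap f (Algebra.TensorProduct.productMap g h)).comp
        (Algebra.TensorProduct.assoc K K K (HStar K) (HStar K) (HStar K)).toAlgHom := by
    refine Algebra.TensorProduct.ext (Algebra.TensorProduct.ext' fun a b => ?_)
      (AlgHom.ext fun c => ?_)
    · simp
    · simp [Algebra.TensorProduct.one_def]
  rw [h1, h2, ← coassoc_algHom, h3]
  rfl

theorem conv_ofGraph (f g : HStar K →ₐ[K] HStar K) (hG : G.IsFeynman1PI) :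
    conv K f g (ofGraph K G) = f (ofGraph K G) + g (ofGraph K G) +
      ∑ D ∈ G.divergentSubgraphs, f (ofSubgraph K G D) * g (ofGraph K (G.shrink D)) := by
  rw [conv, AlgHom.comp_apply, coproduct_ofGraph K hG, reducedCoproduct]
  simp

/-- The unit of the convolution product. -/
def convOne : HStar K →ₐ[K] HStar K := (Algebra.ofId K (HStar K)).comp (counit K)

theorem convOne_ofGraph (G : RibbonGraph) : convOne K (ofGraph K G) = 0 := by
  rw [convOne, AlgHom.comp_apply, counit_ofGraph, map_zero]

theorem conv_convOne (f : HStar K →ₐ[K] HStar K) : conv K f (convOne K) = f := by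
  refine algHom_ext_ofGraph K fun G hG => ?_
  simp [conv_ofGraph K _ _ hG, convOne_ofGraph]

/-- The recursion defining `S` is this identity solved for `S Γ`. -/
theorem conv_antipode_id : conv K (antipode K) (AlgHom.id K _) = convOne K := by
  refine algHom_ext_ofGraph K fun G hG => ?_
  rw [conv_ofGraph K _ _ hG, antipode_ofGraph K hG, convOne_ofGraph]
  simp only [AlgHom.id_apply]
  ring

/-- A left unit of the identity for the convolution product is the unit. -/
theorem eq_convOne_of_conv_id {e : HStar K →ₐ[K] HStar K}
    (he : conv K e (AlgHom.id K _) = AlgHom.id K _) : e = convOne K := by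
  have key : ∀ n, ∀ G : RibbonGraph, G.IsFeynman1PI → G.numInternalHalfEdges = n →
      e (ofGraph K G) = 0 := by
    intro n
    induction n using Nat.strong_induction_on with
    | _ n ih =>
      intro G hG hn
      have h := DFunLike.congr_fun he (ofGraph K G)
      rw [conv_ofGraph K _ _ hG, Finset.sum_eq_zero] at h
      · simpa using h
      -- As `D` is nonempty, it has a component, and `e` kills that component by induction.
      · intro D hD
        obtain ⟨⟨x, hx⟩, -, hd, -⟩ := mem_divergentSubgraphs.1 hD
        rw [ofSubgraph, map_prod, Finset.prod_eq_zero (Finset.mem_univ ⟨_, x, hx, rfl⟩), zero_mul]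
        exact ih _ (hn ▸ numInternalHalfEdges_subComponent_lt G D hD _) _
          (isFeynman1PI_subComponent hG.1 hd _) rfl
  refine algHom_ext_ofGraph K fun G hG => ?_
  rw [key _ G hG rfl, convOne_ofGraph]

/-- With `e = id * S`, associativity gives `e * id = id * (S * id) = id`, so `e` is the unit. -/
theorem conv_id_antipode : conv K (AlgHom.id K _) (antipode K) = convOne K := by
  refine eq_convOne_of_conv_id K ?_
  rw [conv_assoc, conv_antipode_id, conv_convOne]

theorem isHopfAlgebra :
    IsHopfAlgebra K (HStar K) (coproduct K).toLinearMap (counit K).toLinearMap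
      (antipode K).toLinearMap where
  coassoc := congrArg AlgHom.toLinearMap (coassoc_algHom K)
  counit_left := congrArg AlgHom.toLinearMap (counit_left_algHom K)
  counit_right := congrArg AlgHom.toLinearMap (counit_right_algHom K)
  comul_one := map_one (coproduct K)
  comul_mul := map_mul (coproduct K)
  counit_one := map_one (counit K)
  counit_mul := map_mul (counit K)
  antipode_left := by
    have h : LinearMap.mul' K (HStar K) ∘ₗ (antipode K).toLinearMap.rTensor (HStar K) =
        (Algebra.TensorProduct.productMap (antipode K) (AlgHom.id K _)).toLinearMap :=
      TensorProduct.ext' fun a b => by simp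
    rw [← LinearMap.comp_assoc, h]
    exact congrArg AlgHom.toLinearMap (conv_antipode_id K)
  antipode_right := by
    have h : LinearMap.mul' K (HStar K) ∘ₗ (antipode K).toLinearMap.lTensor (HStar K) =
        (Algebra.TensorProduct.productMap (AlgHom.id K _) (antipode K)).toLinearMap :=
      TensorProduct.ext' fun a b => by simp
    rw [← LinearMap.comp_assoc, h]
    exact congrArg AlgHom.toLinearMap (conv_id_antipode K)

end HStar

end

theorem theorem4p1 (K : Type*) [Field K] :
    -- components of divergent subgraphs, and cographs, are again 1PI Feynman graphs
    (∀ Γ : RibbonGraph, Γ.IsFeynman1PI → ∀ D ∈ Γ.divergentSubgraphs,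
      (∀ c, (Γ.subComponent D c).IsFeynman1PI) ∧ (Γ.shrink D).IsFeynman1PI) ∧
    -- the coproduct, the counit and the antipode of each graph
    (∀ Γ : RibbonGraph, Γ.IsFeynman1PI →
      HStar.coproduct K (HStar.ofGraph K Γ) =
        HStar.ofGraph K Γ ⊗ₜ[K] 1 + 1 ⊗ₜ[K] HStar.ofGraph K Γ +
          ∑ D ∈ Γ.divergentSubgraphs,
            HStar.ofSubgraph K Γ D ⊗ₜ[K] HStar.ofGraph K (Γ.shrink D)) ∧
    (∀ Γ : RibbonGraph, Γ.IsFeynman1PI → HStar.counit K (HStar.ofGraph K Γ) = 0) ∧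
    (∀ Γ : RibbonGraph, Γ.IsFeynman1PI →
      HStar.antipode K (HStar.ofGraph K Γ) =
        - HStar.ofGraph K Γ - ∑ D ∈ Γ.divergentSubgraphs,
          HStar.antipode K (HStar.ofSubgraph K Γ D) * HStar.ofGraph K (Γ.shrink D)) ∧
    -- the Hopf algebra axioms
    IsHopfAlgebra K (HStar K) (HStar.coproduct K).toLinearMap (HStar.counit K).toLinearMap
      (HStar.antipode K).toLinearMap := by
  refine ⟨fun Γ hΓ D hD => ?_, fun Γ hΓ => HStar.coproduct_ofGraph K hΓ,
    fun Γ _ => HStar.counit_ofGraph K Γ, fun Γ hΓ => HStar.antipode_ofGraph K hΓ,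
    HStar.isHopfAlgebra K⟩
  obtain ⟨-, h2, h3, h4⟩ := RibbonGraph.mem_divergentSubgraphs.1 hD
  exact ⟨RibbonGraph.isFeynman1PI_subComponent hΓ.1 h3,
    RibbonGraph.isFeynman1PI_shrink hΓ h2 h3 h4⟩
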